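/- Let $I=(a,b)$ with $-\infty<a<b<\infty$ and write $\hat f(p)=\int_{\mathbb R}e^{ipx}f(x)\,dx$. A vector of one of the spaces below "is the function $g$" if $g$ is integrable and the vector is given by $\hat g$. *Vacuum.* Let $\mathcal H=L^2(\mathbb R_+,\tfrac1\pi p\,dp)$ with $\langle f,g\rangle=\frac1\pi\int_0^\infty\overline{\hat f(p)}\,\hat g(p)\,p\,dp$ for real functions $f,g$. *Thermal case, $\beta>0$.* Let $\mathcal K$ be the real Hilbert space $L^2(\mathbb R_+,\frac1\pi p\coth(\beta p/2)\,dp)$ of complex functions, that is, the completion of $C_c^\infty(\mathbb R)$ (real functions) for $\tau_\beta(f,g)=\frac1\pi\,\mathrm{Re}\int_0^\infty\overline{\hat f}\,\hat g\;p\coth(\beta p/2)\,dp$. Let $D=C|D|$ be the operator with $\int fg'\,dx=\tau_\beta(f,Dg)$, i.e. multiplication by $-i\tanh(\beta p/2)$, with $C=-i$ and $|D|=\tanh(\beta p/2)$. Let $\mathcal H^\oplus$ be $\mathcal K\oplus\mathcal K$ with the complex structure $i^\oplus=\begin{pmatrix}-D& C\sqrt{1+D^2}\\ C\sqrt{1+D^2}&D\end{pmatrix}$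 and the inner product $\tau^\oplus(\cdot,\cdot)+i\,\tau^\oplus(\cdot,-i^\oplus\,\cdot)$, where $\tau^\oplus=\tau_\beta\oplus\tau_\beta$. A function $g$ is viewed as the vector $g\oplus 0$. In either space let $H(I)$ be the closure of $C_c^\infty(I)$. For a standard subspace $H$ let $S_H(f+ig)=f-ig$ ($f,g\in H$), $\Delta_H=S_H^*S_H$ and $K_H=-\log\Delta_H=i\frac{d}{du}\Delta_H^{iu}|_{u=0}$. Let $H'$ be the symplectic complement of $H$ with respect to $\mathrm{Im}\langle\cdot,\cdot\rangle$. If $H$ is factorial ($H\cap H'=0$), let $P_H:H+H'\to H$, $h+h'\mapsto h$, be the cutting projector. Put $K_I=K_{H(I)}$, $P_I=P_{H(I)}$, and let $\chi_I$ be the indicator function of $I$. **Statement.** In the vacuum space, and in the thermal space for every $\beta>0$, $H(I)$ is standard and factorial. For every real $f\in C_c^\infty(\mathbb R)$ (supported anywhere), the vector $f$ lies in the domain of $K_I$, and $iK_If$ is a real function on the line, namely $$iK_If(x)=-2\pi\,\frac{(x-a)(b-x)}{b-a}\,f'(x)\quad\text{(vacuum)},$$ $$i^\oplus K_If(x)=-2\beta\,\frac{\sinh\!\big(\frac\pi\beta(x-a)\big)\sinh\!\big(\frac\pi\beta(b-x)\big)}{\sinh\!\big(\frac\pi\beta(b-a)\big)}\,f'(x)\quad\text{(thermal)}.$$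 The truncated function $\chi_I\cdot iK_If$ is also a vector of the one-particle space, $iK_If\in H(I)+H(I)'$, and $$P_I\,(iK_If)=\chi_I\cdot iK_If ,$$ with $i^\oplus$ in place of $i$ in the thermal case. -/

import Mathlib

open MeasureTheory Set Filter Topology
open scoped ContDiff ENNReal InnerProductSpace

noncomputable section

/-! ### One-particle modular theory of a standard subspace -/

namespace StandardSubspace

variable {E : Type*} [NormedAddCommGroup E] [InnerProductSpace ℂ E]

/-- The graph of the Tomita operator `S_H`, the antilinear operator with domain `H + iH` and
`S_H (f + i g) = f - i g` for `f, g ∈ H` (it is closed because `H` is). -/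
def TomitaGraph (H : StandardSubspace E) (x y : E) : Prop :=
  ∃ f ∈ H.toClosedSubmodule, ∃ g ∈ H.toClosedSubmodule,
    x = f + Complex.I • g ∧ y = f - Complex.I • g

/-- The graph of the adjoint `S_H^*` of the antilinear operator `S_H`:
`⟪S_H^* y, x⟫ = ⟪S_H x, y⟫` for all `x` in the domain of `S_H`. -/
def TomitaAdjointGraph (H : StandardSubspace E) (y z : E) : Prop :=
  ∀ x s : E, H.TomitaGraph x s → ⟪z, x⟫_ℂ = ⟪s, y⟫_ℂ

/-- The graph of the modular operator `Δ_H = S_H^* S_H`, that is, of the square of the positive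
part in the polar decomposition `S_H = J_H Δ_H^{1/2}`. -/
def ModularOperatorGraph (H : StandardSubspace E) (x y : E) : Prop :=
  ∃ s : E, H.TomitaGraph x s ∧ H.TomitaAdjointGraph s y

/-- `U` is the modular unitary group `u ↦ Δ_H^{iu}`: a strongly continuous one-parameter group of
unitaries whose analytic continuation to the parameter `u = -i` is `Δ_H` (with its exact domain:
`x` belongs to the domain of `Δ_H` if and only if `u ↦ U u x` extends to a continuous function on
the strip `-1 ≤ Im z ≤ 0` which is holomorphic inside, and then `Δ_H x` is its value at `-i`). -/
structure IsModularGroup (H : StandardSubspace E) (U : ℝ → E ≃ₗᵢ[ℂ] E) : Prop where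
  map_add : ∀ (s t : ℝ) (x : E), U (s + t) x = U s (U t x)
  continuous_apply : ∀ x : E, Continuous fun u : ℝ => U u x
  modularOperatorGraph_iff : ∀ x y : E, H.ModularOperatorGraph x y ↔
    ∃ F : ℂ → E, DiffContOnCl ℂ F {z : ℂ | -1 < z.im ∧ z.im < 0} ∧
      (∀ u : ℝ, F u = U u x) ∧ F (-Complex.I) = y

/-- The graph of the modular Hamiltonian `K_H = -log Δ_H = i (d/du) Δ_H^{iu} |_{u = 0}`: the vector
`x` is in its domain and `K_H x = k`. -/
def ModularHamiltonianGraph (H : StandardSubspace E) (x k : E) : Prop :=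
  ∃ U : ℝ → E ≃ₗᵢ[ℂ] E, H.IsModularGroup U ∧
    HasDerivAt (fun u : ℝ => U u x) (-(Complex.I • k)) 0

/-- `H` is factorial: `H ∩ H' = 0`, with `H'` the symplectic complement of `H` for `Im ⟪·, ·⟫`. -/
def IsFactorial (H : StandardSubspace E) : Prop :=
  H.toClosedSubmodule ⊓ H.toClosedSubmodule.symplComp = ⊥

/-- The cutting projector `P_H : H + H' → H`, `h + h' ↦ h`, of a factorial subspace: the partially
defined real-linear map that glues the identity of `H` and the zero map of `H'`. -/
def cuttingProjector (H : StandardSubspace E) (hH : H.IsFactorial) : E →ₗ.[ℝ] E :=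
  LinearPMap.sup
    ⟨H.toClosedSubmodule.toSubmodule, H.toClosedSubmodule.toSubmodule.subtype⟩
    ⟨H.toClosedSubmodule.symplComp.toSubmodule, 0⟩
    (by
      rintro ⟨x, hx⟩ ⟨y, hy⟩ hxy
      obtain rfl : x = y := hxy
      have h0 : x ∈ H.toClosedSubmodule ⊓ H.toClosedSubmodule.symplComp := ⟨hx, hy⟩
      rw [hH] at h0
      have h1 : x = 0 := by simpa using h0
      subst h1
      rfl)

end StandardSubspace

/-! ### Functions on the line -/

/-- The Fourier transform `∫ e^{ipx} g(x) dx` of a real function. -/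
def lineFourier (g : ℝ → ℝ) (p : ℝ) : ℂ :=
  ∫ x : ℝ, Complex.exp (Complex.I * (p * x : ℝ)) * (g x : ℂ)

/-- Given a relation `Rep g v` ("the vector `v` is the function `g`"), the closed real subspace
`H(I)` that is the closure of `C_c^∞(I)`. -/
def localSubspace {E : Type*} [NormedAddCommGroup E] [InnerProductSpace ℂ E]
    (Rep : (ℝ → ℝ) → E → Prop) (I : Set ℝ) : ClosedSubmodule ℝ E :=
  (Submodule.span ℝ {v : E | ∃ φ : ℝ → ℝ, ContDiff ℝ ∞ φ ∧ HasCompactSupport φ ∧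
    tsupport φ ⊆ I ∧ Rep φ v}).closure

/-! ### The vacuum one-particle space -/

/-- The measure `(1/π) p dp` on the positive half-line. -/
def vacuumMeasure : Measure ℝ :=
  (volume.restrict (Ioi 0)).withDensity fun p => ENNReal.ofReal (p / Real.pi)

/-- The vacuum one-particle space `L²(ℝ₊, (1/π) p dp)`, with
`⟪f, g⟫ = (1/π) ∫₀^∞ conj (f̂ p) (ĝ p) p dp`. -/
abbrev VacuumSpace : Type := Lp ℂ 2 vacuumMeasure

/-- The vector `v` of the vacuum one-particle space is the function `g` on the line. -/
def VacuumRep (g : ℝ → ℝ) (v : VacuumSpace) : Prop :=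
  Integrable g ∧ v =ᵐ[vacuumMeasure] lineFourier g

/-! ### Complexification of a real Hilbert space along a complex structure -/

/-- A complex structure on a real inner product space which is compatible with the inner
product. -/
structure OrthogonalComplexStructure (W : Type*) [NormedAddCommGroup W]
    [InnerProductSpace ℝ W] where
  J : W →ₗ[ℝ] W
  sq : ∀ x, J (J x) = -x
  skew : ∀ x y, ⟪J x, y⟫_ℝ = -⟪x, J y⟫_ℝ

section Complexified

variable {W : Type*} [NormedAddCommGroup W] [InnerProductSpace ℝ W]

/-- `W` as a complex Hilbert space, with multiplication by `i` given by `J` and with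
`⟪x, y⟫ = τ(x, y) + i τ(x, -J y)`, where `τ` is the inner product of `W`. -/
def Complexified (_J : OrthogonalComplexStructure W) : Type _ := W

variable (J : OrthogonalComplexStructure W)

instance : NormedAddCommGroup (Complexified J) := inferInstanceAs (NormedAddCommGroup W)

instance [CompleteSpace W] : CompleteSpace (Complexified J) := inferInstanceAs (CompleteSpace W)

namespace Complexified

/-- The identity map from the real Hilbert space to its complexification. -/
def of (x : W) : Complexified J := x

variable {J}

/-- The identity map from the complexification to the real Hilbert space. -/
def val (x : Complexified J) : W := x

variable (J)

instance : SMul ℂ (Complexified J) := ⟨fun z x => of J (z.re • x.val + z.im • J.J x.val)⟩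

instance : Inner ℂ (Complexified J) :=
  ⟨fun x y => ⟨⟪x.val, y.val⟫_ℝ, ⟪x.val, -J.J y.val⟫_ℝ⟩⟩

theorem val_smul (z : ℂ) (x : Complexified J) :
    (z • x).val = z.re • x.val + z.im • J.J x.val := rfl

theorem val_add (x y : Complexified J) : (x + y).val = x.val + y.val := rfl

theorem inner_def (x y : Complexified J) :
    (inner ℂ x y : ℂ) = ⟨⟪x.val, y.val⟫_ℝ, ⟪x.val, -J.J y.val⟫_ℝ⟩ := rfl

theorem inner_J_self (x : W) : ⟪x, J.J x⟫_ℝ = 0 := by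
  have h := J.skew x x
  rw [real_inner_comm] at h
  linarith

theorem val_inj {x y : Complexified J} (h : x.val = y.val) : x = y := h

instance : Module ℂ (Complexified J) where
  one_smul x := by apply val_inj; simp [val_smul]
  mul_smul z w x := by
    apply val_inj
    simp only [val_smul, Complex.mul_re, Complex.mul_im, map_add, map_smul, J.sq]
    module
  smul_zero z := by
    apply val_inj
    change z.re • (0 : W) + z.im • J.J (0 : W) = 0
    simp
  smul_add z x y := by
    apply val_inj
    simp only [val_smul, val_add, map_add]
    module
  add_smul z w x := by
    apply val_inj
    simp only [val_smul, val_add, Complex.add_re, Complex.add_im]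
    module
  zero_smul x := by
    apply val_inj
    simp only [val_smul, Complex.zero_re, Complex.zero_im, zero_smul, add_zero]
    rfl

theorem norm_smul_eq (z : ℂ) (x : Complexified J) : ‖z • x‖ = ‖z‖ * ‖x‖ := by
  have hJ : ‖J.J x.val‖ ^ 2 = ‖x.val‖ ^ 2 := by
    rw [← real_inner_self_eq_norm_sq, ← real_inner_self_eq_norm_sq, J.skew, J.sq, inner_neg_right,
      neg_neg]
  have key : ‖z.re • x.val + z.im • J.J x.val‖ ^ 2 = (‖z‖ * ‖x.val‖) ^ 2 := by
    rw [norm_add_sq_real, inner_smul_left, inner_smul_right, inner_J_self, norm_smul, norm_smul,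
      mul_pow, mul_pow, mul_pow, hJ, Complex.sq_norm, Complex.normSq_apply, Real.norm_eq_abs,
      Real.norm_eq_abs, sq_abs, sq_abs]
    simp
    ring
  exact (sq_eq_sq₀ (norm_nonneg _) (by positivity)).mp key

instance : InnerProductSpace ℂ (Complexified J) where
  norm_smul_le z x := (norm_smul_eq J z x).le
  norm_sq_eq_re_inner x := (real_inner_self_eq_norm_sq x.val).symm
  conj_inner_symm x y := by
    apply Complex.ext
    · simp [inner_def, real_inner_comm]
    · simp only [inner_def, Complex.conj_im, inner_neg_right, neg_neg]
      rw [real_inner_comm, J.skew]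
  add_left x y z := by
    apply Complex.ext
    · simp [inner_def, val_add, inner_add_left]
    · simp [inner_def, val_add, inner_add_left]
      ring
  smul_left x y z := by
    apply Complex.ext
    · simp [inner_def, val_smul, inner_add_left, inner_smul_left, J.skew]
      ring
    · simp [inner_def, val_smul, inner_add_left, inner_smul_left, J.skew, J.sq]
      ring

end Complexified

end Complexified

/-! ### The purified thermal one-particle space -/

/-- The measure `(1/π) p coth(βp/2) dp` on the positive half-line. For real functions,
`(1/π) ∫₀^∞ |f̂ p|² p coth(βp/2) dp = (1/π) ∫_ℝ |f̂ p|² p / (1 - e^{-βp}) dp` is the square of the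
norm for `τ_β`. -/
def thermalMeasure (β : ℝ) : Measure ℝ :=
  (volume.restrict (Ioi 0)).withDensity fun p =>
    ENNReal.ofReal (p * (Real.cosh (β * p / 2) / Real.sinh (β * p / 2)) / Real.pi)

/-- The completion of `C_c^∞(ℝ)` for `τ_β`, in momentum space; it is used as a real Hilbert space,
with `τ_β(f, g) = (1/π) Re ∫₀^∞ conj (f̂ p) (ĝ p) p coth(βp/2) dp`. -/
abbrev ThermalReal (β : ℝ) : Type := Lp ℂ 2 (thermalMeasure β)

/-- Multiplication by an essentially bounded function, in momentum space. -/
def momentumMul {β : ℝ} (m : ℝ → ℂ) (hm : MemLp m ∞ (thermalMeasure β)) :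
    ThermalReal β →ₗ[ℝ] ThermalReal β where
  toFun u := ((Lp.memLp u).mul (r := 2) hm).toLp (m * ⇑u)
  map_add' u v := by
    apply Lp.ext
    filter_upwards [Lp.coeFn_add (((Lp.memLp u).mul (r := 2) hm).toLp (m * ⇑u))
        (((Lp.memLp v).mul (r := 2) hm).toLp (m * ⇑v)), Lp.coeFn_add u v,
      ((Lp.memLp u).mul (r := 2) hm).coeFn_toLp, ((Lp.memLp v).mul (r := 2) hm).coeFn_toLp,
      ((Lp.memLp (u + v)).mul (r := 2) hm).coeFn_toLp] with p h1 h2 h3 h4 h5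
    rw [h1, h5, Pi.mul_apply, h2, Pi.add_apply, Pi.add_apply, h3, h4, Pi.mul_apply, Pi.mul_apply,
      mul_add]
  map_smul' c u := by
    apply Lp.ext
    filter_upwards [Lp.coeFn_smul c (((Lp.memLp u).mul (r := 2) hm).toLp (m * ⇑u)),
      Lp.coeFn_smul c u, ((Lp.memLp u).mul (r := 2) hm).coeFn_toLp,
      ((Lp.memLp (c • u)).mul (r := 2) hm).coeFn_toLp] with p h1 h2 h3 h4
    rw [RingHom.id_apply, h1, h4, Pi.mul_apply, h2, Pi.smul_apply, Pi.smul_apply, h3, Pi.mul_apply,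
      mul_smul_comm]

theorem momentumMul_coeFn {β : ℝ} (m : ℝ → ℂ) (hm : MemLp m ∞ (thermalMeasure β))
    (u : ThermalReal β) :
    momentumMul m hm u =ᵐ[thermalMeasure β] fun p => m p * u p :=
  ((Lp.memLp u).mul (r := 2) hm).coeFn_toLp

/-- The complex structure `C` in `D = C|D|`, which is multiplication by `-i sgn p`. -/
def polarC (_p : ℝ) : ℂ := -Complex.I

/-- The multiplier of `|D|`, where `D` is the operator with `σ(f, g) = τ_β(f, D g)` and
`σ(f, g) = ∫ f g' dx = (1/π) Re ∫₀^∞ conj (f̂ p) (-i p ĝ p) dp`. -/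
def absD (β p : ℝ) : ℝ := Real.tanh (β * p / 2)

theorem memLp_D (β : ℝ) :
    MemLp (fun p => polarC p * (absD β p : ℂ)) ∞ (thermalMeasure β) := by
  have hc : Continuous fun p => polarC p * (absD β p : ℂ) := by
    unfold polarC absD
    simp only [Real.tanh_eq_sinh_div_cosh]
    have : Continuous fun p : ℝ => Real.sinh (β * p / 2) / Real.cosh (β * p / 2) :=
      (Real.continuous_sinh.comp (by fun_prop)).div (Real.continuous_cosh.comp (by fun_prop))
        fun p => (Real.cosh_pos _).ne'
    exact continuous_const.mul (Complex.continuous_ofReal.comp this)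
  refine memLp_top_of_bound hc.aestronglyMeasurable 1 (ae_of_all _ fun p => ?_)
  simp only [polarC, absD, norm_mul, norm_neg, Complex.norm_I, one_mul, Complex.norm_real,
    Real.norm_eq_abs]
  exact (Real.abs_tanh_lt_one _).le

theorem memLp_T (β : ℝ) :
    MemLp (fun p => polarC p * (Real.sqrt (1 - absD β p ^ 2) : ℂ)) ∞ (thermalMeasure β) := by
  have hc : Continuous fun p => polarC p * (Real.sqrt (1 - absD β p ^ 2) : ℂ) := by
    unfold polarC absD
    simp only [Real.tanh_eq_sinh_div_cosh]
    have : Continuous fun p : ℝ => Real.sinh (β * p / 2) / Real.cosh (β * p / 2) :=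
      (Real.continuous_sinh.comp (by fun_prop)).div (Real.continuous_cosh.comp (by fun_prop))
        fun p => (Real.cosh_pos _).ne'
    exact continuous_const.mul (Complex.continuous_ofReal.comp
      (Real.continuous_sqrt.comp (continuous_const.sub (this.pow 2))))
  refine memLp_top_of_bound hc.aestronglyMeasurable 1 (ae_of_all _ fun p => ?_)
  simp only [polarC, norm_mul, norm_neg, Complex.norm_I, one_mul, Complex.norm_real,
    Real.norm_eq_abs, abs_of_nonneg (Real.sqrt_nonneg _)]
  rw [Real.sqrt_le_one]
  nlinarith [sq_nonneg (absD β p)]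

/-- The operator `D = C|D|`. -/
def opD (β : ℝ) : ThermalReal β →ₗ[ℝ] ThermalReal β := momentumMul _ (memLp_D β)

/-- The operator `C √(1 + D²)`. -/
def opT (β : ℝ) : ThermalReal β →ₗ[ℝ] ThermalReal β := momentumMul _ (memLp_T β)

theorem opD_skew (β : ℝ) (u v : ThermalReal β) : ⟪opD β u, v⟫_ℝ = -⟪u, opD β v⟫_ℝ := by
  rw [L2.inner_def, L2.inner_def, ← integral_neg]
  refine integral_congr_ae ?_
  filter_upwards [momentumMul_coeFn _ (memLp_D β) u, momentumMul_coeFn _ (memLp_D β) v] with p h1 h2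
  change ⟪momentumMul _ (memLp_D β) u p, v p⟫_ℝ = -⟪u p, momentumMul _ (memLp_D β) v p⟫_ℝ
  rw [h1, h2]
  simp [Complex.inner, polarC]
  ring

theorem opT_skew (β : ℝ) (u v : ThermalReal β) : ⟪opT β u, v⟫_ℝ = -⟪u, opT β v⟫_ℝ := by
  rw [L2.inner_def, L2.inner_def, ← integral_neg]
  refine integral_congr_ae ?_
  filter_upwards [momentumMul_coeFn _ (memLp_T β) u, momentumMul_coeFn _ (memLp_T β) v] with p h1 h2
  change ⟪momentumMul _ (memLp_T β) u p, v p⟫_ℝ = -⟪u p, momentumMul _ (memLp_T β) v p⟫_ℝ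
  rw [h1, h2]
  simp [Complex.inner, polarC]
  ring

theorem opD_opT_comm (β : ℝ) (u : ThermalReal β) : opD β (opT β u) = opT β (opD β u) := by
  apply Lp.ext
  filter_upwards [momentumMul_coeFn _ (memLp_D β) (opT β u), momentumMul_coeFn _ (memLp_T β) u,
    momentumMul_coeFn _ (memLp_T β) (opD β u), momentumMul_coeFn _ (memLp_D β) u] with p h1 h2 h3 h4
  change momentumMul _ (memLp_D β) (opT β u) p = momentumMul _ (memLp_T β) (opD β u) p
  rw [h1, h3]
  change _ * momentumMul _ (memLp_T β) u p = _ * momentumMul _ (memLp_D β) u p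
  rw [h2, h4]
  ring

theorem opD_sq_add_opT_sq (β : ℝ) (u : ThermalReal β) :
    opD β (opD β u) + opT β (opT β u) = -u := by
  apply Lp.ext
  filter_upwards [Lp.coeFn_add (opD β (opD β u)) (opT β (opT β u)), Lp.coeFn_neg u,
    momentumMul_coeFn _ (memLp_D β) (opD β u), momentumMul_coeFn _ (memLp_T β) u,
    momentumMul_coeFn _ (memLp_T β) (opT β u), momentumMul_coeFn _ (memLp_D β) u]
    with p h h' h1 h2 h3 h4
  rw [h, h', Pi.add_apply, Pi.neg_apply]
  change momentumMul _ (memLp_D β) (opD β u) p + momentumMul _ (memLp_T β) (opT β u) p = _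
  rw [h1, h3]
  change _ * momentumMul _ (memLp_D β) u p + _ * momentumMul _ (memLp_T β) u p = _
  rw [h2, h4]
  have hs : ((Real.sqrt (1 - absD β p ^ 2) : ℝ) : ℂ) ^ 2 = 1 - (absD β p : ℂ) ^ 2 := by
    rw [← Complex.ofReal_pow, Real.sq_sqrt]
    · push_cast
      rfl
    · have := (sq_lt_one_iff_abs_lt_one _).mpr (Real.abs_tanh_lt_one (β * p / 2))
      simp only [absD]
      linarith
  simp only [polarC]
  linear_combination (-(u p)) * hs + (absD β p : ℂ) ^ 2 * u p * Complex.I_sq +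
    ((Real.sqrt (1 - absD β p ^ 2) : ℝ) : ℂ) ^ 2 * u p * Complex.I_sq

/-- The complex structure `i^⊕ = [[-D, C√(1+D²)], [C√(1+D²), D]]` on the real Hilbert space
`𝒦 ⊕ 𝒦`. -/
def thermalJ (β : ℝ) :
    OrthogonalComplexStructure (WithLp 2 (ThermalReal β × ThermalReal β)) where
  J :=
    { toFun := fun x => WithLp.toLp 2
        (-opD β x.fst + opT β x.snd, opT β x.fst + opD β x.snd)
      map_add' := fun x y => by
        apply WithLp.ofLp_injective
        apply Prod.ext <;> simp <;> abel
      map_smul' := fun c x => by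
        apply WithLp.ofLp_injective
        apply Prod.ext <;> simp }
  sq x := by
    apply WithLp.ofLp_injective
    have h1 := opD_sq_add_opT_sq β x.fst
    have h2 := opD_sq_add_opT_sq β x.snd
    have h3 := opD_opT_comm β x.fst
    have h4 := opD_opT_comm β x.snd
    apply Prod.ext
    · simp [h4, ← h1]
      abel
    · simp [h3, ← h2]
      abel
  skew x y := by
    simp [WithLp.prod_inner_apply, inner_add_left, inner_add_right, opD_skew, opT_skew]
    ring

/-- The purified thermal one-particle space `𝓗^⊕`. -/
abbrev ThermalSpace (β : ℝ) : Type := Complexified (thermalJ β)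

/-- The vector `v` of the purified thermal one-particle space is `g ⊕ 0`, for the function `g` on
the line. -/
def ThermalRep (β : ℝ) (g : ℝ → ℝ) (v : ThermalSpace β) : Prop :=
  Integrable g ∧ v.val.fst =ᵐ[thermalMeasure β] lineFourier g ∧ v.val.snd = 0

/-! ### The modular vector fields of an interval -/

/-- `i K_I f` as a function, in the vacuum: `-2π (x - a) (b - x) / (b - a) f'(x)`. -/
def vacuumIK (a b : ℝ) (f : ℝ → ℝ) (x : ℝ) : ℝ :=
  -(2 * Real.pi * ((x - a) * (b - x) / (b - a)) * deriv f x)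

/-- `i^⊕ K_I (f ⊕ 0)` as a function, at inverse temperature `β`:
`-2β sinh(π (x - a) / β) sinh(π (b - x) / β) / sinh(π (b - a) / β) f'(x)`. -/
def thermalIK (β a b : ℝ) (f : ℝ → ℝ) (x : ℝ) : ℝ :=
  -(2 * β * (Real.sinh (Real.pi / β * (x - a)) * Real.sinh (Real.pi / β * (b - x)) /
    Real.sinh (Real.pi / β * (b - a))) * deriv f x)

end

/-! Everything reduces to one model in which the modular group is diagonal.

In position space the squared vacuum norm is `(1/2π) ∬ (f y - f x)² / (y - x)²`
(`lintegral_vacuum_eq`). The thermal norm has the kernel `(c/2)² / sinh² (c (y - x) / 2)`, with `c =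
2π/β`, and an additional mass term `(c/π) ∫ f²` (`lintegral_thermal_eq`). If `f` vanishes off `(a,
b)`, the logistic coordinate of the interval turns the part of the vacuum integral inside the
interval into the `sinh` kernel, and the interaction with the complement into exactly the mass term
(`lintegral_gagliardo_interval`). So an interval in the vacuum looks like the whole line at any
chosen temperature. The imaginary part of the inner product is `∫ f g'` in both pictures, hence is
invariant under the change of coordinate. By polarisation all inner products agree, and totality of
test functions on both sides gives a unitary (`IsThermalRep.exists_unitary`). On the vacuum side,
totality is a Reeh–Schlieder argument based on boundary uniqueness for holomorphic functions.

At `β = 2π` the whole thermal line is `L²(ℝ, ρ)` with `ρ(p) = p / (π (1 - e^{-2πp}))`. The closure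
of the real functions is the set of `x` with `x(-p) = conj x(p)`, and the Tomita operator is the
reflection `x ↦ conj x(-p)`. Since `ρ(-p) = e^{-2πp} ρ(p)`, the modular operator is multiplication
by `e^{-2πp}` and `Δ^{iu}` is multiplication by `e^{-2πiup}`, a translation of the line.
Standardness, factoriality and the exact domain of `Δ` are read off here
(`exists_standardSubspace_of_model`).

The function `f` may be supported anywhere, so the unitary gives no formula for its image. The
modular field is a quadratic polynomial times `d/dx`, a generator of Möbius transformations, and the
vacuum inner product is infinitesimally invariant under it (`integral_Ioi_quadratic_field`). Moving
the field onto test functions inside the interval, where it becomes `-2π d/ds`, identifies `iK_I f`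
weakly (`IsConformalUnitary.symm_vacuumIK`).

The field vanishes at the endpoints, so its truncation has a square-integrable weak derivative and
is a vector, and in the logistic coordinate it is a real function of `L¹ ∩ L²`; thus it lies in
`H(I)`. What was cut off vanishes on `I`, so it is symplectically orthogonal to `H(I)` by the
formula `∫ f g'`.

For the thermal statement the line is mapped to `(0, 1)` by the logistic map of scale `2π/β`. Then
`I` becomes a subinterval, and the thermal field becomes the vacuum field of that subinterval
(`vacuumIK_intervalPush`). -/

noncomputable section

/-! ### Fourier integrals on `L¹ ∩ L²` -/

open FourierTransform SchwartzMap in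
theorem integral_fourier_mul_schwartz {f : ℝ → ℂ} (hf : Integrable f) (g : 𝓢(ℝ, ℂ)) :
    ∫ ξ, 𝓕 f ξ * g ξ = ∫ x, f x * 𝓕 (g : ℝ → ℂ) x := by
  have h := VectorFourier.integral_fourierIntegral_smul_eq_flip (μ := volume) (ν := volume)
    (L := innerₗ ℝ) (f := f) (g := g) Real.continuous_fourierChar continuous_inner hf g.integrable
  rw [flip_innerₗ] at h
  exact h

open FourierTransform in
theorem continuous_fourier_of_integrable {f : ℝ → ℂ} (hf : Integrable f) : Continuous (𝓕 f) :=
  VectorFourier.fourierIntegral_continuous Real.continuous_fourierChar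
    (L := innerₗ ℝ) continuous_inner hf

open FourierTransform SchwartzMap in
theorem integral_fourier_schwartz_smul (f : Lp ℂ 2 (volume : Measure ℝ)) (g : 𝓢(ℝ, ℂ)) :
    ∫ x, (𝓕 g) x • f x = ∫ x, g x • (𝓕 f : Lp ℂ 2 (volume : Measure ℝ)) x := by
  have h1 := DFunLike.congr_fun (Lp.fourier_toTemperedDistribution_eq f) g
  rw [TemperedDistribution.fourier_apply, Lp.toTemperedDistribution_apply,
    Lp.toTemperedDistribution_apply] at h1
  exact h1

open SchwartzMap in
theorem exists_schwartzMap_eq_ofReal {g : ℝ → ℝ} (hg : ContDiff ℝ ∞ g) (hgc : HasCompactSupport g) :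
    ∃ G : 𝓢(ℝ, ℂ), ∀ x, G x = (g x : ℂ) := by
  have hgC : ContDiff ℝ ∞ (fun x => (g x : ℂ)) := Complex.ofRealCLM.contDiff.comp hg
  have hgcC : HasCompactSupport (fun x => (g x : ℂ)) :=
    hgc.comp_left (g := Complex.ofReal) Complex.ofReal_zero
  exact ⟨hgcC.toSchwartzMap hgC, fun x => rfl⟩

-- Both sides move the transform onto `G`: on the left by duality for tempered distributions, on the
-- right by Fubini. The two transforms of `f` are therefore the same distribution.
open FourierTransform SchwartzMap in
theorem integral_schwartz_smul_fourier_toLp {f : ℝ → ℂ} (hf : Integrable f) (hf2 : MemLp f 2)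
    (G : 𝓢(ℝ, ℂ)) :
    ∫ x, G x • (𝓕 (hf2.toLp f) : Lp ℂ 2 (volume : Measure ℝ)) x = ∫ x, G x • 𝓕 f x := by
  rw [← integral_fourier_schwartz_smul (hf2.toLp f) G]
  have h2 := integral_fourier_mul_schwartz hf G
  trans ∫ x, f x * 𝓕 (G : ℝ → ℂ) x
  · refine integral_congr_ae ?_
    filter_upwards [hf2.coeFn_toLp] with x hx
    rw [hx, SchwartzMap.fourier_coe, smul_eq_mul, mul_comm]
  · rw [← h2]
    exact integral_congr_ae (ae_of_all _ fun x => mul_comm _ _)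

open FourierTransform SchwartzMap in
/-- The Fourier integral of a function in `L¹ ∩ L²` is its `L²` Fourier transform. -/
theorem coeFn_fourier_toLp {f : ℝ → ℂ} (hf : Integrable f) (hf2 : MemLp f 2) :
    (𝓕 (hf2.toLp f) : Lp ℂ 2 (volume : Measure ℝ)) =ᵐ[volume] 𝓕 f := by
  have key := integral_schwartz_smul_fourier_toLp hf hf2
  generalize (𝓕 (hf2.toLp f) : Lp ℂ 2 (volume : Measure ℝ)) = F at key
  have hFl : LocallyIntegrable F := (Lp.memLp F).locallyIntegrable (by norm_num)
  have hcl : LocallyIntegrable (𝓕 f) := (continuous_fourier_of_integrable hf).locallyIntegrable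
  refine ae_eq_of_integral_contDiff_smul_eq hFl hcl fun g hg hgc => ?_
  obtain ⟨G, hG⟩ := exists_schwartzMap_eq_ofReal hg hgc
  have := key G
  simp only [hG, Complex.coe_smul] at this
  exact this

/-! ### The Fourier transform of real functions -/

open FourierTransform in
theorem lineFourier_eq_fourier (g : ℝ → ℝ) (p : ℝ) :
    lineFourier g p = 𝓕 (fun x => (g x : ℂ)) (-(2 * Real.pi)⁻¹ * p) := by
  rw [lineFourier, Real.fourier_real_eq_integral_exp_smul]
  refine integral_congr_ae (ae_of_all _ fun x => ?_)
  simp only [smul_eq_mul]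
  congr 2
  have := Real.pi_ne_zero
  push_cast
  field_simp

open FourierTransform in
theorem lineFourier_eq_comp (g : ℝ → ℝ) :
    lineFourier g = fun p => 𝓕 (fun x => (g x : ℂ)) (-(2 * Real.pi)⁻¹ * p) :=
  funext (lineFourier_eq_fourier g)

theorem continuous_lineFourier {g : ℝ → ℝ} (hg : Integrable g) : Continuous (lineFourier g) := by
  rw [lineFourier_eq_comp]
  exact (continuous_fourier_of_integrable hg.ofReal).comp (by fun_prop)

theorem integrable_exp_mul {g : ℝ → ℝ} (hg : Integrable g) (p : ℝ) :
    Integrable fun x : ℝ => Complex.exp (Complex.I * (p * x : ℝ)) * (g x : ℂ) := by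
  refine hg.ofReal.bdd_mul (c := 1) (by fun_prop) (ae_of_all _ fun x => ?_)
  rw [mul_comm, Complex.norm_exp_ofReal_mul_I]

theorem norm_lineFourier_le (g : ℝ → ℝ) (p : ℝ) : ‖lineFourier g p‖ ≤ ∫ x, |g x| := by
  refine (norm_integral_le_integral_norm _).trans (le_of_eq ?_)
  refine integral_congr_ae (ae_of_all _ fun x => ?_)
  simp only [norm_mul, Complex.norm_real, Real.norm_eq_abs]
  rw [mul_comm Complex.I, Complex.norm_exp_ofReal_mul_I, one_mul]

theorem lineFourier_neg_arg (g : ℝ → ℝ) (p : ℝ) :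
    lineFourier g (-p) = (starRingEnd ℂ) (lineFourier g p) := by
  rw [lineFourier, lineFourier, ← integral_conj]
  refine integral_congr_ae (ae_of_all _ fun x => ?_)
  simp only [map_mul, Complex.conj_ofReal, ← Complex.exp_conj, Complex.conj_I]
  congr 2
  push_cast
  ring

theorem lineFourier_add {f g : ℝ → ℝ} (hf : Integrable f) (hg : Integrable g) (p : ℝ) :
    lineFourier (fun x => f x + g x) p = lineFourier f p + lineFourier g p := by
  rw [lineFourier, lineFourier, lineFourier,
    ← integral_add (integrable_exp_mul hf p) (integrable_exp_mul hg p)]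
  refine integral_congr_ae (ae_of_all _ fun x => ?_)
  push_cast
  ring

theorem lineFourier_const_mul (c : ℝ) (f : ℝ → ℝ) (p : ℝ) :
    lineFourier (fun x => c * f x) p = c * lineFourier f p := by
  rw [lineFourier, lineFourier, ← integral_const_mul]
  refine integral_congr_ae (ae_of_all _ fun x => ?_)
  push_cast
  ring

theorem lineFourier_sub {f g : ℝ → ℝ} (hf : Integrable f) (hg : Integrable g) (p : ℝ) :
    lineFourier (fun x => f x - g x) p = lineFourier f p - lineFourier g p := by
  rw [lineFourier, lineFourier, lineFourier,
    ← integral_sub (integrable_exp_mul hf p) (integrable_exp_mul hg p)]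
  refine integral_congr_ae (ae_of_all _ fun x => ?_)
  push_cast
  ring

theorem lineFourier_comp_add (g : ℝ → ℝ) (t p : ℝ) :
    lineFourier (fun x => g (x + t)) p =
      Complex.exp (-(Complex.I * (p * t : ℝ))) * lineFourier g p := by
  rw [lineFourier, lineFourier, ← integral_const_mul, ← integral_add_right_eq_self (fun x =>
    Complex.exp (-(Complex.I * (p * t : ℝ))) * (Complex.exp (Complex.I * (p * x : ℝ)) * (g x : ℂ))) t]
  refine integral_congr_ae (ae_of_all _ fun x => ?_)
  simp only []
  rw [← mul_assoc, ← Complex.exp_add]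
  congr 2
  push_cast
  ring

theorem memLp_lineFourier {g : ℝ → ℝ} (hg : Integrable g) (hg2 : MemLp g 2) :
    MemLp (lineFourier g) 2 := by
  have h : MemLp (FourierTransform.fourier fun x => (g x : ℂ)) 2 :=
    (memLp_congr_ae (coeFn_fourier_toLp hg.ofReal hg2.ofReal)).mp (Lp.memLp _)
  rw [lineFourier_eq_comp]
  have hne : (-(2 * Real.pi)⁻¹ : ℝ) ≠ 0 := by
    have := Real.pi_pos
    simp [this.ne']
  refine MemLp.comp_of_map (f := fun p : ℝ => -(2 * Real.pi)⁻¹ * p) ?_ (by fun_prop)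
  rw [Real.map_volume_mul_left hne]
  exact h.smul_measure ENNReal.ofReal_ne_top

/-- Plancherel's theorem. -/
theorem integral_conj_lineFourier_mul {f g : ℝ → ℝ} (hf : Integrable f) (hf2 : MemLp f 2)
    (hg : Integrable g) (hg2 : MemLp g 2) :
    ∫ p, (starRingEnd ℂ) (lineFourier f p) * lineFourier g p =
      2 * Real.pi * ((∫ x, f x * g x : ℝ) : ℂ) := by
  have h := Lp.inner_fourier_eq (hf2.ofReal (K := ℂ)|>.toLp _) (hg2.ofReal (K := ℂ)|>.toLp _)
  rw [L2.inner_def, L2.inner_def] at h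
  simp only [lineFourier_eq_fourier]
  rw [Measure.integral_comp_mul_left (fun p =>
    (starRingEnd ℂ) (FourierTransform.fourier (fun x => (f x : ℂ)) p) *
      FourierTransform.fourier (fun x => (g x : ℂ)) p)]
  have e1 : ∫ p, (starRingEnd ℂ) (FourierTransform.fourier (fun x => (f x : ℂ)) p) *
      FourierTransform.fourier (fun x => (g x : ℂ)) p = ((∫ x, f x * g x : ℝ) : ℂ) := by
    rw [← integral_complex_ofReal]
    refine Eq.trans ?_ (h.trans ?_)
    · refine integral_congr_ae ?_
      filter_upwards [coeFn_fourier_toLp hf.ofReal hf2.ofReal,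
        coeFn_fourier_toLp hg.ofReal hg2.ofReal] with p h1 h2
      rw [h1, h2]
      simp [mul_comm]
    · refine integral_congr_ae ?_
      filter_upwards [(hf2.ofReal (K := ℂ)).coeFn_toLp, (hg2.ofReal (K := ℂ)).coeFn_toLp]
        with p h1 h2
      rw [h1, h2]
      simp [mul_comm]
  rw [e1]
  have hpi := Real.pi_pos
  rw [inv_neg, inv_inv, abs_neg, abs_of_pos (by positivity), Complex.real_smul]
  push_cast
  ring

theorem lintegral_enorm_lineFourier_sq {f : ℝ → ℝ} (hf : Integrable f) (hf2 : MemLp f 2) :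
    ∫⁻ p, ENNReal.ofReal (‖lineFourier f p‖ ^ 2) =
      ENNReal.ofReal (2 * Real.pi) * ∫⁻ x, ENNReal.ofReal (f x ^ 2) := by
  have h := integral_conj_lineFourier_mul hf hf2 hf hf2
  have hi := (memLp_lineFourier hf hf2).integrable_norm_pow (by norm_num)
  have hi2 := hf2.integrable_sq
  have e : ∫ p, ‖lineFourier f p‖ ^ 2 = 2 * Real.pi * ∫ x, f x ^ 2 := by
    have h1 : ∀ p, (starRingEnd ℂ) (lineFourier f p) * lineFourier f p =
        ((‖lineFourier f p‖ ^ 2 : ℝ) : ℂ) := fun p => by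
      rw [Complex.conj_mul']; push_cast; rfl
    simp only [h1] at h
    rw [integral_complex_ofReal] at h
    have h2 := congrArg Complex.re h
    simp only [Complex.ofReal_re] at h2
    rw [h2]
    simp [pow_two]
  rw [← ofReal_integral_eq_lintegral_ofReal hi (ae_of_all _ fun p => by positivity), e,
    ENNReal.ofReal_mul (by positivity),
    ← ofReal_integral_eq_lintegral_ofReal hi2 (ae_of_all _ fun p => by positivity)]

/-- A real test function on the line. -/
structure IsTestFunction (f : ℝ → ℝ) : Prop where
  contDiff : ContDiff ℝ ∞ f
  hasCompactSupport : HasCompactSupport f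

namespace IsTestFunction

variable {f g : ℝ → ℝ}

theorem continuous (hf : IsTestFunction f) : Continuous f := hf.contDiff.continuous

theorem differentiable (hf : IsTestFunction f) : Differentiable ℝ f :=
  hf.contDiff.differentiable (by simp)

theorem integrable (hf : IsTestFunction f) : Integrable f :=
  hf.continuous.integrable_of_hasCompactSupport hf.hasCompactSupport

theorem memLp (hf : IsTestFunction f) : MemLp f 2 :=
  hf.continuous.memLp_of_hasCompactSupport hf.hasCompactSupport

theorem deriv (hf : IsTestFunction f) : IsTestFunction (deriv f) where
  contDiff := (contDiff_infty_iff_deriv.mp hf.contDiff).2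
  hasCompactSupport := hf.hasCompactSupport.deriv

theorem mul_left (hf : IsTestFunction f) (hg : ContDiff ℝ ∞ g) :
    IsTestFunction fun x => g x * f x where
  contDiff := hg.mul hf.contDiff
  hasCompactSupport := hf.hasCompactSupport.mul_left

theorem const_mul (hf : IsTestFunction f) (c : ℝ) : IsTestFunction fun x => c * f x :=
  hf.mul_left contDiff_const

theorem add (hf : IsTestFunction f) (hg : IsTestFunction g) :
    IsTestFunction fun x => f x + g x where
  contDiff := hf.contDiff.add hg.contDiff
  hasCompactSupport := hf.hasCompactSupport.add hg.hasCompactSupport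

theorem sub (hf : IsTestFunction f) (hg : IsTestFunction g) :
    IsTestFunction fun x => f x - g x where
  contDiff := hf.contDiff.sub hg.contDiff
  hasCompactSupport := hf.hasCompactSupport.sub hg.hasCompactSupport

theorem comp_add (hf : IsTestFunction f) (t : ℝ) : IsTestFunction fun x => f (x + t) where
  contDiff := hf.contDiff.comp (by fun_prop)
  hasCompactSupport := hf.hasCompactSupport.comp_homeomorph (Homeomorph.addRight t)

end IsTestFunction

/-! ### Fourier transforms of test functions: derivatives, decay, injectivity -/

theorem lineFourier_deriv {f : ℝ → ℝ} (hf : IsTestFunction f) (p : ℝ) :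
    lineFourier (deriv f) p = -Complex.I * p * lineFourier f p := by
  have hd : deriv (fun x => (f x : ℂ)) = fun x => ((deriv f x : ℝ) : ℂ) :=
    funext fun x => ((hf.differentiable x).hasDerivAt.ofReal_comp).deriv
  have h := Real.fourier_deriv (f := fun x => (f x : ℂ)) hf.integrable.ofReal
    (fun x => (hf.differentiable x).hasDerivAt.ofReal_comp.differentiableAt)
    (by rw [hd]; exact hf.deriv.integrable.ofReal)
  rw [lineFourier_eq_fourier, lineFourier_eq_fourier, ← hd, h]
  simp only [smul_eq_mul]
  have := Real.pi_ne_zero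
  push_cast
  field_simp

theorem hasDerivAt_lineFourier {f : ℝ → ℝ} (hf : IsTestFunction f) (p : ℝ) :
    HasDerivAt (lineFourier f) (Complex.I * lineFourier (fun x => x * f x) p) p := by
  have hx : Integrable (fun x : ℝ => x • (f x : ℂ)) := by
    simpa using (hf.mul_left contDiff_id).integrable.ofReal (𝕜 := ℂ)
  have h := Real.hasDerivAt_fourier hf.integrable.ofReal hx (-(2 * Real.pi)⁻¹ * p)
  have h2 : HasDerivAt (fun p : ℝ => -(2 * Real.pi)⁻¹ * p) (-(2 * Real.pi)⁻¹) p := by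
    simpa using (hasDerivAt_id p).const_mul (-(2 * Real.pi)⁻¹)
  have h3 := h.scomp p h2
  rw [lineFourier_eq_comp]
  refine h3.congr_deriv ?_
  rw [lineFourier_eq_fourier, Real.fourier_real_eq, Real.fourier_real_eq, ← integral_const_mul,
    ← integral_smul]
  refine integral_congr_ae (ae_of_all _ fun x => ?_)
  have := Real.pi_ne_zero
  simp only [Complex.real_smul, smul_eq_mul, Circle.smul_def]
  push_cast
  field_simp

/-- The operator `1 - d²/dx²` multiplies the transform by `1 + p²`; applying it twice to `f` leaves
an integrable function, whose transform is bounded. -/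
theorem exists_norm_lineFourier_le {f : ℝ → ℝ} (hf : IsTestFunction f) :
    ∃ C, 0 ≤ C ∧ ∀ p, ‖lineFourier f p‖ ≤ C / (1 + p ^ 2) ^ 2 := by
  have key : ∀ {g : ℝ → ℝ}, IsTestFunction g → ∀ p,
      lineFourier (fun x => g x - deriv (deriv g) x) p = ((1 + p ^ 2 : ℝ) : ℂ) * lineFourier g p := by
    intro g hg p
    rw [lineFourier_sub hg.integrable hg.deriv.deriv.integrable, lineFourier_deriv hg.deriv,
      lineFourier_deriv hg]
    push_cast
    linear_combination (-(p : ℂ) ^ 2 * lineFourier g p) * Complex.I_sq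
  have hg := hf.sub hf.deriv.deriv
  set g := fun x => f x - deriv (deriv f) x with hgdef
  refine ⟨∫ x, |g x - deriv (deriv g) x|, by positivity, fun p => ?_⟩
  have h := norm_lineFourier_le (fun x => g x - deriv (deriv g) x) p
  rw [key hg, key hf, norm_mul, norm_mul, Complex.norm_real, Real.norm_of_nonneg (by positivity)]
    at h
  rw [le_div_iff₀ (by positivity)]
  linarith

/-- Every test function is the Fourier transform of a Schwartz function, so an integrable function
with zero transform integrates to zero against every test function. -/
theorem ae_eq_zero_of_forall_integral_exp_mul_eq_zero {k : ℝ → ℂ} (hk : Integrable k)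
    (h : ∀ t : ℝ, ∫ p, Complex.exp (Complex.I * (p * t : ℝ)) * k p = 0) : k =ᵐ[volume] 0 := by
  refine ae_eq_zero_of_integral_contDiff_smul_eq_zero hk.locallyIntegrable fun g hg hgc => ?_
  obtain ⟨G, hG⟩ := exists_schwartzMap_eq_ofReal hg hgc
  have h1 := integral_fourier_mul_schwartz hk (FourierTransform.fourierInv G)
  have h2 : ∀ x, FourierTransform.fourier (FourierTransform.fourierInv G : ℝ → ℂ) x = (g x : ℂ) := by
    intro x
    rw [← SchwartzMap.fourier_coe, FourierTransform.fourier_fourierInv_eq, hG]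
  have h3 : FourierTransform.fourier k = 0 := by
    ext ξ
    rw [Real.fourier_real_eq_integral_exp_smul, Pi.zero_apply, ← h (-2 * Real.pi * ξ)]
    refine integral_congr_ae (ae_of_all _ fun x => ?_)
    simp only [smul_eq_mul]
    congr 2
    push_cast
    ring
  rw [h3] at h1
  simp only [Pi.zero_apply, zero_mul, integral_zero, h2] at h1
  rw [h1]
  exact integral_congr_ae (ae_of_all _ fun x => by simp [mul_comm])

/-- A positive bump at `m` whose radius is less than `1/|p|` has a transform close to `e^{ipm}`
times its mass, hence nonzero. Shrinking bumps give a countable family that serves all `p`;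
countability lets the exceptional null sets be united later. -/
theorem exists_testFunction_lineFourier_ne_zero (m : ℝ) {δ : ℝ} (hδ : 0 < δ) :
    ∃ φ : ℕ → ℝ → ℝ, (∀ n, IsTestFunction (φ n) ∧ tsupport (φ n) ⊆ Metric.closedBall m δ) ∧
      ∀ p, ∃ n, lineFourier (φ n) p ≠ 0 := by
  let r : ℕ → ℝ := fun n => δ / (n + 1)
  have hr : ∀ n, 0 < r n := fun n => by positivity
  let b : ∀ n, ContDiffBump m := fun n => ⟨r n / 2, r n, by linarith [hr n], by linarith [hr n]⟩
  refine ⟨fun n => b n, fun n => ⟨⟨(b n).contDiff, (b n).hasCompactSupport⟩, ?_⟩, fun p => ?_⟩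
  · rw [(b n).tsupport_eq]
    refine Metric.closedBall_subset_closedBall ?_
    exact div_le_self hδ.le (by linarith [n.cast_nonneg (α := ℝ)])
  -- With this `n` the radius `δ / (n + 1)` times `|p|` is below `1`, which makes the oscillation of
  -- `e^{ipx}` on the bump smaller than its mass.
  · obtain ⟨n, hn⟩ := exists_nat_gt (|p| * δ)
    refine ⟨n, fun h0 => ?_⟩
    have hT : IsTestFunction (b n) := ⟨(b n).contDiff, (b n).hasCompactSupport⟩
    have hpos : 0 < ∫ x, b n x := (b n).integral_pos
    have hpr : |p| * r n < 1 := by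
      simp only [r]
      rw [mul_div_assoc', div_lt_one (by positivity)]
      linarith
    have e : Complex.exp (Complex.I * (p * m : ℝ)) * ((∫ x, b n x : ℝ) : ℂ) =
        ∫ x, (Complex.exp (Complex.I * (p * m : ℝ)) - Complex.exp (Complex.I * (p * x : ℝ))) *
          (b n x : ℂ) := by
      simp only [sub_mul]
      have hc : Integrable fun x => Complex.exp (Complex.I * (p * m : ℝ)) * (b n x : ℂ) :=
        hT.integrable.ofReal.const_mul _
      refine ((integral_sub hc (integrable_exp_mul hT.integrable p)).trans ?_).symm
      rw [integral_const_mul, integral_complex_ofReal]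
      exact (congrArg _ h0).trans (sub_zero _)
    have e2 := congrArg norm e
    rw [norm_mul, mul_comm Complex.I, Complex.norm_exp_ofReal_mul_I, one_mul, Complex.norm_real,
      Real.norm_of_nonneg hpos.le] at e2
    have hle : ‖∫ x, (Complex.exp (Complex.I * (p * m : ℝ)) -
        Complex.exp (Complex.I * (p * x : ℝ))) * (b n x : ℂ)‖ ≤ ∫ x, |p| * r n * b n x := by
      refine norm_integral_le_of_norm_le (hT.integrable.const_mul _) (ae_of_all _ fun x => ?_)
      rw [norm_mul, Complex.norm_real, Real.norm_of_nonneg (b n).nonneg]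
      by_cases hx : x ∈ Metric.ball m (r n)
      · refine mul_le_mul_of_nonneg_right ?_ (b n).nonneg
        have e3 : Complex.exp (Complex.I * (p * m : ℝ)) - Complex.exp (Complex.I * (p * x : ℝ)) =
            Complex.exp (Complex.I * (p * x : ℝ)) *
              (Complex.exp (Complex.I * (p * (m - x) : ℝ)) - 1) := by
          rw [mul_sub, ← Complex.exp_add]
          congr 2
          · push_cast; ring
          · ring
        rw [e3, norm_mul, mul_comm Complex.I, Complex.norm_exp_ofReal_mul_I, one_mul]
        refine (Real.norm_exp_I_mul_ofReal_sub_one_le).trans ?_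
        rw [Real.norm_eq_abs, abs_mul]
        refine mul_le_mul_of_nonneg_left ?_ (abs_nonneg _)
        rw [Metric.mem_ball, Real.dist_eq, abs_sub_comm] at hx
        exact hx.le
      · have : b n x = 0 := by
          by_contra hne
          have : x ∈ Function.support (b n) := hne
          rw [(b n).support_eq] at this
          exact hx this
        simp [this]
    rw [integral_const_mul] at hle
    rw [mul_comm Complex.I, ← e2] at hle
    nlinarith

/-! ### Two kernels on the line -/

theorem lintegral_even {F : ℝ → ℝ≥0∞} (hF : ∀ t, F (-t) = F t) :
    ∫⁻ t, F t = 2 * ∫⁻ t in Ioi 0, F t := by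
  rw [← lintegral_add_compl F measurableSet_Ioi (A := Ioi (0 : ℝ)), two_mul, compl_Ioi,
    ← restrict_Iio_eq_restrict_Iic]
  congr 1
  have h := (Measure.measurePreserving_neg (volume : Measure ℝ)).setLIntegral_comp_emb
    (Homeomorph.neg ℝ).measurableEmbedding F (Ioi 0)
  simp only [hF] at h
  rw [h]
  congr 2
  simp

/-- Twice the real part of the difference of the Laplace integrals of `1` and `e^{ipt}`, that is `2
(1/s - s/(s² + p²))`. It is the building block of both kernels, which are superpositions of
exponentials with nonnegative weights. -/
theorem setLIntegral_one_sub_cos_mul_exp {s : ℝ} (hs : 0 < s) (p : ℝ) :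
    ∫⁻ t in Ioi (0 : ℝ), ENNReal.ofReal ((2 - 2 * Real.cos (p * t)) * Real.exp (-(s * t))) =
      ENNReal.ofReal (2 * p ^ 2 / (s * (s ^ 2 + p ^ 2))) := by
  have hre : ((-s : ℂ) + p * Complex.I).re < 0 := by simpa using hs
  have hre0 : ((-s : ℂ)).re < 0 := by simpa using hs
  have i1 := integrableOn_exp_mul_complex_Ioi hre 0
  have i0 := integrableOn_exp_mul_complex_Ioi hre0 0
  have e1 := integral_exp_mul_complex_Ioi hre 0
  have e0 := integral_exp_mul_complex_Ioi hre0 0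
  have hpt : ∀ t : ℝ, (2 - 2 * Real.cos (p * t)) * Real.exp (-(s * t)) =
      2 * (Complex.exp (-s * t) - Complex.exp ((-s + p * Complex.I) * t)).re := by
    intro t
    have h0 : Complex.exp (-s * t) = ((Real.exp (-(s * t)) : ℝ) : ℂ) := by
      push_cast; congr 1; ring
    have h1 : Complex.exp ((-s + p * Complex.I) * t) =
        ((Real.exp (-(s * t)) : ℝ) : ℂ) * Complex.exp ((p * t : ℝ) * Complex.I) := by
      push_cast; rw [← Complex.exp_add]; congr 1; ring
    rw [h0, h1, Complex.sub_re, Complex.re_ofReal_mul, Complex.exp_ofReal_mul_I_re,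
      Complex.ofReal_re]
    ring
  simp only [hpt]
  have hint : IntegrableOn (fun t : ℝ => 2 * (Complex.exp (-s * t) -
      Complex.exp ((-s + p * Complex.I) * t)).re) (Ioi 0) := (i0.sub i1).re.const_mul 2
  rw [← ofReal_integral_eq_lintegral_ofReal hint]
  · congr 1
    rw [integral_const_mul]
    have := integral_re (i0.sub i1)
    simp only [Pi.sub_apply, RCLike.re_to_complex] at this
    rw [this, integral_sub i0 i1, e0, e1]
    have h2 : ((-s : ℂ) + p * Complex.I) ≠ 0 := fun h => by rw [h] at hre; simp at hre
    simp only [Complex.ofReal_zero, mul_zero, Complex.exp_zero, Complex.sub_re, Complex.div_re,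
      Complex.normSq_apply, Complex.neg_re, Complex.neg_im, Complex.add_re, Complex.add_im,
      Complex.mul_re, Complex.mul_im, Complex.I_re, Complex.I_im, Complex.ofReal_re,
      Complex.ofReal_im, Complex.one_re, Complex.one_im]
    have : s ^ 2 + p ^ 2 ≠ 0 := by positivity
    simp only [mul_one, mul_zero, zero_mul, sub_zero, add_zero, zero_add, neg_zero, zero_div]
    rw [show -s * -s + p * p = s ^ 2 + p ^ 2 by ring]
    field_simp
    ring
  · refine ae_of_all _ fun t => ?_
    simp only [← hpt, Pi.zero_apply]
    have := Real.cos_le_one (p * t)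
    have := Real.exp_pos (-(s * t))
    apply mul_nonneg <;> linarith

theorem setLIntegral_mul_exp {t : ℝ} (ht : 0 < t) :
    ∫⁻ s in Ioi (0 : ℝ), ENNReal.ofReal (s * Real.exp (-(t * s))) =
      ENNReal.ofReal (1 / t ^ 2) := by
  have h := Real.integral_rpow_mul_exp_neg_mul_Ioi (a := 2) two_pos ht
  norm_num at h
  have hi : IntegrableOn (fun s : ℝ => s * Real.exp (-(t * s))) (Ioi 0) := by
    by_contra hc
    rw [integral_undef hc] at h
    have : (t ^ 2)⁻¹ ≠ 0 := by positivity
    exact this h.symm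
  rw [← ofReal_integral_eq_lintegral_ofReal hi, h, one_div]
  filter_upwards [ae_restrict_mem measurableSet_Ioi] with s hs
  have : 0 < s := hs
  simp only [Pi.zero_apply]
  positivity

theorem two_sub_two_cos_nonneg (x : ℝ) : 0 ≤ 2 - 2 * Real.cos x := by
  linarith [Real.cos_le_one x]

theorem setLIntegral_lorentz {p : ℝ} (hp : p ≠ 0) :
    ∫⁻ s in Ioi (0 : ℝ), ENNReal.ofReal (2 * p ^ 2 / (s ^ 2 + p ^ 2)) =
      ENNReal.ofReal (Real.pi * |p|) := by
  have hp' : 0 < |p| := abs_pos.mpr hp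
  have hd : ∀ s : ℝ, HasDerivAt (fun s => 2 * |p| * Real.arctan (s / |p|))
      (2 * p ^ 2 / (s ^ 2 + p ^ 2)) s := by
    intro s
    have h := (((hasDerivAt_id s).div_const |p|).arctan).const_mul (2 * |p|)
    refine h.congr_deriv ?_
    have : s ^ 2 + p ^ 2 ≠ 0 := by positivity
    simp only [id]
    rw [← sq_abs p] at *
    field_simp
    ring
  have hlim : Tendsto (fun s => 2 * |p| * Real.arctan (s / |p|)) atTop
      (𝓝 (2 * |p| * (Real.pi / 2))) :=
    ((tendsto_nhds_of_tendsto_nhdsWithin Real.tendsto_arctan_atTop).comp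
      (tendsto_id.atTop_div_const hp')).const_mul _
  have h0 : ∀ s ∈ Ioi (0 : ℝ), 0 ≤ 2 * p ^ 2 / (s ^ 2 + p ^ 2) := fun s _ => by positivity
  rw [← ofReal_integral_eq_lintegral_ofReal
    (integrableOn_Ioi_deriv_of_nonneg' (fun s _ => hd s) h0 hlim)
    (by filter_upwards with s; simp only [Pi.zero_apply]; positivity),
    integral_Ioi_of_hasDerivAt_of_nonneg' (fun s _ => hd s) h0 hlim]
  congr 1
  simp
  ring

/-- Writing `1/t² = ∫ s e^{-ts} ds` and applying Tonelli reduces the integral to a Laplace transform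
in `t` and then to a Lorentzian in `s`; every integrand is nonnegative. -/
theorem lintegral_two_sub_two_cos_div_sq (p : ℝ) :
    ∫⁻ t : ℝ, ENNReal.ofReal (1 / t ^ 2) * ENNReal.ofReal (2 - 2 * Real.cos (p * t)) =
      ENNReal.ofReal (2 * Real.pi * |p|) := by
  rcases eq_or_ne p 0 with rfl | hp
  · simp
  rw [lintegral_even (by intro t; simp)]
  have e : ∫⁻ t in Ioi (0 : ℝ), ENNReal.ofReal (1 / t ^ 2) * ENNReal.ofReal (2 - 2 * Real.cos (p * t)) =
      ∫⁻ t in Ioi (0 : ℝ), ∫⁻ s in Ioi (0 : ℝ),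
        ENNReal.ofReal (s * ((2 - 2 * Real.cos (p * t)) * Real.exp (-(s * t)))) := by
    refine setLIntegral_congr_fun measurableSet_Ioi fun t ht => ?_
    rw [← setLIntegral_mul_exp ht, ← lintegral_mul_const _ (by fun_prop)]
    refine lintegral_congr fun s => ?_
    rw [← ENNReal.ofReal_mul' (two_sub_two_cos_nonneg _)]
    congr 1
    rw [mul_comm t s]
    ring
  rw [e, lintegral_lintegral_swap (by fun_prop)]
  have e2 : ∫⁻ s in Ioi (0 : ℝ), ∫⁻ t in Ioi (0 : ℝ),
        ENNReal.ofReal (s * ((2 - 2 * Real.cos (p * t)) * Real.exp (-(s * t)))) =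
      ∫⁻ s in Ioi (0 : ℝ), ENNReal.ofReal (2 * p ^ 2 / (s ^ 2 + p ^ 2)) := by
    refine setLIntegral_congr_fun measurableSet_Ioi fun s hs => ?_
    have hs' : 0 < s := hs
    simp only [ENNReal.ofReal_mul hs'.le]
    rw [lintegral_const_mul _ (by fun_prop), setLIntegral_one_sub_cos_mul_exp hs',
      ← ENNReal.ofReal_mul hs'.le]
    congr 1
    field_simp
  rw [e2, setLIntegral_lorentz hp, show (2 : ℝ≥0∞) = ENNReal.ofReal 2 by simp,
    ← ENNReal.ofReal_mul two_pos.le]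
  congr 1
  ring

/-- The Mittag-Leffler expansion of the cotangent, evaluated at `iy`. -/
theorem hasSum_inv_sq_add_sq {y : ℝ} (hy : 0 < y) :
    HasSum (fun n : ℕ => 1 / (y ^ 2 + ((n : ℝ) + 1) ^ 2))
      ((Real.pi * (Real.cosh (Real.pi * y) / Real.sinh (Real.pi * y)) - 1 / y) / (2 * y)) := by
  have hz : (y * Complex.I : ℂ) ∈ Complex.integerComplement := by
    rw [Complex.mem_integerComplement_iff]
    rintro ⟨n, hn⟩
    have := congrArg Complex.im hn
    simp at this
    exact hy.ne this
  have hs : HasSum (fun n => cotTerm (y * Complex.I) n) _ := (summable_cotTerm hz).hasSum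
  have e : ∑' n, cotTerm (y * Complex.I) n = _ := (cot_series_rep' hz).symm
  rw [e] at hs
  have hpt : ∀ n : ℕ, cotTerm (y * Complex.I) n =
      ((1 / (y ^ 2 + ((n : ℝ) + 1) ^ 2) : ℝ) : ℂ) * (-2 * y * Complex.I) := by
    intro n
    rw [cotTerm_identity hz]
    have h1 : (y * Complex.I + (n + 1)) * (y * Complex.I - (n + 1)) =
        -((y ^ 2 + ((n : ℝ) + 1) ^ 2 : ℝ) : ℂ) := by
      push_cast
      linear_combination (y : ℂ) ^ 2 * Complex.I_sq
    have h3 : ((y ^ 2 + ((n : ℝ) + 1) ^ 2 : ℝ) : ℂ) ≠ 0 := by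
      exact_mod_cast (by positivity : (0 : ℝ) < y ^ 2 + ((n : ℝ) + 1) ^ 2).ne'
    rw [h1, Complex.ofReal_div, Complex.ofReal_one]
    field_simp
  simp only [hpt] at hs
  have hsinh : Real.sinh (Real.pi * y) ≠ 0 :=
    (Real.sinh_pos_iff.mpr (by have := Real.pi_pos; positivity)).ne'
  have h2 : (Real.pi * Complex.cot (Real.pi * (y * Complex.I)) - 1 / (y * Complex.I) : ℂ) =
      (((Real.pi * (Real.cosh (Real.pi * y) / Real.sinh (Real.pi * y)) - 1 / y) / (2 * y) : ℝ) : ℂ) *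
        (-2 * y * Complex.I) := by
    have hy' : (y : ℂ) ≠ 0 := by exact_mod_cast hy.ne'
    have hsinh' : Complex.sinh (Real.pi * y) ≠ 0 := by exact_mod_cast hsinh
    rw [← mul_assoc, Complex.cot_eq_cos_div_sin, Complex.cos_mul_I, Complex.sin_mul_I]
    push_cast
    have hI := Complex.I_ne_zero
    field_simp
    linear_combination (Real.pi * y * Complex.cosh (Real.pi * y) - Complex.sinh (Real.pi * y)) * Complex.I_sq
  rw [h2] at hs
  have h3 : (-2 * y * Complex.I : ℂ) ≠ 0 := by simp [hy.ne']
  rw [hasSum_mul_right_iff h3] at hs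
  exact_mod_cast hs

/-- This is `∑ n rⁿ = r / (1 - r)²` at `r = e^{-ct}`; it writes the thermal kernel as a positive
combination of exponentials. -/
theorem hasSum_sinh_kernel {c t : ℝ} (hc : 0 < c) (ht : 0 < t) :
    HasSum (fun n : ℕ => c ^ 2 * ((n : ℝ) + 1) * Real.exp (-(c * (n + 1) * t)))
      ((c / 2) ^ 2 / Real.sinh (c * t / 2) ^ 2) := by
  have hct : 0 < c * t := by positivity
  set r := Real.exp (-(c * t)) with hr
  have hr1 : r < 1 := by rw [hr, Real.exp_lt_one_iff]; linarith
  have hr0 : 0 < r := Real.exp_pos _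
  have h := hasSum_coe_mul_geometric_of_norm_lt_one (𝕜 := ℝ) (r := r)
    (by rw [Real.norm_of_nonneg hr0.le]; exact hr1)
  rw [← hasSum_nat_add_iff' 1] at h
  simp only [Finset.range_one, Finset.sum_singleton, Nat.cast_zero, zero_mul, sub_zero] at h
  have h' := h.mul_left (c ^ 2)
  have hval : c ^ 2 * (r / (1 - r) ^ 2) = (c / 2) ^ 2 / Real.sinh (c * t / 2) ^ 2 := by
    have e : Real.sinh (c * t / 2) ^ 2 = (1 - r) ^ 2 / (4 * r) := by
      have h1 : Real.exp (c * t / 2) * Real.exp (-(c * t / 2)) = 1 := by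
        rw [← Real.exp_add]; simp
      have h2 : r = Real.exp (-(c * t / 2)) ^ 2 := by
        rw [hr, ← Real.exp_nat_mul]; congr 1; push_cast; ring
      rw [Real.sinh_eq, h2]
      set u := Real.exp (c * t / 2)
      set v := Real.exp (-(c * t / 2))
      have hv : v ≠ 0 := (Real.exp_pos _).ne'
      have hu : u = 1 / v := by field_simp; exact h1
      rw [hu]
      field_simp
      ring
    rw [e]
    have : 1 - r ≠ 0 := by linarith
    field_simp
    ring
  rw [← hval]
  refine h'.congr_fun fun n => ?_
  have h4 : Real.exp (-(c * (n + 1) * t)) = r ^ (n + 1) := by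
    rw [hr, ← Real.exp_nat_mul]
    congr 1
    push_cast
    ring
  rw [h4]
  push_cast
  ring

/-- Integrating the exponential expansion of the kernel term by term gives the partial fractions of
`coth` without its pole at zero. The missing pole is the summand `2c`, which becomes the mass term
of the thermal norm. -/
theorem lintegral_two_sub_two_cos_div_sinh_sq {c p : ℝ} (hc : 0 < c) (hp : 0 < p) :
    (∫⁻ t : ℝ, ENNReal.ofReal ((c / 2) ^ 2 / Real.sinh (c * t / 2) ^ 2) *
        ENNReal.ofReal (2 - 2 * Real.cos (p * t))) + ENNReal.ofReal (2 * c) =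
      ENNReal.ofReal (2 * Real.pi *
        (p * (Real.cosh (Real.pi * p / c) / Real.sinh (Real.pi * p / c)))) := by
  rw [lintegral_even (by intro t; simp [neg_div])]
  have e : ∫⁻ t in Ioi (0 : ℝ), ENNReal.ofReal ((c / 2) ^ 2 / Real.sinh (c * t / 2) ^ 2) *
        ENNReal.ofReal (2 - 2 * Real.cos (p * t)) =
      ∫⁻ t in Ioi (0 : ℝ), ∑' n : ℕ, ENNReal.ofReal (c ^ 2 * ((n : ℝ) + 1)) *
        ENNReal.ofReal ((2 - 2 * Real.cos (p * t)) * Real.exp (-(c * (n + 1) * t))) := by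
    refine setLIntegral_congr_fun measurableSet_Ioi fun t ht => ?_
    have h := hasSum_sinh_kernel hc ht
    rw [← h.tsum_eq, ENNReal.ofReal_tsum_of_nonneg (fun n => by positivity) h.summable,
      ← ENNReal.tsum_mul_right]
    refine tsum_congr fun n => ?_
    rw [← ENNReal.ofReal_mul (by positivity), ← ENNReal.ofReal_mul (by positivity)]
    congr 1
    ring
  have hterm : ∀ n : ℕ, ∫⁻ t in Ioi (0 : ℝ), ENNReal.ofReal (c ^ 2 * ((n : ℝ) + 1)) *
        ENNReal.ofReal ((2 - 2 * Real.cos (p * t)) * Real.exp (-(c * (n + 1) * t))) =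
      ENNReal.ofReal (2 * p ^ 2 / c * (1 / ((p / c) ^ 2 + ((n : ℝ) + 1) ^ 2))) := by
    intro n
    rw [lintegral_const_mul _ (by fun_prop), setLIntegral_one_sub_cos_mul_exp (by positivity),
      ← ENNReal.ofReal_mul (by positivity)]
    congr 1
    have h1 : (c * (n + 1)) ^ 2 + p ^ 2 ≠ 0 := by positivity
    have h2 : (p / c) ^ 2 + ((n : ℝ) + 1) ^ 2 ≠ 0 := by positivity
    field_simp
    ring
  have hs := (hasSum_inv_sq_add_sq (y := p / c) (by positivity)).mul_left (2 * p ^ 2 / c)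
  rw [e, lintegral_tsum (fun n => by fun_prop), tsum_congr hterm,
    ← ENNReal.ofReal_tsum_of_nonneg (fun n => by positivity) hs.summable, hs.tsum_eq,
    show (2 : ℝ≥0∞) = ENNReal.ofReal 2 by simp, ← ENNReal.ofReal_mul two_pos.le,
    ← ENNReal.ofReal_add _ (by positivity)]
  · congr 1
    rw [← mul_div_assoc Real.pi p c]
    field_simp
    ring
  · rw [← hs.tsum_eq]
    have : 0 ≤ ∑' n : ℕ, 2 * p ^ 2 / c * (1 / ((p / c) ^ 2 + ((n : ℝ) + 1) ^ 2)) :=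
      tsum_nonneg fun n => by positivity
    linarith

/-! ### The one-particle norms in position space -/

theorem norm_exp_sub_one_sq (x : ℝ) :
    ‖Complex.exp (-(Complex.I * (x : ℝ))) - 1‖ ^ 2 = 2 - 2 * Real.cos x := by
  have h : Complex.exp (-(Complex.I * (x : ℝ))) = Complex.exp ((-x : ℝ) * Complex.I) := by
    congr 1; push_cast; ring
  rw [h, Complex.sq_norm, Complex.normSq_apply]
  simp only [Complex.sub_re, Complex.sub_im, Complex.exp_ofReal_mul_I_re,
    Complex.exp_ofReal_mul_I_im, Complex.one_re, Complex.one_im, Real.cos_neg, Real.sin_neg]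
  nlinarith [Real.sin_sq_add_cos_sq x]

/-- Plancherel for the difference of two translates: its transform carries the factor `e^{-ipt} -
1`, of squared modulus `2 - 2 cos (pt)`. -/
theorem lintegral_comp_add_sub_sq {f : ℝ → ℝ} (hf : Integrable f) (hf2 : MemLp f 2) (t : ℝ) :
    ENNReal.ofReal (2 * Real.pi) * ∫⁻ x, ENNReal.ofReal ((f (x + t) - f x) ^ 2) =
      ∫⁻ p, ENNReal.ofReal (2 - 2 * Real.cos (p * t)) * ENNReal.ofReal (‖lineFourier f p‖ ^ 2) := by
  have h1 : Integrable fun x => f (x + t) := hf.comp_add_right t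
  have h2 : MemLp (fun x => f (x + t)) 2 :=
    hf2.comp_measurePreserving (measurePreserving_add_right volume t)
  have h3 := lintegral_enorm_lineFourier_sq (h1.sub hf) (h2.sub hf2)
  simp only [Pi.sub_apply] at h3
  rw [← h3]
  refine lintegral_congr fun p => ?_
  have e := lineFourier_sub h1 hf p
  rw [lineFourier_comp_add] at e
  have e' : lineFourier ((fun x => f (x + t)) - f) p =
      (Complex.exp (-(Complex.I * (p * t : ℝ))) - 1) * lineFourier f p := by
    rw [sub_mul, one_mul, ← e]; rfl
  rw [e', norm_mul, mul_pow, norm_exp_sub_one_sq, ENNReal.ofReal_mul (two_sub_two_cos_nonneg _)]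

/-- By Tonelli, a translation-invariant quadratic form of differences is diagonal in momentum space,
and the kernel determines the momentum weight. -/
theorem lintegral_kernel_eq {f : ℝ → ℝ} (hf : Integrable f) (hf2 : MemLp f 2)
    {k : ℝ → ℝ≥0∞} (hk : Measurable k) :
    ENNReal.ofReal (2 * Real.pi) *
        ∫⁻ t, k t * ∫⁻ x, ENNReal.ofReal ((f (x + t) - f x) ^ 2) =
      ∫⁻ p, ENNReal.ofReal (‖lineFourier f p‖ ^ 2) *
        ∫⁻ t, k t * ENNReal.ofReal (2 - 2 * Real.cos (p * t)) := by
  have hc := (continuous_lineFourier hf).measurable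
  calc _ = ∫⁻ t, k t * (ENNReal.ofReal (2 * Real.pi) *
        ∫⁻ x, ENNReal.ofReal ((f (x + t) - f x) ^ 2)) := by
        rw [← lintegral_const_mul' _ _ ENNReal.ofReal_ne_top]
        exact lintegral_congr fun t => by ring
    _ = ∫⁻ t, ∫⁻ p, ENNReal.ofReal (‖lineFourier f p‖ ^ 2) *
          (k t * ENNReal.ofReal (2 - 2 * Real.cos (p * t))) := by
        refine lintegral_congr fun t => ?_
        rw [lintegral_comp_add_sub_sq hf hf2, ← lintegral_const_mul _ (by fun_prop)]
        exact lintegral_congr fun p => by ring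
    _ = ∫⁻ p, ∫⁻ t, ENNReal.ofReal (‖lineFourier f p‖ ^ 2) *
          (k t * ENNReal.ofReal (2 - 2 * Real.cos (p * t))) := by
        refine lintegral_lintegral_swap (Measurable.aemeasurable ?_)
        simp only [Function.uncurry_def]
        fun_prop
    _ = _ := by
        refine lintegral_congr fun p => ?_
        rw [lintegral_const_mul _ (by fun_prop)]

theorem measurable_ofReal_inv_sq : Measurable fun t : ℝ => ENNReal.ofReal (1 / t ^ 2) := by
  fun_prop

theorem measurable_sinh_kernel (c : ℝ) :
    Measurable fun t : ℝ => ENNReal.ofReal ((c / 2) ^ 2 / Real.sinh (c * t / 2) ^ 2) := by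
  have : Measurable fun t : ℝ => Real.sinh (c * t / 2) :=
    (Real.continuous_sinh.comp (by fun_prop)).measurable
  fun_prop

theorem norm_lineFourier_neg_arg (f : ℝ → ℝ) (p : ℝ) :
    ‖lineFourier f (-p)‖ = ‖lineFourier f p‖ := by
  rw [lineFourier_neg_arg, RCLike.norm_conj]

/-- The vacuum norm is a Gagliardo seminorm. -/
theorem lintegral_vacuum_eq {f : ℝ → ℝ} (hf : Integrable f) (hf2 : MemLp f 2) :
    ENNReal.ofReal (2 * Real.pi) * ∫⁻ p, ENNReal.ofReal (‖lineFourier f p‖ ^ 2) ∂vacuumMeasure =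
      ∫⁻ t, ENNReal.ofReal (1 / t ^ 2) * ∫⁻ x, ENNReal.ofReal ((f (x + t) - f x) ^ 2) := by
  have hpi := Real.pi_pos
  have hc := (continuous_lineFourier hf).measurable
  have h := (lintegral_kernel_eq hf hf2 measurable_ofReal_inv_sq).symm
  simp only [lintegral_two_sub_two_cos_div_sq] at h
  rw [lintegral_even (by intro p; rw [norm_lineFourier_neg_arg, abs_neg])] at h
  have h2 : 2 * ∫⁻ p in Ioi (0 : ℝ), ENNReal.ofReal (‖lineFourier f p‖ ^ 2) *
        ENNReal.ofReal (2 * Real.pi * |p|) =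
      ENNReal.ofReal (2 * Real.pi) * (ENNReal.ofReal (2 * Real.pi) *
        ∫⁻ p, ENNReal.ofReal (‖lineFourier f p‖ ^ 2) ∂vacuumMeasure) := by
    rw [vacuumMeasure, lintegral_withDensity_eq_lintegral_mul _ (by fun_prop) (by fun_prop),
      show (2 : ℝ≥0∞) = ENNReal.ofReal 2 by simp, ← lintegral_const_mul _ (by fun_prop),
      ← lintegral_const_mul _ (by fun_prop), ← lintegral_const_mul _ (by fun_prop)]
    refine setLIntegral_congr_fun measurableSet_Ioi fun p hp => ?_
    have hp' : 0 < p := hp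
    simp only [Pi.mul_apply]
    rw [abs_of_pos hp', mul_comm (ENNReal.ofReal (‖lineFourier f p‖ ^ 2)), ← mul_assoc, ← mul_assoc,
      ← mul_assoc, ← ENNReal.ofReal_mul (by positivity), ← ENNReal.ofReal_mul (by positivity),
      ← ENNReal.ofReal_mul (by positivity), ← ENNReal.ofReal_mul (by positivity),
      ← ENNReal.ofReal_mul (by positivity)]
    congr 1
    field_simp
  rw [h2] at h
  exact ((ENNReal.mul_right_inj (by simpa using hpi) ENNReal.ofReal_ne_top).mp h)

theorem sinh_pos_of_thermal {β p : ℝ} (hβ : 0 < β) (hp : 0 < p) : 0 < Real.sinh (β * p / 2) :=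
  Real.sinh_pos_iff.mpr (by positivity)

/-- The thermal norm in position space. -/
theorem lintegral_thermal_eq {f : ℝ → ℝ} (hf : Integrable f) (hf2 : MemLp f 2) {β : ℝ}
    (hβ : 0 < β) :
    ENNReal.ofReal (2 * Real.pi) *
        ∫⁻ p, ENNReal.ofReal (‖lineFourier f p‖ ^ 2) ∂(thermalMeasure β) =
      (∫⁻ t, ENNReal.ofReal ((2 * Real.pi / β / 2) ^ 2 / Real.sinh (2 * Real.pi / β * t / 2) ^ 2) *
        ∫⁻ x, ENNReal.ofReal ((f (x + t) - f x) ^ 2)) +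
      ENNReal.ofReal (2 * (2 * Real.pi / β)) * ∫⁻ x, ENNReal.ofReal (f x ^ 2) := by
  have hpi := Real.pi_pos
  have hcpos : 0 < 2 * Real.pi / β := by positivity
  set c := 2 * Real.pi / β with hcdef
  have hc := (continuous_lineFourier hf).measurable
  have hm := measurable_sinh_kernel c
  have h := lintegral_kernel_eq hf hf2 hm
  have h0 := lintegral_enorm_lineFourier_sq hf hf2
  have hsum : ENNReal.ofReal (2 * Real.pi) *
      ((∫⁻ t, ENNReal.ofReal ((c / 2) ^ 2 / Real.sinh (c * t / 2) ^ 2) *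
        ∫⁻ x, ENNReal.ofReal ((f (x + t) - f x) ^ 2)) +
        ENNReal.ofReal (2 * c) * ∫⁻ x, ENNReal.ofReal (f x ^ 2)) =
      ∫⁻ p, ENNReal.ofReal (‖lineFourier f p‖ ^ 2) *
        ((∫⁻ t, ENNReal.ofReal ((c / 2) ^ 2 / Real.sinh (c * t / 2) ^ 2) *
          ENNReal.ofReal (2 - 2 * Real.cos (p * t))) + ENNReal.ofReal (2 * c)) := by
    rw [mul_add, h, mul_left_comm, ← h0, ← lintegral_const_mul _ (by fun_prop), ← lintegral_add_right _ (by fun_prop)]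
    exact lintegral_congr fun p => by ring
  replace hsum := hsum.symm
  rw [lintegral_even (by
    intro p
    rw [norm_lineFourier_neg_arg]
    simp only [neg_mul, Real.cos_neg])] at hsum
  have h2 : 2 * ∫⁻ p in Ioi (0 : ℝ), ENNReal.ofReal (‖lineFourier f p‖ ^ 2) *
        ((∫⁻ t, ENNReal.ofReal ((c / 2) ^ 2 / Real.sinh (c * t / 2) ^ 2) *
          ENNReal.ofReal (2 - 2 * Real.cos (p * t))) + ENNReal.ofReal (2 * c)) =
      ENNReal.ofReal (2 * Real.pi) * (ENNReal.ofReal (2 * Real.pi) *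
        ∫⁻ p, ENNReal.ofReal (‖lineFourier f p‖ ^ 2) ∂(thermalMeasure β)) := by
    have hms : Measurable fun p : ℝ => ENNReal.ofReal
        (p * (Real.cosh (β * p / 2) / Real.sinh (β * p / 2)) / Real.pi) := by
      have h1 : Measurable fun p : ℝ => Real.sinh (β * p / 2) :=
        (Real.continuous_sinh.comp (by fun_prop)).measurable
      have h2 : Measurable fun p : ℝ => Real.cosh (β * p / 2) :=
        (Real.continuous_cosh.comp (by fun_prop)).measurable
      fun_prop
    rw [thermalMeasure, lintegral_withDensity_eq_lintegral_mul _ hms (by fun_prop),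
      show (2 : ℝ≥0∞) = ENNReal.ofReal 2 by simp,
      ← lintegral_const_mul _ (by fun_prop), ← lintegral_const_mul _ (by fun_prop),
      ← lintegral_const_mul' _ _ ENNReal.ofReal_ne_top]
    refine setLIntegral_congr_fun measurableSet_Ioi fun p hp => ?_
    have hp' : 0 < p := hp
    have hs := sinh_pos_of_thermal hβ hp'
    have hch := Real.cosh_pos (β * p / 2)
    simp only [Pi.mul_apply]
    rw [lintegral_two_sub_two_cos_div_sinh_sq hcpos hp',
      show Real.pi * p / c = β * p / 2 by rw [hcdef]; field_simp,
      mul_comm (ENNReal.ofReal (‖lineFourier f p‖ ^ 2)), ← mul_assoc, ← mul_assoc,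
      ← mul_assoc, ← ENNReal.ofReal_mul (by positivity), ← ENNReal.ofReal_mul (by positivity),
      ← ENNReal.ofReal_mul (by positivity), ← ENNReal.ofReal_mul (by positivity),
      ← ENNReal.ofReal_mul (by positivity)]
    congr 1
    field_simp
  rw [h2] at hsum
  exact ((ENNReal.mul_right_inj (by simpa using hpi) ENNReal.ofReal_ne_top).mp hsum)

/-! ### A logistic coordinate of an interval -/

/-- The logistic diffeomorphism of the line onto `(a, b)`. -/
def intervalParam (a b c s : ℝ) : ℝ := a + (b - a) / (1 + Real.exp (-(c * s)))

/-- The inverse of `intervalParam`. -/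
def intervalCoord (a b c x : ℝ) : ℝ := Real.log ((x - a) / (b - x)) / c

section

variable {a b c : ℝ}

theorem intervalParam_sub_left (a b c s : ℝ) :
    intervalParam a b c s - a = (b - a) / (1 + Real.exp (-(c * s))) := by
  simp [intervalParam]

theorem sub_intervalParam_right (a b c s : ℝ) :
    b - intervalParam a b c s = (b - a) * Real.exp (-(c * s)) / (1 + Real.exp (-(c * s))) := by
  have := Real.exp_pos (-(c * s))
  rw [intervalParam]
  field_simp
  ring

theorem intervalParam_mem (hab : a < b) (c s : ℝ) : intervalParam a b c s ∈ Ioo a b := by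
  have := Real.exp_pos (-(c * s))
  have hba : 0 < b - a := sub_pos.mpr hab
  constructor
  · rw [← sub_pos, intervalParam_sub_left]; positivity
  · rw [← sub_pos, sub_intervalParam_right]; positivity

theorem intervalCoord_param (hab : a < b) (hc : 0 < c) (s : ℝ) :
    intervalCoord a b c (intervalParam a b c s) = s := by
  have hE := Real.exp_pos (-(c * s))
  have hba : b - a ≠ 0 := (sub_pos.mpr hab).ne'
  have h : (b - a) / (1 + Real.exp (-(c * s))) /
      ((b - a) * Real.exp (-(c * s)) / (1 + Real.exp (-(c * s)))) = Real.exp (c * s) := by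
    rw [Real.exp_neg] at *
    have := Real.exp_pos (c * s)
    field_simp
  rw [intervalCoord, intervalParam_sub_left, sub_intervalParam_right, h, Real.log_exp]
  field_simp

theorem intervalParam_coord (hc : 0 < c) {x : ℝ} (hx : x ∈ Ioo a b) :
    intervalParam a b c (intervalCoord a b c x) = x := by
  have h1 : 0 < x - a := sub_pos.mpr hx.1
  have h2 : 0 < b - x := sub_pos.mpr hx.2
  have h3 : c * intervalCoord a b c x = Real.log ((x - a) / (b - x)) := by
    rw [intervalCoord]; field_simp
  rw [intervalParam, h3, Real.exp_neg, Real.exp_log (by positivity)]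
  have h4 : b - a ≠ 0 := by linarith
  field_simp
  rw [show x - a + (b - x) = b - a by ring]
  field_simp
  ring

theorem intervalParam_injective (hab : a < b) (hc : 0 < c) :
    Function.Injective (intervalParam a b c) :=
  Function.LeftInverse.injective (intervalCoord_param hab hc)

theorem range_intervalParam (hab : a < b) (hc : 0 < c) : range (intervalParam a b c) = Ioo a b := by
  ext x
  constructor
  · rintro ⟨s, rfl⟩
    exact intervalParam_mem hab c s
  · exact fun hx => ⟨_, intervalParam_coord hc hx⟩

theorem contDiff_intervalParam (a b c : ℝ) : ContDiff ℝ ∞ (intervalParam a b c) := by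
  have h : ContDiff ℝ ∞ fun s : ℝ => 1 + Real.exp (-(c * s)) :=
    contDiff_const.add (Real.contDiff_exp.comp (by fun_prop))
  exact contDiff_const.add (contDiff_const.div h fun s => by positivity)

theorem contDiffAt_intervalCoord {x : ℝ} (hx : x ∈ Ioo a b) :
    ContDiffAt ℝ ∞ (intervalCoord a b c) x := by
  have h1 : 0 < x - a := sub_pos.mpr hx.1
  have h2 : 0 < b - x := sub_pos.mpr hx.2
  have h : ContDiffAt ℝ ∞ (fun x => (x - a) / (b - x)) x :=
    ContDiffAt.div (by fun_prop) (by fun_prop) h2.ne'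
  exact (h.log (by positivity)).div_const c

theorem hasDerivAt_intervalParam (hab : a < b) (c s : ℝ) :
    HasDerivAt (intervalParam a b c)
      (c * ((intervalParam a b c s - a) * (b - intervalParam a b c s) / (b - a))) s := by
  have hE := Real.exp_pos (-(c * s))
  have hba : b - a ≠ 0 := (sub_pos.mpr hab).ne'
  have h1 : HasDerivAt (fun s : ℝ => 1 + Real.exp (-(c * s))) (Real.exp (-(c * s)) * (-(c * 1))) s :=
    ((((hasDerivAt_id s).const_mul c).neg).exp).const_add 1
  have h2 := ((hasDerivAt_const s (b - a)).div h1 (by positivity)).const_add a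
  refine h2.congr_deriv ?_
  rw [intervalParam_sub_left, sub_intervalParam_right]
  field_simp
  ring

theorem intervalParam_deriv_pos (hab : a < b) (hc : 0 < c) (s : ℝ) :
    0 < c * ((intervalParam a b c s - a) * (b - intervalParam a b c s) / (b - a)) := by
  have h := intervalParam_mem hab c s
  have h1 : 0 < intervalParam a b c s - a := sub_pos.mpr h.1
  have h2 : 0 < b - intervalParam a b c s := sub_pos.mpr h.2
  have hba : 0 < b - a := sub_pos.mpr hab
  positivity

/-- The conformal covariance of `1/(x - y)²`: multiplied by the two Jacobians of the logistic map,
it becomes a function of `s' - s` alone, and this function is the thermal kernel. -/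
theorem intervalParam_kernel (hab : a < b) (hc : 0 < c) (s s' : ℝ) :
    c * ((intervalParam a b c s - a) * (b - intervalParam a b c s) / (b - a)) *
      (c * ((intervalParam a b c s' - a) * (b - intervalParam a b c s') / (b - a))) *
        (1 / (intervalParam a b c s' - intervalParam a b c s) ^ 2) =
      (c / 2) ^ 2 / Real.sinh (c * (s' - s) / 2) ^ 2 := by
  -- On the diagonal both sides are `0`, by the convention for division by zero.
  rcases eq_or_ne s s' with rfl | hne
  · simp
  have hba : b - a ≠ 0 := (sub_pos.mpr hab).ne'
  have hx : intervalParam a b c s' - intervalParam a b c s ≠ 0 :=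
    sub_ne_zero.mpr fun h => hne (intervalParam_injective hab hc h).symm
  have hs : Real.sinh (c * (s' - s) / 2) ≠ 0 := by
    rw [Ne, Real.sinh_eq_zero]
    intro h
    have : c * (s' - s) = 0 := by linarith
    rcases mul_eq_zero.mp this with h | h
    · exact hc.ne' h
    · exact hne (by linarith)
  set e := Real.exp (-(c * s) / 2) with he
  set e' := Real.exp (-(c * s') / 2) with he'
  have hep : 0 < e := Real.exp_pos _
  have hep' : 0 < e' := Real.exp_pos _
  have hE : Real.exp (-(c * s)) = e ^ 2 := by
    rw [he, ← Real.exp_nat_mul]; congr 1; push_cast; ring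
  have hE' : Real.exp (-(c * s')) = e' ^ 2 := by
    rw [he', ← Real.exp_nat_mul]; congr 1; push_cast; ring
  have h1 : Real.exp (c * (s' - s) / 2) = e / e' := by
    rw [he, he', ← Real.exp_sub]; congr 1; ring
  have h2 : Real.exp (-(c * (s' - s) / 2)) = e' / e := by
    rw [he, he', ← Real.exp_sub]; congr 1; ring
  have hd : intervalParam a b c s' - intervalParam a b c s =
      (b - a) * (e ^ 2 - e' ^ 2) / ((1 + e ^ 2) * (1 + e' ^ 2)) := by
    rw [intervalParam, intervalParam, hE, hE']
    field_simp
    ring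
  have hsinh : Real.sinh (c * (s' - s) / 2) = (e ^ 2 - e' ^ 2) / (2 * e * e') := by
    rw [Real.sinh_eq, h1, h2]
    field_simp
  have hdiff : e ^ 2 - e' ^ 2 ≠ 0 := by
    intro h
    rw [hsinh, h] at hs
    simp at hs
  rw [hd, hsinh, intervalParam_sub_left, intervalParam_sub_left, sub_intervalParam_right,
    sub_intervalParam_right, hE, hE']
  field_simp

theorem lintegral_Ioo_eq (hab : a < b) (hc : 0 < c) (G : ℝ → ℝ≥0∞) :
    ∫⁻ x in Ioo a b, G x = ∫⁻ s, ENNReal.ofReal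
      (c * ((intervalParam a b c s - a) * (b - intervalParam a b c s) / (b - a))) *
        G (intervalParam a b c s) := by
  have h := lintegral_image_eq_lintegral_abs_deriv_mul MeasurableSet.univ
    (fun s _ => (hasDerivAt_intervalParam hab c s).hasDerivWithinAt)
    (intervalParam_injective hab hc).injOn G
  rw [image_univ, range_intervalParam hab hc, Measure.restrict_univ] at h
  rw [h]
  refine lintegral_congr fun s => ?_
  rw [abs_of_pos (intervalParam_deriv_pos hab hc s)]

/-! ### Conformal covariance of the norms -/

theorem lintegral_kernel_eq_double {k : ℝ → ℝ≥0∞} (hk : Measurable k) {f : ℝ → ℝ}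
    (hf : Measurable f) :
    ∫⁻ t, k t * ∫⁻ x, ENNReal.ofReal ((f (x + t) - f x) ^ 2) =
      ∫⁻ x, ∫⁻ y, k (y - x) * ENNReal.ofReal ((f y - f x) ^ 2) := by
  calc _ = ∫⁻ t, ∫⁻ x, k t * ENNReal.ofReal ((f (x + t) - f x) ^ 2) :=
        lintegral_congr fun t => (lintegral_const_mul _ (by fun_prop)).symm
    _ = ∫⁻ x, ∫⁻ t, k t * ENNReal.ofReal ((f (x + t) - f x) ^ 2) := by
        refine lintegral_lintegral_swap (Measurable.aemeasurable ?_)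
        simp only [Function.uncurry_def]
        fun_prop
    _ = _ := by
        refine lintegral_congr fun x => ?_
        rw [← lintegral_sub_right_eq_self (μ := volume)
          (fun t => k t * ENNReal.ofReal ((f (x + t) - f x) ^ 2)) x]
        refine lintegral_congr fun y => ?_
        rw [add_sub_cancel]

/-- The two half-lines contribute `1/(x - a)` and `1/(b - x)`. Their sum is the reciprocal of the
modular weight, up to a constant the inverse of the Jacobian of the logistic map; hence the mass
term in the new coordinate is constant. -/
theorem setLIntegral_compl_Ioo_inv_sq {x : ℝ} (hx : x ∈ Ioo a b) :
    ∫⁻ y in (Ioo a b)ᶜ, ENNReal.ofReal (1 / (y - x) ^ 2) =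
      ENNReal.ofReal ((b - a) / ((x - a) * (b - x))) := by
  have h1 : 0 < x - a := sub_pos.mpr hx.1
  have h2 : 0 < b - x := sub_pos.mpr hx.2
  have hab : a < b := hx.1.trans hx.2
  have key : ∀ d : ℝ, 0 < d → ∫⁻ t in Ioi d, ENNReal.ofReal (1 / t ^ 2) = ENNReal.ofReal (1 / d) := by
    intro d hd
    have hder : ∀ t ∈ Ici d, HasDerivAt (fun t : ℝ => -(1 / t)) (1 / t ^ 2) t := by
      intro t ht
      have ht0 : t ≠ 0 := (hd.trans_le ht).ne'
      have := (hasDerivAt_inv ht0).neg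
      simp only [one_div]
      refine this.congr_deriv (by simp)
    have hlim : Tendsto (fun t : ℝ => -(1 / t)) atTop (𝓝 0) := by
      simpa using (tendsto_inv_atTop_zero (𝕜 := ℝ)).neg
    rw [← ofReal_integral_eq_lintegral_ofReal
      (integrableOn_Ioi_deriv_of_nonneg' hder (fun t _ => by positivity) hlim)
      (by filter_upwards with t; simp only [Pi.zero_apply]; positivity),
      integral_Ioi_of_hasDerivAt_of_nonneg' hder (fun t _ => by positivity) hlim]
    simp
  have hsplit : (Ioo a b)ᶜ = Iic a ∪ Ici b := by
    ext y
    simp only [mem_compl_iff, mem_Ioo, not_and_or, not_lt, mem_union, mem_Iic, mem_Ici]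
  rw [hsplit, lintegral_union measurableSet_Ici
    (disjoint_left.mpr fun y hy hy' => by
      simp only [mem_Iic, mem_Ici] at hy hy'; linarith)]
  have e1 : ∫⁻ y in Ici b, ENNReal.ofReal (1 / (y - x) ^ 2) = ENNReal.ofReal (1 / (b - x)) := by
    rw [← key _ h2, ← restrict_Ioi_eq_restrict_Ici]
    have h := (measurePreserving_sub_right volume x).setLIntegral_comp_emb
      (MeasurableEquiv.subRight x).measurableEmbedding
      (fun t => ENNReal.ofReal (1 / t ^ 2)) (Ioi b)
    rw [h]
    simp
  have e2 : ∫⁻ y in Iic a, ENNReal.ofReal (1 / (y - x) ^ 2) = ENNReal.ofReal (1 / (x - a)) := by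
    rw [← key _ h1, ← restrict_Iio_eq_restrict_Iic]
    have h := (Measure.measurePreserving_sub_left volume x).setLIntegral_comp_emb
      (MeasurableEquiv.subLeft x).measurableEmbedding
      (fun t => ENNReal.ofReal (1 / t ^ 2)) (Iio a)
    have h3 : (fun y => x - y) '' Iio a = Ioi (x - a) := by simp
    rw [h3] at h
    rw [← h]
    refine lintegral_congr fun y => ?_
    congr 2
    ring
  rw [e1, e2, ← ENNReal.ofReal_add (by positivity) (by positivity)]
  congr 1
  field_simp
  ring

/-- The double integral splits into inside-inside, two equal mixed parts, and outside-outside, which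
vanishes. The first becomes the `sinh` kernel by conformal covariance. In the mixed part one
variable integrates out, leaving `f²` times the reciprocal of the Jacobian, hence a mass term with
coefficient `2c`. -/
theorem lintegral_gagliardo_interval (hab : a < b) (hc : 0 < c) {f : ℝ → ℝ} (hf : Measurable f)
    (h0 : ∀ x ∉ Ioo a b, f x = 0) :
    ∫⁻ t, ENNReal.ofReal (1 / t ^ 2) * ∫⁻ x, ENNReal.ofReal ((f (x + t) - f x) ^ 2) =
      (∫⁻ t, ENNReal.ofReal ((c / 2) ^ 2 / Real.sinh (c * t / 2) ^ 2) *
        ∫⁻ s, ENNReal.ofReal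
          ((f (intervalParam a b c (s + t)) - f (intervalParam a b c s)) ^ 2)) +
      ENNReal.ofReal (2 * c) * ∫⁻ s, ENNReal.ofReal (f (intervalParam a b c s) ^ 2) := by
  have hσ : Measurable (intervalParam a b c) := (contDiff_intervalParam a b c).continuous.measurable
  rw [lintegral_kernel_eq_double measurable_ofReal_inv_sq hf,
    lintegral_kernel_eq_double (measurable_sinh_kernel c)
      (f := fun s => f (intervalParam a b c s)) (hf.comp hσ)]
  set I := Ioo a b with hI
  have hIm : MeasurableSet I := measurableSet_Ioo
  set K : ℝ → ℝ → ℝ≥0∞ := fun x y => ENNReal.ofReal (1 / (y - x) ^ 2) *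
    ENNReal.ofReal ((f y - f x) ^ 2) with hK
  have hKm : Measurable (Function.uncurry K) := by
    simp only [hK, Function.uncurry_def]
    fun_prop
  have hKx : ∀ x, Measurable (K x) := fun x => hKm.of_uncurry_left
  have hKs : ∀ x y, K x y = K y x := by
    intro x y
    simp only [hK]
    rw [← neg_sub x y, neg_sq, ← neg_sub (f x) (f y), neg_sq]
  have hin : ∀ s : Set ℝ, Measurable fun x => ∫⁻ y in s, K x y := fun s =>
    hKm.lintegral_prod_right'
  have split : ∫⁻ x, ∫⁻ y, K x y = (∫⁻ x in I, ∫⁻ y in I, K x y) +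
      2 * ∫⁻ x in I, ∫⁻ y in Iᶜ, K x y := by
    have e1 : ∀ x, ∫⁻ y, K x y = (∫⁻ y in I, K x y) + ∫⁻ y in Iᶜ, K x y := fun x =>
      (lintegral_add_compl _ hIm).symm
    simp only [e1]
    rw [lintegral_add_left (hin I), ← lintegral_add_compl (fun x => ∫⁻ y in I, K x y) hIm,
      ← lintegral_add_compl (fun x => ∫⁻ y in Iᶜ, K x y) hIm]
    have e2 : ∫⁻ x in Iᶜ, ∫⁻ y in Iᶜ, K x y = 0 := by
      rw [setLIntegral_congr_fun hIm.compl (g := fun _ => 0), lintegral_zero]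
      intro x hx
      simp only []
      rw [setLIntegral_congr_fun hIm.compl (g := fun _ => 0), lintegral_zero]
      intro y hy
      simp only [hK, h0 x hx, h0 y hy]
      simp
    have e3 : ∫⁻ x in Iᶜ, ∫⁻ y in I, K x y = ∫⁻ x in I, ∫⁻ y in Iᶜ, K x y := by
      rw [lintegral_lintegral_swap hKm.aemeasurable]
      simp only [hKs]
    rw [e2, e3]
    ring
  rw [split]
  congr 1
  · rw [lintegral_Ioo_eq hab hc]
    refine lintegral_congr fun s => ?_
    rw [lintegral_Ioo_eq hab hc, ← lintegral_const_mul' _ _ ENNReal.ofReal_ne_top]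
    refine lintegral_congr fun s' => ?_
    rw [← intervalParam_kernel hab hc s s']
    have p1 := (intervalParam_deriv_pos hab hc s).le
    have p2 := (intervalParam_deriv_pos hab hc s').le
    rw [ENNReal.ofReal_mul (mul_nonneg p1 p2), ENNReal.ofReal_mul p1]
    simp only [hK]
    ring
  · have e4 : ∫⁻ x in I, ∫⁻ y in Iᶜ, K x y =
        ∫⁻ x in I, ENNReal.ofReal ((b - a) / ((x - a) * (b - x))) * ENNReal.ofReal (f x ^ 2) := by
      refine setLIntegral_congr_fun hIm fun x hx => ?_
      rw [← setLIntegral_compl_Ioo_inv_sq hx, ← lintegral_mul_const _ (by fun_prop)]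
      refine setLIntegral_congr_fun hIm.compl fun y hy => ?_
      simp only [hK, h0 y hy, zero_sub, neg_sq]
    rw [e4, lintegral_Ioo_eq hab hc, ENNReal.ofReal_mul two_pos.le, ENNReal.ofReal_ofNat, mul_assoc,
      ← lintegral_const_mul' _ _ ENNReal.ofReal_ne_top]
    congr 1
    refine lintegral_congr fun s => ?_
    have h := intervalParam_mem hab c s
    have h1 : 0 < intervalParam a b c s - a := sub_pos.mpr h.1
    have h2 : 0 < b - intervalParam a b c s := sub_pos.mpr h.2
    have h3 : 0 < b - a := sub_pos.mpr hab
    rw [← mul_assoc, ← ENNReal.ofReal_mul (by positivity)]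
    congr 2
    field_simp

/-- The vacuum norm of a function on an interval is the thermal norm, in logistic coordinates. -/
theorem lintegral_vacuum_eq_thermal (hab : a < b) {β : ℝ} (hβ : 0 < β) {f : ℝ → ℝ}
    (hm : Measurable f) (h0 : ∀ x ∉ Ioo a b, f x = 0) (hf : Integrable f) (hf2 : MemLp f 2)
    (hg : Integrable fun s => f (intervalParam a b (2 * Real.pi / β) s))
    (hg2 : MemLp (fun s => f (intervalParam a b (2 * Real.pi / β) s)) 2) :
    ∫⁻ p, ENNReal.ofReal (‖lineFourier f p‖ ^ 2) ∂vacuumMeasure =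
      ∫⁻ p, ENNReal.ofReal (‖lineFourier (fun s => f (intervalParam a b (2 * Real.pi / β) s)) p‖ ^ 2)
        ∂(thermalMeasure β) := by
  have hpi := Real.pi_pos
  refine (ENNReal.mul_right_inj (a := ENNReal.ofReal (2 * Real.pi)) (by simpa using hpi)
    ENNReal.ofReal_ne_top).mp ?_
  rw [lintegral_vacuum_eq hf hf2, lintegral_thermal_eq hg hg2 hβ,
    lintegral_gagliardo_interval hab (by positivity : 0 < 2 * Real.pi / β) hm h0]

end

/-! ### Generalities on `L²` -/

theorem enorm_sq_eq_ofReal (z : ℂ) : ‖z‖ₑ ^ (2 : ℝ) = ENNReal.ofReal (‖z‖ ^ 2) := by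
  rw [ENNReal.ofReal_pow (norm_nonneg z), ofReal_norm]
  norm_cast

theorem memLp_two_of_lintegral_lt_top {μ : Measure ℝ} {F : ℝ → ℂ} (hF : AEStronglyMeasurable F μ)
    (h : ∫⁻ p, ENNReal.ofReal (‖F p‖ ^ 2) ∂μ < ⊤) : MemLp F 2 μ := by
  refine ⟨hF, ?_⟩
  rw [eLpNorm_lt_top_iff_lintegral_rpow_enorm_lt_top (by norm_num) (by norm_num)]
  simpa only [ENNReal.toReal_ofNat, enorm_sq_eq_ofReal] using h

theorem MeasureTheory.MemLp.lintegral_norm_sq_lt_top {μ : Measure ℝ} {F : ℝ → ℂ}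
    (hF : MemLp F 2 μ) : ∫⁻ p, ENNReal.ofReal (‖F p‖ ^ 2) ∂μ < ⊤ := by
  have h := (eLpNorm_lt_top_iff_lintegral_rpow_enorm_lt_top (by norm_num) (by norm_num)).mp hF.2
  simpa only [ENNReal.toReal_ofNat, enorm_sq_eq_ofReal] using h

theorem norm_sq_eq_toReal_lintegral {μ : Measure ℝ} {F : ℝ → ℂ} {v : Lp ℂ 2 μ} (h : v =ᵐ[μ] F) :
    ‖v‖ ^ 2 = (∫⁻ p, ENNReal.ofReal (‖F p‖ ^ 2) ∂μ).toReal := by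
  rw [Lp.norm_def, ← ENNReal.toReal_pow, eLpNorm_congr_ae h,
    eLpNorm_eq_lintegral_rpow_enorm_toReal (by norm_num) (by norm_num)]
  congr 1
  simp only [ENNReal.toReal_ofNat, enorm_sq_eq_ofReal]
  rw [← ENNReal.rpow_natCast, ← ENNReal.rpow_mul]
  norm_num

/-- Norms of real combinations determine only the real part of the inner product. The imaginary part
is the symplectic form and has to be compared separately. -/
theorem inner_eq_of_norm_eq {E F : Type*} [NormedAddCommGroup E] [InnerProductSpace ℂ E]
    [NormedAddCommGroup F] [InnerProductSpace ℂ F] {x y : E} {x' y' : F}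
    (h1 : ‖x + y‖ ^ 2 = ‖x' + y'‖ ^ 2) (h2 : ‖x - y‖ ^ 2 = ‖x' - y'‖ ^ 2)
    (h3 : (⟪x, y⟫_ℂ).im = (⟪x', y'⟫_ℂ).im) : ⟪x, y⟫_ℂ = ⟪x', y'⟫_ℂ := by
  refine Complex.ext ?_ h3
  have e1 := norm_add_sq (𝕜 := ℂ) x y
  have e2 := norm_sub_sq (𝕜 := ℂ) x y
  have e1' := norm_add_sq (𝕜 := ℂ) x' y'
  have e2' := norm_sub_sq (𝕜 := ℂ) x' y'
  simp only [RCLike.re_to_complex] at e1 e2 e1' e2'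
  linarith

/-! ### The symplectic form -/

theorem integral_Ioi_add_comp_neg {F : ℝ → ℂ} (hF : Integrable F) :
    ∫ p, F p = ∫ p in Ioi (0 : ℝ), (F p + F (-p)) := by
  rw [integral_add hF.integrableOn hF.comp_neg.integrableOn, integral_comp_neg_Ioi (f := F), neg_zero,
    add_comm, intervalIntegral.integral_Iic_add_Ioi hF.integrableOn hF.integrableOn]

theorem integrable_conj_lineFourier_mul {f g : ℝ → ℝ} (hf : Integrable f) (hf2 : MemLp f 2)
    (hg : Integrable g) (hg2 : MemLp g 2) :
    Integrable fun p => (starRingEnd ℂ) (lineFourier f p) * lineFourier g p :=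
  (memLp_lineFourier hf hf2).star.integrable_mul (memLp_lineFourier hg hg2)

theorem integrable_conj_lineFourier_mul_id {f g : ℝ → ℝ} (hf : Integrable f) (hf2 : MemLp f 2)
    (hg : IsTestFunction g) :
    Integrable fun p : ℝ => (starRingEnd ℂ) (lineFourier f p) * lineFourier g p * p := by
  have h := (integrable_conj_lineFourier_mul hf hf2 hg.deriv.integrable hg.deriv.memLp).const_mul
    Complex.I
  refine h.congr (ae_of_all _ fun p => ?_)
  simp only []
  rw [lineFourier_deriv hg]
  linear_combination (-(starRingEnd ℂ) (lineFourier f p) * lineFourier g p * p) * Complex.I_sq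

/-- For real functions the integrand at `-p` is minus the conjugate of the one at `p`. The integral
over the line is thus `2i` times the imaginary part over the half-line, and Plancherel with `g'`
evaluates it. -/
theorem im_integral_Ioi_conj_lineFourier_mul {f g : ℝ → ℝ} (hf : Integrable f) (hf2 : MemLp f 2)
    (hg : IsTestFunction g) :
    (∫ p in Ioi (0 : ℝ), (starRingEnd ℂ) (lineFourier f p) * lineFourier g p * p).im =
      Real.pi * ∫ x, f x * deriv g x := by
  have hi := integrable_conj_lineFourier_mul_id hf hf2 hg
  have h := integral_conj_lineFourier_mul hf hf2 hg.deriv.integrable hg.deriv.memLp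
  have e1 : ∫ p : ℝ, (starRingEnd ℂ) (lineFourier f p) * lineFourier g p * p =
      Complex.I * (2 * Real.pi * ((∫ x, f x * deriv g x : ℝ) : ℂ)) := by
    rw [← h, ← integral_const_mul]
    refine integral_congr_ae (ae_of_all _ fun p => ?_)
    simp only []
    rw [lineFourier_deriv hg]
    linear_combination ((starRingEnd ℂ) (lineFourier f p) * lineFourier g p * p) * Complex.I_sq
  rw [integral_Ioi_add_comp_neg hi] at e1
  have e2 : ∫ p in Ioi (0 : ℝ), ((starRingEnd ℂ) (lineFourier f p) * lineFourier g p * p +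
      (starRingEnd ℂ) (lineFourier f (-p)) * lineFourier g (-p) * (-p : ℝ)) =
      (∫ p in Ioi (0 : ℝ), (starRingEnd ℂ) (lineFourier f p) * lineFourier g p * p) -
      (starRingEnd ℂ) (∫ p in Ioi (0 : ℝ),
        (starRingEnd ℂ) (lineFourier f p) * lineFourier g p * p) := by
    have hi2 : IntegrableOn (fun p : ℝ => (starRingEnd ℂ)
        ((starRingEnd ℂ) (lineFourier f p) * lineFourier g p * p)) (Ioi 0) :=
      (RCLike.conjLIE (K := ℂ)).toContinuousLinearEquiv.toContinuousLinearMap.integrable_comp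
        hi.integrableOn
    rw [← integral_conj, ← integral_sub hi.integrableOn hi2]
    refine integral_congr_ae (ae_of_all _ fun p => ?_)
    simp only [lineFourier_neg_arg, map_mul, Complex.conj_ofReal]
    push_cast
    ring
  rw [e2] at e1
  have h4 := congrArg Complex.im e1
  simp at h4
  linarith

/-! ### Vectors that are functions on the line -/

theorem VacuumRep.add {f g : ℝ → ℝ} {v w : VacuumSpace} (hv : VacuumRep f v) (hw : VacuumRep g w) :
    VacuumRep (fun x => f x + g x) (v + w) := by
  refine ⟨hv.1.add hw.1, ?_⟩
  filter_upwards [Lp.coeFn_add v w, hv.2, hw.2] with p h1 h2 h3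
  rw [h1, Pi.add_apply, h2, h3, lineFourier_add hv.1 hw.1]

theorem VacuumRep.sub {f g : ℝ → ℝ} {v w : VacuumSpace} (hv : VacuumRep f v) (hw : VacuumRep g w) :
    VacuumRep (fun x => f x - g x) (v - w) := by
  refine ⟨hv.1.sub hw.1, ?_⟩
  filter_upwards [Lp.coeFn_sub v w, hv.2, hw.2] with p h1 h2 h3
  rw [h1, Pi.sub_apply, h2, h3, lineFourier_sub hv.1 hw.1]

theorem VacuumRep.unique {f : ℝ → ℝ} {v w : VacuumSpace} (hv : VacuumRep f v)
    (hw : VacuumRep f w) : v = w := Lp.ext (hv.2.trans hw.2.symm)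

theorem ae_vacuumMeasure_iff {P : ℝ → Prop} :
    (∀ᵐ p ∂vacuumMeasure, P p) ↔ ∀ᵐ p, 0 < p → P p := by
  rw [vacuumMeasure, ae_withDensity_iff (by fun_prop), ae_restrict_iff' measurableSet_Ioi]
  refine ⟨fun h => ?_, fun h => ?_⟩
  · filter_upwards [h] with p hp h0
    refine hp h0 ?_
    simpa using div_pos h0 Real.pi_pos
  · filter_upwards [h] with p hp h0 _
    exact hp h0

theorem integral_vacuumMeasure (F : ℝ → ℂ) :
    ∫ p, F p ∂vacuumMeasure = ∫ p in Ioi (0 : ℝ), ((p / Real.pi : ℝ) : ℂ) * F p := by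
  rw [vacuumMeasure, integral_withDensity_eq_integral_toReal_smul (by fun_prop)
    (ae_of_all _ fun p => ENNReal.ofReal_lt_top)]
  refine setIntegral_congr_fun measurableSet_Ioi fun p hp => ?_
  have : 0 ≤ p / Real.pi := div_nonneg (le_of_lt hp) Real.pi_pos.le
  simp only [ENNReal.toReal_ofReal this, Complex.real_smul]

theorem VacuumRep.inner_eq {f g : ℝ → ℝ} {v w : VacuumSpace} (hv : VacuumRep f v)
    (hw : VacuumRep g w) :
    ⟪v, w⟫_ℂ = ((Real.pi⁻¹ : ℝ) : ℂ) *
      ∫ p in Ioi (0 : ℝ), (starRingEnd ℂ) (lineFourier f p) * lineFourier g p * p := by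
  rw [L2.inner_def, ← integral_const_mul]
  trans ∫ p, (starRingEnd ℂ) (lineFourier f p) * lineFourier g p ∂vacuumMeasure
  · refine integral_congr_ae ?_
    filter_upwards [hv.2, hw.2] with p h1 h2
    rw [h1, h2]
    simp [mul_comm]
  · rw [integral_vacuumMeasure]
    refine integral_congr_ae (ae_of_all _ fun p => ?_)
    push_cast
    ring

/-- The imaginary part of the inner product is the symplectic form. -/
theorem VacuumRep.im_inner_eq {f g : ℝ → ℝ} {v w : VacuumSpace} (hv : VacuumRep f v)
    (hf2 : MemLp f 2) (hw : VacuumRep g w) (hg : IsTestFunction g) :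
    (⟪v, w⟫_ℂ).im = ∫ x, f x * deriv g x := by
  rw [hv.inner_eq hw, Complex.im_ofReal_mul, im_integral_Ioi_conj_lineFourier_mul hv.1 hf2 hg]
  have := Real.pi_ne_zero
  field_simp

theorem VacuumRep.norm_sq_eq {f : ℝ → ℝ} {v : VacuumSpace} (hv : VacuumRep f v) :
    ‖v‖ ^ 2 = (∫⁻ p, ENNReal.ofReal (‖lineFourier f p‖ ^ 2) ∂vacuumMeasure).toReal :=
  norm_sq_eq_toReal_lintegral hv.2

theorem exists_vacuumRep_of_lintegral_lt_top {f : ℝ → ℝ} (hf : Integrable f)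
    (h : ∫⁻ p, ENNReal.ofReal (‖lineFourier f p‖ ^ 2) ∂vacuumMeasure < ⊤) :
    ∃ v, VacuumRep f v := by
  have hm := memLp_two_of_lintegral_lt_top (continuous_lineFourier hf).aestronglyMeasurable h
  exact ⟨hm.toLp _, hf, hm.coeFn_toLp⟩

/-- A function has a vacuum vector as soon as it and its derivative are in `L¹ ∩ L²`. -/
theorem exists_vacuumRep_of_weakDeriv {f g : ℝ → ℝ} (hf : Integrable f) (hf2 : MemLp f 2)
    (hg : Integrable g) (hg2 : MemLp g 2)
    (h : ∀ p, lineFourier g p = -Complex.I * p * lineFourier f p) : ∃ v, VacuumRep f v := by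
  refine exists_vacuumRep_of_lintegral_lt_top hf ?_
  have h1 := (memLp_lineFourier hf hf2).lintegral_norm_sq_lt_top
  have h2 := (memLp_lineFourier hg hg2).lintegral_norm_sq_lt_top
  have hc := (continuous_lineFourier hf).measurable
  have hc2 := (continuous_lineFourier hg).measurable
  rw [vacuumMeasure, lintegral_withDensity_eq_lintegral_mul _ (by fun_prop) (by fun_prop)]
  refine lt_of_le_of_lt (b := ∫⁻ p, (ENNReal.ofReal (‖lineFourier f p‖ ^ 2) +
    ENNReal.ofReal (‖lineFourier g p‖ ^ 2))) ?_ ?_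
  · refine (setLIntegral_mono' measurableSet_Ioi fun p hp => ?_).trans (setLIntegral_le_lintegral _ _)
    have hp' : 0 < p := hp
    simp only [Pi.mul_apply]
    rw [← ENNReal.ofReal_mul (by have := Real.pi_pos; positivity),
      ← ENNReal.ofReal_add (by positivity) (by positivity)]
    refine ENNReal.ofReal_le_ofReal ?_
    rw [h p]
    simp only [norm_mul, norm_neg, Complex.norm_I, one_mul, Complex.norm_real, Real.norm_eq_abs,
      mul_pow, sq_abs]
    have h3 : p / Real.pi ≤ 1 + p ^ 2 := by
      have : p / Real.pi ≤ p := div_le_self hp'.le (by linarith [Real.pi_gt_three])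
      nlinarith [sq_nonneg (p - 1)]
    nlinarith [sq_nonneg ‖lineFourier f p‖]
  · rw [lintegral_add_left (by fun_prop)]
    exact ENNReal.add_lt_top.mpr ⟨h1, h2⟩

theorem IsTestFunction.exists_vacuumRep {f : ℝ → ℝ} (hf : IsTestFunction f) :
    ∃ v, VacuumRep f v :=
  exists_vacuumRep_of_weakDeriv hf.integrable hf.memLp hf.deriv.integrable hf.deriv.memLp
    (lineFourier_deriv hf)

/-! ### Uniqueness for boundary values of holomorphic functions -/

/-- A function that is holomorphic in a square and continuous up to the boundary vanishes at the
centre if it vanishes on one side: the product of its four rotated copies vanishes on the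
boundary. -/
theorem eq_zero_center_of_eq_zero_side {G : ℂ → ℂ} {x₀ d : ℝ} (hd : 0 < d)
    (hG : DiffContOnCl ℂ G (Ioo (x₀ - d) (x₀ + d) ×ℂ Ioo (-(2 * d)) 0))
    (h0 : ∀ x : ℝ, |x - x₀| ≤ d → G x = 0) : G (x₀ - d * Complex.I) = 0 := by
  set c : ℂ := x₀ - d * Complex.I with hc
  have hcre : c.re = x₀ := by simp [hc]
  have hcim : c.im = -d := by simp [hc]
  set R := Ioo (x₀ - d) (x₀ + d) ×ℂ Ioo (-(2 * d)) 0 with hR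
  set U := Ioo (-d) d ×ℂ Ioo (-d) d with hU
  have hcomp : ∀ ζ : ℂ, ζ ∈ ({1, Complex.I, -1, -Complex.I} : Set ℂ) →
      DiffContOnCl ℂ (fun w => G (c + ζ * w)) U := by
    intro ζ hζ
    have haff : DiffContOnCl ℂ (fun w : ℂ => c + ζ * w) U :=
      Differentiable.diffContOnCl (by fun_prop)
    refine hG.comp haff fun w hw => ?_
    rw [hU, Complex.mem_reProdIm] at hw
    rw [hR, Complex.mem_reProdIm]
    obtain ⟨⟨h1, h2⟩, h3, h4⟩ := hw
    simp only [mem_insert_iff, mem_singleton_iff] at hζ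
    rcases hζ with rfl | rfl | rfl | rfl <;>
    · simp only [Complex.add_re, Complex.add_im, hcre, hcim, Complex.mul_re, Complex.mul_im,
        Complex.one_re, Complex.one_im, Complex.I_re, Complex.I_im, Complex.neg_re, Complex.neg_im,
        mem_Ioo]
      refine ⟨⟨?_, ?_⟩, ?_, ?_⟩ <;> linarith
  set Q : ℂ → ℂ := fun w => G (c + 1 * w) * G (c + Complex.I * w) * G (c + -1 * w) *
    G (c + -Complex.I * w) with hQ
  have hQd : DiffContOnCl ℂ Q U := by
    have h1 := hcomp 1 (by simp)
    have h2 := hcomp Complex.I (by simp)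
    have h3 := hcomp (-1) (by simp)
    have h4 := hcomp (-Complex.I) (by simp)
    exact ⟨((h1.1.mul h2.1).mul h3.1).mul h4.1, ((h1.2.mul h2.2).mul h3.2).mul h4.2⟩
  have hUb : Bornology.IsBounded U := (Metric.isBounded_Ioo _ _).reProdIm (Metric.isBounded_Ioo _ _)
  have hfr : ∀ w ∈ frontier U, ‖Q w‖ ≤ 0 := by
    intro w hw
    have hne : -d ≠ d := by linarith
    have hcl : w ∈ closure U := hw.1
    have hnot : w ∉ U := by
      have hUo : IsOpen U := isOpen_Ioo.reProdIm isOpen_Ioo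
      intro hwU
      exact hw.2 (by rwa [hUo.interior_eq])
    rw [hU, Complex.closure_reProdIm, closure_Ioo hne, Complex.mem_reProdIm] at hcl
    rw [hU, Complex.mem_reProdIm] at hnot
    obtain ⟨⟨h1, h2⟩, h3, h4⟩ := hcl
    have hreal : ∀ ζ : ℂ, (c + ζ * w).im = 0 → |(c + ζ * w).re - x₀| ≤ d → G (c + ζ * w) = 0 := by
      intro ζ him hre
      have : c + ζ * w = (((c + ζ * w).re : ℝ) : ℂ) := Complex.ext (by simp) (by simpa using him)
      rw [this]
      exact h0 _ hre
    have hcases : w.im = d ∨ w.re = d ∨ w.im = -d ∨ w.re = -d := by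
      by_contra! hcon
      obtain ⟨k1, k2, k3, k4⟩ := hcon
      exact hnot ⟨⟨lt_of_le_of_ne h1 k4.symm, lt_of_le_of_ne h2 k2⟩,
        lt_of_le_of_ne h3 k3.symm, lt_of_le_of_ne h4 k1⟩
    have hz : Q w = 0 := by
      simp only [hQ]
      rcases hcases with h | h | h | h
      · rw [hreal 1 (by simp [hcim, h]) (by rw [abs_le]; simp [hcre]; constructor <;> linarith)]
        simp
      · rw [hreal Complex.I (by simp [hcim, h])
          (by rw [abs_le]; simp [hcre]; constructor <;> linarith)]
        simp
      · rw [hreal (-1) (by simp [hcim, h])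
          (by rw [abs_le]; simp [hcre]; constructor <;> linarith)]
        simp
      · rw [hreal (-Complex.I) (by simp [hcim, h])
          (by rw [abs_le]; simp [hcre]; constructor <;> linarith)]
        simp
    simp [hz]
  have h0U : (0 : ℂ) ∈ closure U := subset_closure (by
    rw [hU, Complex.mem_reProdIm]
    simp [hd])
  have hfin := Complex.norm_le_of_forall_mem_frontier_norm_le hUb hQd hfr h0U
  have hQ0 : Q 0 = 0 := by simpa using hfin
  simpa [hQ] using hQ0

/-- Squares with one side on the real segment force `G` to vanish on an open set below it; the
identity theorem and continuity do the rest. No reflection across the boundary is used. -/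
theorem eqOn_zero_of_boundary_eq_zero {G : ℂ → ℂ} {D : Set ℂ} (hDo : IsOpen D) (hDc : Convex ℝ D)
    (hG : DiffContOnCl ℂ G D) {x₀ ε : ℝ} (hε : 0 < ε)
    (hD : ∀ z : ℂ, |z.re - x₀| < ε → -ε < z.im → z.im < 0 → z ∈ D)
    (h0 : ∀ x : ℝ, |x - x₀| < ε → G x = 0) : EqOn G 0 (closure D) := by
  have hpt : ∀ z : ℂ, |z.re - x₀| < ε / 2 → -(ε / 2) < z.im → z.im < 0 → G z = 0 := by
    intro z h1 h2 h3
    rw [abs_lt] at h1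
    have hd : 0 < -z.im := by linarith
    have hz : z = (z.re : ℂ) - ((-z.im : ℝ) : ℂ) * Complex.I := by
      apply Complex.ext <;> simp
    rw [hz]
    refine eq_zero_center_of_eq_zero_side hd (hG.mono fun w hw => ?_) fun x hx => ?_
    · rw [Complex.mem_reProdIm] at hw
      obtain ⟨⟨k1, k2⟩, k3, k4⟩ := hw
      exact hD w (by rw [abs_lt]; constructor <;> linarith) (by linarith) k4
    · rw [abs_le] at hx
      exact h0 x (by rw [abs_lt]; constructor <;> linarith)
  have hopen : IsOpen {z : ℂ | |z.re - x₀| < ε / 2 ∧ -(ε / 2) < z.im ∧ z.im < 0} := by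
    have h1 : IsOpen {z : ℂ | |z.re - x₀| < ε / 2} :=
      isOpen_lt (Complex.continuous_re.sub continuous_const).abs continuous_const
    have h2 : IsOpen {z : ℂ | -(ε / 2) < z.im} := isOpen_lt continuous_const Complex.continuous_im
    have h3 : IsOpen {z : ℂ | z.im < 0} := isOpen_lt Complex.continuous_im continuous_const
    exact h1.inter (h2.inter h3)
  set z₀ : ℂ := ⟨x₀, -(ε / 4)⟩ with hz0
  have hz0mem : z₀ ∈ {z : ℂ | |z.re - x₀| < ε / 2 ∧ -(ε / 2) < z.im ∧ z.im < 0} := by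
    refine ⟨?_, ?_, ?_⟩
    · simp [hz0]; linarith
    · simp only [hz0]; linarith
    · simp only [hz0]; linarith
  have hev : G =ᶠ[𝓝 z₀] 0 := by
    filter_upwards [hopen.mem_nhds hz0mem] with z hz
    exact hpt z hz.1 hz.2.1 hz.2.2
  have hz0D : z₀ ∈ D := hD z₀ (by simpa [hz0] using hε) (by simp only [hz0]; linarith)
    (by simp only [hz0]; linarith)
  have hEq : EqOn G 0 D := (hG.differentiableOn.analyticOnNhd hDo).eqOn_zero_of_preconnected_of_eventuallyEq_zero
    hDc.isPreconnected hz0D hev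
  exact hEq.of_subset_closure hG.continuousOn continuousOn_const subset_closure subset_rfl

/-! ### Totality of test functions -/

theorem ae_eq_zero_of_forall_lineFourier {ι : Type*} [Countable ι] {h : ℝ → ℂ} {φ : ι → ℝ → ℝ}
    (hφ : ∀ p, ∃ n, lineFourier (φ n) p ≠ 0)
    (hi : ∀ n, Integrable fun p => lineFourier (φ n) p * h p)
    (h0 : ∀ n, ∀ t : ℝ, ∫ p, Complex.exp (Complex.I * (p * t : ℝ)) *
      (lineFourier (φ n) p * h p) = 0) : h =ᵐ[volume] 0 := by
  have hall : ∀ᵐ p, ∀ n, lineFourier (φ n) p * h p = 0 := ae_all_iff.mpr fun n =>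
    ae_eq_zero_of_forall_integral_exp_mul_eq_zero (hi n) (h0 n)
  filter_upwards [hall] with p hp
  obtain ⟨n, hn⟩ := hφ p
  exact (mul_eq_zero.mp (hp n)).resolve_left hn

theorem lineFourier_comp_sub (g : ℝ → ℝ) (t p : ℝ) :
    lineFourier (fun x => g (x + -t)) p =
      Complex.exp (Complex.I * (p * t : ℝ)) * lineFourier g p := by
  rw [lineFourier_comp_add]
  congr 2
  push_cast
  ring

/-- The Fourier transforms of test functions are total. -/
theorem ae_eq_zero_of_forall_testFunction {h : ℝ → ℂ}
    (hi : ∀ φ, IsTestFunction φ → Integrable fun p => lineFourier φ p * h p)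
    (h0 : ∀ φ, IsTestFunction φ → ∫ p, lineFourier φ p * h p = 0) : h =ᵐ[volume] 0 := by
  obtain ⟨φ, hφ, hne⟩ := exists_testFunction_lineFourier_ne_zero 0 one_pos
  refine ae_eq_zero_of_forall_lineFourier hne (fun n => hi _ (hφ n).1) fun n t => ?_
  rw [← h0 _ ((hφ n).1.comp_add (-t))]
  refine integral_congr_ae (ae_of_all _ fun p => ?_)
  simp only []
  rw [lineFourier_comp_sub]
  ring

/-- Positivity of the momentum makes `|e^{-ipz}| ≤ 1` in the lower half-plane. Away from the
boundary the extra factor `p` of the derivative is absorbed by the exponential decay. -/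
theorem differentiableOn_integral_exp {k : ℝ → ℂ} (hk : Integrable k)
    (hk0 : ∀ p ≤ 0, k p = 0) :
    DiffContOnCl ℂ (fun z : ℂ => ∫ p : ℝ, Complex.exp (-(Complex.I * (p * z))) * k p)
      {z : ℂ | z.im < 0} := by
  have hnorm : ∀ (p : ℝ) (z : ℂ), ‖Complex.exp (-(Complex.I * (p * z)))‖ = Real.exp (p * z.im) := by
    intro p z
    rw [Complex.norm_exp]
    congr 1
    simp
  have hbd : ∀ z : ℂ, z.im ≤ 0 → ∀ p : ℝ, ‖Complex.exp (-(Complex.I * (p * z))) * k p‖ ≤ ‖k p‖ := by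
    intro z hz p
    rcases le_or_gt p 0 with hp | hp
    · simp [hk0 p hp]
    · rw [norm_mul, hnorm]
      refine mul_le_of_le_one_left (norm_nonneg _) ?_
      rw [Real.exp_le_one_iff]
      exact mul_nonpos_of_nonneg_of_nonpos hp.le hz
  have hmeas : ∀ z : ℂ, AEStronglyMeasurable
      (fun p : ℝ => Complex.exp (-(Complex.I * (p * z))) * k p) volume := fun z =>
    (Continuous.aestronglyMeasurable (by fun_prop)).mul hk.1
  have hcl : closure {z : ℂ | z.im < 0} = {z : ℂ | z.im ≤ 0} := Complex.closure_setOfPred_im_lt 0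
  constructor
  · intro z hz
    have hz' : z.im < 0 := hz
    set y : ℝ := -z.im / 2 with hy
    have hy0 : 0 < y := by rw [hy]; linarith
    refine DifferentiableAt.differentiableWithinAt ?_
    have hball : ∀ w ∈ Metric.ball z y, w.im ≤ -y := by
      intro w hw
      have h1 : |w.im - z.im| ≤ ‖w - z‖ := by
        simpa using Complex.abs_im_le_norm (w - z)
      rw [Metric.mem_ball, dist_eq_norm] at hw
      have := (abs_le.mp h1).2
      rw [hy] at *
      linarith
    have hF := hasDerivAt_integral_of_dominated_loc_of_deriv_le (𝕜 := ℂ) (μ := volume)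
      (F := fun (w : ℂ) (p : ℝ) => Complex.exp (-(Complex.I * (p * w))) * k p)
      (F' := fun (w : ℂ) (p : ℝ) =>
        Complex.exp (-(Complex.I * (p * w))) * (-(Complex.I * p)) * k p)
      (x₀ := z) (s := Metric.ball z y) (bound := fun p => y⁻¹ * ‖k p‖)
      (Metric.ball_mem_nhds z hy0) (Eventually.of_forall hmeas)
      (hk.mono (hmeas z) (ae_of_all _ (hbd z hz'.le)))
      ((Continuous.aestronglyMeasurable (by fun_prop)).mul hk.1)
      (ae_of_all _ fun p w hw => ?_) (hk.norm.const_mul _)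
      (ae_of_all _ fun p w hw => ?_)
    · exact hF.2.differentiableAt
    · rcases le_or_gt p 0 with hp | hp
      · simp [hk0 p hp]
      · rw [norm_mul, norm_mul, hnorm]
        refine mul_le_mul_of_nonneg_right ?_ (norm_nonneg _)
        simp only [norm_neg, norm_mul, Complex.norm_I, one_mul, Complex.norm_real,
          Real.norm_of_nonneg hp.le]
        have h1 : Real.exp (p * w.im) ≤ Real.exp (-(p * y)) := by
          refine Real.exp_le_exp.mpr ?_
          have := mul_le_mul_of_nonneg_left (hball w hw) hp.le
          linarith
        have h2 : Real.exp (-(p * y)) * (p * y) ≤ 1 := by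
          rw [Real.exp_neg, inv_mul_le_one₀ (Real.exp_pos _)]
          linarith [Real.add_one_le_exp (p * y)]
        calc Real.exp (p * w.im) * p ≤ Real.exp (-(p * y)) * p :=
              mul_le_mul_of_nonneg_right h1 hp.le
          _ = y⁻¹ * (Real.exp (-(p * y)) * (p * y)) := by field_simp
          _ ≤ y⁻¹ * 1 := by gcongr
          _ = y⁻¹ := mul_one _
    · have h1 : HasDerivAt (fun w : ℂ => -(Complex.I * (p * w))) (-(Complex.I * p)) w := by
        have h2 := (((hasDerivAt_id w).const_mul (p : ℂ)).const_mul Complex.I).neg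
        rw [mul_one] at h2
        exact h2
      exact (h1.cexp).mul_const (k p)
  · rw [hcl]
    intro z hz
    refine continuousWithinAt_of_dominated (bound := fun p => ‖k p‖)
      (Eventually.of_forall hmeas) ?_ hk.norm
      (ae_of_all _ fun p => Continuous.continuousWithinAt (by fun_prop))
    filter_upwards [self_mem_nhdsWithin] with w hw
    exact ae_of_all _ (hbd w hw)

/-- The Fourier transforms of test functions on an interval are total on the half-line. -/
theorem ae_eq_zero_of_forall_testFunction_Ioo {h : ℝ → ℂ} (hneg : ∀ p ≤ 0, h p = 0) {a b : ℝ}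
    (hab : a < b)
    (hi : ∀ φ, IsTestFunction φ → tsupport φ ⊆ Ioo a b →
      Integrable fun p => lineFourier φ p * h p)
    (h0 : ∀ φ, IsTestFunction φ → tsupport φ ⊆ Ioo a b → ∫ p, lineFourier φ p * h p = 0) :
    h =ᵐ[volume] 0 := by
  set m := (a + b) / 2 with hm
  -- Bumps of radius `δ` about the midpoint, translated by less than `δ`, stay within `(b - a) / 4`
  -- of it, hence inside the interval.
  set δ := (b - a) / 8 with hδ
  have hδ0 : 0 < δ := by rw [hδ]; linarith
  obtain ⟨φ, hφ, hne⟩ := exists_testFunction_lineFourier_ne_zero m hδ0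
  have hsub : ∀ n, tsupport (φ n) ⊆ Ioo a b := fun n x hx => by
    have := (hφ n).2 hx
    rw [Metric.mem_closedBall, Real.dist_eq, abs_le] at this
    rw [hm, hδ] at this
    constructor <;> linarith [this.1, this.2]
  have hsubt : ∀ n, ∀ t : ℝ, |t| < δ → tsupport (fun x => φ n (x + -t)) ⊆ Ioo a b := by
    intro n t ht x hx
    have h1 : tsupport (fun x => φ n (x + -t)) = (fun x => x + -t) ⁻¹' tsupport (φ n) :=
      tsupport_comp_eq_preimage (φ n) (Homeomorph.addRight (-t))
    rw [h1] at hx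
    have := (hφ n).2 hx
    rw [Metric.mem_closedBall, Real.dist_eq, abs_le] at this
    rw [abs_lt] at ht
    rw [hm, hδ] at this
    rw [hδ] at ht
    constructor <;> linarith [this.1, this.2, ht.1, ht.2]
  refine ae_eq_zero_of_forall_lineFourier hne (fun n => hi _ (hφ n).1 (hsub n)) fun n => ?_
  set k : ℝ → ℂ := fun p => lineFourier (φ n) p * h p with hk
  have hki : Integrable k := hi _ (hφ n).1 (hsub n)
  have hD := differentiableOn_integral_exp hki (fun p hp => by simp [hk, hneg p hp])
  -- The Reeh–Schlieder argument: the pairing with the translated bump vanishes for small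
  -- translations and, by positivity of momentum, is a boundary value from the lower half-plane; so
  -- it vanishes for all translations, including those that leave the interval.
  have hzero := eqOn_zero_of_boundary_eq_zero (isOpen_lt Complex.continuous_im continuous_const)
    (convex_halfSpace_im_lt 0) hD (x₀ := 0) hδ0 (fun z _ _ hz => hz) (fun t ht => ?_)
  · intro t
    have := hzero (x := ((-t : ℝ) : ℂ)) (by
      rw [Complex.closure_setOfPred_im_lt]; simp)
    rw [← Pi.zero_apply (M := fun _ : ℂ => ℂ) (((-t : ℝ) : ℂ)), ← this]
    refine integral_congr_ae (ae_of_all _ fun p => ?_)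
    simp only []
    congr 2
    push_cast
    ring
  · have ht' : |-t| < δ := by simpa using ht
    rw [← h0 _ ((hφ n).1.comp_add (- -t)) (hsubt n (-t) ht')]
    refine integral_congr_ae (ae_of_all _ fun p => ?_)
    simp only [hk]
    rw [lineFourier_comp_sub, mul_assoc]
    congr 2
    push_cast
    ring

/-! ### The spectral model -/

/-- The density of the spectral measure of the modular Hamiltonian. -/
def modelDensity (p : ℝ) : ℝ := p / (Real.pi * (1 - Real.exp (-(2 * Real.pi * p))))

theorem modelDensity_pos {p : ℝ} (hp : p ≠ 0) : 0 < modelDensity p := by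
  have hpi := Real.pi_pos
  rw [modelDensity]
  rcases lt_or_gt_of_ne hp with h | h
  · refine div_pos_of_neg_of_neg h (mul_neg_of_pos_of_neg hpi ?_)
    have : 1 < Real.exp (-(2 * Real.pi * p)) := Real.one_lt_exp_iff.mpr (by nlinarith)
    linarith
  · refine div_pos h (mul_pos hpi ?_)
    have : Real.exp (-(2 * Real.pi * p)) < 1 := Real.exp_lt_one_iff.mpr (by have := mul_pos hpi h; linarith)
    linarith

theorem modelDensity_nonneg (p : ℝ) : 0 ≤ modelDensity p := by
  rcases eq_or_ne p 0 with rfl | hp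
  · simp [modelDensity]
  · exact (modelDensity_pos hp).le

theorem one_sub_exp_ne_zero {p : ℝ} (hp : p ≠ 0) : 1 - Real.exp (-(2 * Real.pi * p)) ≠ 0 := by
  intro h
  have h1 : Real.exp (-(2 * Real.pi * p)) = 1 := by linarith
  rw [Real.exp_eq_one_iff] at h1
  have := Real.pi_pos
  have h2 : Real.pi * p = 0 := by linarith
  rcases mul_eq_zero.mp h2 with h | h
  · exact this.ne' h
  · exact hp h

/-- The KMS condition in momentum space. It is why the modular operator is multiplication by
`e^{-2πp}`. -/
theorem modelDensity_neg (p : ℝ) :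
    modelDensity (-p) = Real.exp (-(2 * Real.pi * p)) * modelDensity p := by
  rcases eq_or_ne p 0 with rfl | hp
  · simp [modelDensity]
  have h1 := one_sub_exp_ne_zero hp
  have h2 := one_sub_exp_ne_zero (neg_ne_zero.mpr hp)
  have hpi := Real.pi_ne_zero
  rw [modelDensity, modelDensity]
  have hE := (Real.exp_pos (2 * Real.pi * p)).ne'
  rw [show -(2 * Real.pi * -p) = 2 * Real.pi * p by ring] at *
  rw [Real.exp_neg] at *
  have h3 : Real.exp (2 * Real.pi * p) - 1 ≠ 0 := by
    intro h; apply h2; linarith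
  have h4 : 1 - (Real.exp (2 * Real.pi * p))⁻¹ =
    (Real.exp (2 * Real.pi * p) - 1) / Real.exp (2 * Real.pi * p) := by field_simp
  have h5 : 1 - Real.exp (2 * Real.pi * p) = -(Real.exp (2 * Real.pi * p) - 1) := by ring
  rw [h4, h5]
  field_simp

/-- The odd part of the density carries the symplectic form and does not see the temperature. -/
theorem modelDensity_sub (p : ℝ) : modelDensity p - modelDensity (-p) = p / Real.pi := by
  rcases eq_or_ne p 0 with rfl | hp
  · simp [modelDensity]
  have h1 := one_sub_exp_ne_zero hp
  have hpi := Real.pi_ne_zero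
  rw [modelDensity_neg, modelDensity]
  set E := Real.exp (-(2 * Real.pi * p))
  field_simp

/-- The even part of the density is the thermal weight at `β = 2π`; it governs the norms of real
functions, whose transforms have even modulus. -/
theorem modelDensity_add {p : ℝ} (hp : p ≠ 0) :
    modelDensity p + modelDensity (-p) =
      p * (Real.cosh (2 * Real.pi * p / 2) / Real.sinh (2 * Real.pi * p / 2)) / Real.pi := by
  have h1 := one_sub_exp_ne_zero hp
  have hpi := Real.pi_ne_zero
  rw [modelDensity_neg, modelDensity, Real.cosh_eq, Real.sinh_eq]
  set u := Real.exp (2 * Real.pi * p / 2) with hu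
  have hu0 : u ≠ 0 := (Real.exp_pos _).ne'
  have h2 : Real.exp (-(2 * Real.pi * p / 2)) = 1 / u := by rw [hu, Real.exp_neg, one_div]
  have h3 : Real.exp (-(2 * Real.pi * p)) = 1 / u ^ 2 := by
    rw [hu, ← Real.exp_nat_mul, one_div, ← Real.exp_neg]; congr 1; push_cast; ring
  rw [h3] at h1
  rw [h2, h3]
  have h4 : u ^ 2 - 1 ≠ 0 := by
    intro h; apply h1
    have : u ^ 2 = 1 := by linarith
    rw [this]; simp
  have e1 : 1 - 1 / u ^ 2 = (u ^ 2 - 1) / u ^ 2 := by field_simp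
  have e2 : (u - 1 / u) / 2 = (u ^ 2 - 1) / (2 * u) := by field_simp
  rw [e1, e2]
  field_simp

@[fun_prop]
theorem measurable_modelDensity : Measurable modelDensity := by
  unfold modelDensity
  fun_prop

/-- The spectral measure of the modular Hamiltonian. -/
def modelMeasure : Measure ℝ := volume.withDensity fun p => ENNReal.ofReal (modelDensity p)

/-- The spectral representation of the modular group. -/
abbrev ModelSpace : Type := Lp ℂ 2 modelMeasure

theorem ae_ne_zero : ∀ᵐ p : ℝ, p ≠ 0 := by
  simp [ae_iff]

/-- The density vanishes only at `0`, so the null sets are those of Lebesgue measure, which are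
invariant under `p ↦ -p`. -/
theorem ae_modelMeasure_iff {P : ℝ → Prop} : (∀ᵐ p ∂modelMeasure, P p) ↔ ∀ᵐ p, P p := by
  rw [modelMeasure, ae_withDensity_iff (by fun_prop)]
  refine ⟨fun h => ?_, fun h => ?_⟩
  · filter_upwards [h, ae_ne_zero] with p hp h0
    exact hp (by simpa using modelDensity_pos h0)
  · filter_upwards [h] with p hp _
    exact hp

theorem ae_modelMeasure : ae modelMeasure = ae (volume : Measure ℝ) := by
  ext s
  exact ae_modelMeasure_iff (P := fun p => p ∈ s)

theorem aestronglyMeasurable_modelMeasure_iff {F : ℝ → ℂ} :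
    AEStronglyMeasurable F modelMeasure ↔ AEStronglyMeasurable F volume := by
  refine ⟨fun h => h.mono_ac ?_, fun h => h.mono_ac ?_⟩
  · exact Measure.ae_le_iff_absolutelyContinuous.mp ae_modelMeasure.ge
  · exact Measure.ae_le_iff_absolutelyContinuous.mp ae_modelMeasure.le

theorem ae_neg_iff {P : ℝ → Prop} : (∀ᵐ p : ℝ, P (-p)) ↔ ∀ᵐ p : ℝ, P p := by
  have h := (Measure.measurePreserving_neg (volume : Measure ℝ)).quasiMeasurePreserving
  refine ⟨fun hp => ?_, fun hp => h.ae hp⟩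
  have := h.ae hp
  simpa using this

theorem lintegral_modelMeasure {F : ℝ → ℝ≥0∞} (hF : AEMeasurable F volume) :
    ∫⁻ p, F p ∂modelMeasure = ∫⁻ p, ENNReal.ofReal (modelDensity p) * F p := by
  rw [modelMeasure, lintegral_withDensity_eq_lintegral_mul₀ (by fun_prop) hF]
  rfl

theorem integral_modelMeasure (F : ℝ → ℂ) :
    ∫ p, F p ∂modelMeasure = ∫ p, (modelDensity p : ℂ) * F p := by
  rw [modelMeasure, integral_withDensity_eq_integral_toReal_smul (by fun_prop)
    (ae_of_all _ fun p => ENNReal.ofReal_lt_top)]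
  refine integral_congr_ae (ae_of_all _ fun p => ?_)
  simp only [ENNReal.toReal_ofReal (modelDensity_nonneg p), Complex.real_smul]

theorem integrable_modelMeasure_iff {F : ℝ → ℂ} :
    Integrable F modelMeasure ↔ Integrable fun p => (modelDensity p : ℂ) * F p := by
  rw [modelMeasure, integrable_withDensity_iff_integrable_smul' (by fun_prop)
    (ae_of_all _ fun p => ENNReal.ofReal_lt_top)]
  refine integrable_congr (ae_of_all _ fun p => ?_)
  simp only [ENNReal.toReal_ofReal (modelDensity_nonneg p), Complex.real_smul]

namespace ModelSpace

theorem ext_ae {x y : ModelSpace} (h : ∀ᵐ p, x p = y p) : x = y :=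
  Lp.ext (ae_modelMeasure_iff.mpr h)

theorem aestronglyMeasurable (x : ModelSpace) : AEStronglyMeasurable x volume :=
  aestronglyMeasurable_modelMeasure_iff.mp (Lp.aestronglyMeasurable x)

theorem ae_add (x y : ModelSpace) : ∀ᵐ p, (x + y) p = x p + y p :=
  ae_modelMeasure_iff.mp (Lp.coeFn_add x y)

theorem ae_sub (x y : ModelSpace) : ∀ᵐ p, (x - y) p = x p - y p :=
  ae_modelMeasure_iff.mp (Lp.coeFn_sub x y)

theorem ae_smul (c : ℂ) (x : ModelSpace) : ∀ᵐ p, (c • x) p = c * x p :=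
  ae_modelMeasure_iff.mp (Lp.coeFn_smul c x)

theorem ae_zero : ∀ᵐ p, (0 : ModelSpace) p = 0 :=
  ae_modelMeasure_iff.mp (Lp.coeFn_zero ℂ 2 modelMeasure)

theorem exists_of_memLp {F : ℝ → ℂ} (h : MemLp F 2 modelMeasure) :
    ∃ x : ModelSpace, ∀ᵐ p, x p = F p := ⟨h.toLp F, ae_modelMeasure_iff.mp h.coeFn_toLp⟩

theorem memLp_of_ae {F : ℝ → ℂ} {x : ModelSpace} (h : ∀ᵐ p, x p = F p) :
    MemLp F 2 modelMeasure := (memLp_congr_ae (ae_modelMeasure_iff.mpr h)).mp (Lp.memLp x)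

theorem inner_eq (x y : ModelSpace) :
    ⟪x, y⟫_ℂ = ∫ p, (modelDensity p : ℂ) * ((starRingEnd ℂ) (x p) * y p) := by
  rw [L2.inner_def, ← integral_modelMeasure]
  refine integral_congr_ae (ae_of_all _ fun p => ?_)
  simp [mul_comm]

theorem integrable_inner (x y : ModelSpace) :
    Integrable fun p => (modelDensity p : ℂ) * ((starRingEnd ℂ) (x p) * y p) :=
  integrable_modelMeasure_iff.mp ((Lp.memLp x).star.integrable_mul (Lp.memLp y))

/-- The vectors `x` with `x (-p) = conj (x p)`. -/
def IsHermitian (x : ModelSpace) : Prop := ∀ᵐ p, x (-p) = (starRingEnd ℂ) (x p)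

/-- `y p = conj (x (-p))`. -/
def IsReflection (x y : ModelSpace) : Prop := ∀ᵐ p, y p = (starRingEnd ℂ) (x (-p))

/-- A convergent sequence in `L²` has an almost everywhere convergent subsequence, and the reflected
subsequence converges almost everywhere as well. The reflection itself is not bounded on the model
space. -/
theorem isClosed_setOf_isHermitian : IsClosed {x : ModelSpace | IsHermitian x} := by
  refine IsSeqClosed.isClosed fun u x hu hx => ?_
  have h1 := tendstoInMeasure_of_tendsto_Lp hx
  obtain ⟨ns, -, hns⟩ := h1.exists_seq_tendsto_ae
  rw [ae_modelMeasure_iff] at hns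
  have hneg := ae_neg_iff.mpr hns
  have hall : ∀ᵐ p, ∀ n, u n (-p) = (starRingEnd ℂ) (u n p) := ae_all_iff.mpr hu
  filter_upwards [hns, hneg, hall] with p h2 h3 h4
  refine tendsto_nhds_unique h3 ?_
  simp only [h4]
  exact (Complex.continuous_conj.tendsto _).comp h2

/-- Multiplication by a function bounded by one. -/
theorem exists_mul_of_norm_le {m : ℝ → ℂ} (hm : AEStronglyMeasurable m volume)
    (h1 : ∀ p, ‖m p‖ ≤ 1) (x : ModelSpace) : ∃ y : ModelSpace, ∀ᵐ p, y p = m p * x p := by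
  refine exists_of_memLp ((Lp.memLp x).of_le
    (aestronglyMeasurable_modelMeasure_iff.mpr (hm.mul x.aestronglyMeasurable))
    (ae_of_all _ fun p => ?_))
  rw [norm_mul]
  exact mul_le_of_le_one_left (norm_nonneg _) (h1 p)

/-- Nondegeneracy of the symplectic form on the hermitian vectors, which is factoriality of the
model. -/
theorem eq_zero_of_forall_isHermitian_im_inner {x : ModelSpace} (hx : IsHermitian x)
    (h : ∀ y, IsHermitian y → (⟪y, x⟫_ℂ).im = 0) : x = 0 := by
  -- The vector `i sgn(p) x` is again hermitian, and its symplectic product with `x` is `-∫ (p/π)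
  -- |x|²` over the positive half-line.
  obtain ⟨y, hy⟩ := exists_mul_of_norm_le (m := fun p => Complex.I * (SignType.sign p : ℝ))
    (Measurable.aestronglyMeasurable (by
      have : Measurable fun p : ℝ => ((SignType.sign p : ℝ) : ℂ) := by
        refine Complex.measurable_ofReal.comp ?_
        have h2 : (fun p : ℝ => ((SignType.sign p : SignType) : ℝ)) =
            fun p => if 0 < p then 1 else if p < 0 then -1 else 0 := by
          ext p
          rw [sign_apply]
          split_ifs <;> simp
        rw [h2]
        exact Measurable.ite measurableSet_Ioi measurable_const
          (Measurable.ite measurableSet_Iio measurable_const measurable_const)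
      fun_prop)) (fun p => by
      rw [norm_mul, Complex.norm_I, one_mul, Complex.norm_real]
      rcases lt_trichotomy p 0 with hp | rfl | hp
      · simp [sign_neg hp]
      · simp
      · simp [sign_pos hp]) x
  have hyH : IsHermitian y := by
    filter_upwards [hy, ae_neg_iff.mpr hy, hx] with p h1 h2 h3
    rw [h1, h2, h3, Left.sign_neg]
    simp
  have h0 := h y hyH
  have hi := integrable_inner y x
  rw [inner_eq, integral_Ioi_add_comp_neg hi] at h0
  have h3 : ∀ᵐ p, 0 < p → (modelDensity p : ℂ) * ((starRingEnd ℂ) (y p) * x p) +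
      (modelDensity (-p) : ℂ) * ((starRingEnd ℂ) (y (-p)) * x (-p)) =
      -Complex.I * ((p / Real.pi * ‖x p‖ ^ 2 : ℝ) : ℂ) := by
    filter_upwards [hy, ae_neg_iff.mpr hy, hx] with p h1 h2 h4 hp
    rw [h1, h2, h4, Left.sign_neg, sign_pos hp, ← modelDensity_sub]
    have := Complex.conj_mul' (x p)
    push_cast
    simp only [map_mul, Complex.conj_I, map_one, map_neg, mul_one, SignType.coe_one,
      Complex.ofReal_one, Complex.conj_conj]
    rw [← this]
    ring
  have h5 := hi.integrableOn (s := Ioi 0) |>.add (hi.comp_neg.integrableOn (s := Ioi 0))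
  have h3' : (fun p => (modelDensity p : ℂ) * ((starRingEnd ℂ) (y p) * x p) +
      (modelDensity (-p) : ℂ) * ((starRingEnd ℂ) (y (-p)) * x (-p))) =ᵐ[volume.restrict (Ioi 0)]
      fun p => -Complex.I * ((p / Real.pi * ‖x p‖ ^ 2 : ℝ) : ℂ) :=
    (ae_restrict_iff' measurableSet_Ioi).mpr h3
  rw [integral_congr_ae h3'] at h0
  have h6 : IntegrableOn (fun p => p / Real.pi * ‖x p‖ ^ 2) (Ioi 0) := by
    have h7 := (h5.congr h3').const_mul Complex.I
    have h8 := h7.re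
    refine h8.congr (ae_of_all _ fun p => ?_)
    simp only [RCLike.re_to_complex]
    rw [← mul_assoc, mul_neg, Complex.I_mul_I, neg_neg, one_mul, Complex.ofReal_re]
  rw [integral_const_mul, integral_complex_ofReal] at h0
  simp only [neg_mul, Complex.neg_im, Complex.mul_im, Complex.I_re, Complex.I_im, Complex.ofReal_re,
    Complex.ofReal_im, zero_mul, one_mul, zero_add, neg_eq_zero] at h0
  rw [setIntegral_eq_zero_iff_of_nonneg_ae] at h0
  · have h9 : ∀ᵐ p, 0 < p → x p = 0 := by
      have := (ae_restrict_iff' measurableSet_Ioi).mp h0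
      filter_upwards [this] with p hp hp0
      have h10 := hp hp0
      simp only [Pi.zero_apply] at h10
      have hpi : p / Real.pi ≠ 0 := (div_pos hp0 Real.pi_pos).ne'
      simpa [hpi] using h10
    refine ext_ae ?_
    filter_upwards [h9, ae_neg_iff.mpr h9, hx, ae_ne_zero, ae_zero] with p h1 h2 h4 hp hz
    rw [hz]
    rcases lt_or_gt_of_ne hp with h | h
    · have := h2 (by linarith)
      rw [h4] at this
      simpa using this
    · exact h1 h
  · refine (ae_restrict_iff' measurableSet_Ioi).mpr (ae_of_all _ fun p hp => ?_)
    have hp' : 0 < p := hp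
    have := Real.pi_pos
    simp only [Pi.zero_apply]
    positivity
  · exact h6

/-! #### Reflection -/

/-- The domain of `Δ` lies in that of `S`: the reflected vector has the weight `ρ(-p) = E ρ(p)` with
`E = e^{-2πp}`, and `E ≤ 1 + E²` bounds its squared norm by `‖x‖² + ‖y‖²`. -/
theorem exists_isReflection {x y : ModelSpace}
    (hy : ∀ᵐ p : ℝ, y p = ((Real.exp (-(2 * Real.pi * p)) : ℝ) : ℂ) * x p) :
    ∃ s : ModelSpace, IsReflection x s := by
  have hms : AEStronglyMeasurable (fun p => x (-p)) volume :=
    x.aestronglyMeasurable.comp_quasiMeasurePreserving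
      (Measure.measurePreserving_neg (volume : Measure ℝ)).quasiMeasurePreserving
  have hms2 : AEStronglyMeasurable (fun p => (starRingEnd ℂ) (x (-p))) volume :=
    Complex.continuous_conj.comp_aestronglyMeasurable hms
  refine exists_of_memLp (memLp_two_of_lintegral_lt_top
    (aestronglyMeasurable_modelMeasure_iff.mpr hms2) ?_)
  have hx := (Lp.memLp x).lintegral_norm_sq_lt_top
  have hy2 := (Lp.memLp y).lintegral_norm_sq_lt_top
  have mx : AEMeasurable (fun p => ENNReal.ofReal (‖x p‖ ^ 2)) volume :=
    (x.aestronglyMeasurable.norm.aemeasurable.pow_const 2).ennreal_ofReal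
  have my : AEMeasurable (fun p => ENNReal.ofReal (‖y p‖ ^ 2)) volume :=
    (y.aestronglyMeasurable.norm.aemeasurable.pow_const 2).ennreal_ofReal
  rw [lintegral_modelMeasure mx] at hx
  rw [lintegral_modelMeasure my] at hy2
  rw [lintegral_modelMeasure (by
    simp only [RCLike.norm_conj]
    exact (hms.norm.aemeasurable.pow_const 2).ennreal_ofReal)]
  have e : ∫⁻ p, ENNReal.ofReal (modelDensity p) * ENNReal.ofReal (‖(starRingEnd ℂ) (x (-p))‖ ^ 2) =
      ∫⁻ p, ENNReal.ofReal (modelDensity (-p)) * ENNReal.ofReal (‖x p‖ ^ 2) := by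
    rw [← lintegral_neg_eq_self]
    simp only [neg_neg, RCLike.norm_conj]
  rw [e]
  refine lt_of_le_of_lt ?_ (ENNReal.add_lt_top.mpr ⟨hx, hy2⟩)
  rw [← lintegral_add_left' (by fun_prop)]
  refine lintegral_mono_ae ?_
  filter_upwards [hy] with p hp
  rw [hp, modelDensity_neg]
  have hE := Real.exp_pos (-(2 * Real.pi * p))
  have h0 := modelDensity_nonneg p
  rw [← ENNReal.ofReal_mul (by positivity), ← ENNReal.ofReal_mul h0, ← ENNReal.ofReal_mul h0,
    ← ENNReal.ofReal_add (by positivity) (by positivity)]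
  refine ENNReal.ofReal_le_ofReal ?_
  rw [norm_mul, Complex.norm_real, Real.norm_of_nonneg hE.le]
  have h2 : 0 ≤ modelDensity p * ‖x p‖ ^ 2 := by positivity
  nlinarith [sq_nonneg (Real.exp (-(2 * Real.pi * p)) - 1)]

/-! ### The modular group of the spectral model -/

/-- The multiplier `e^{-2πizp}` of the modular group at the complex parameter `z`. -/
def phase (z : ℂ) (p : ℝ) : ℂ := Complex.exp (-(2 * Real.pi * Complex.I * z * p))

theorem norm_phase (z : ℂ) (p : ℝ) : ‖phase z p‖ = Real.exp (2 * Real.pi * z.im * p) := by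
  rw [phase, Complex.norm_exp]
  congr 1
  simp

theorem norm_phase_ofReal (u p : ℝ) : ‖phase u p‖ = 1 := by
  rw [norm_phase]
  simp

theorem phase_add (z w : ℂ) (p : ℝ) : phase (z + w) p = phase z p * phase w p := by
  rw [phase, phase, phase, ← Complex.exp_add]
  congr 1
  ring

theorem phase_zero (p : ℝ) : phase 0 p = 1 := by simp [phase]

theorem phase_neg_I (p : ℝ) : phase (-Complex.I) p = ((Real.exp (-(2 * Real.pi * p)) : ℝ) : ℂ) := by
  rw [phase]
  push_cast
  congr 1
  linear_combination (2 * Real.pi * p : ℂ) * Complex.I_sq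

@[fun_prop]
theorem continuous_phase (z : ℂ) : Continuous (phase z) := by
  unfold phase
  fun_prop

theorem memLp_phase_mul (u : ℝ) (x : ModelSpace) :
    MemLp (fun p => phase u p * x p) 2 modelMeasure := by
  refine (Lp.memLp x).of_le ((continuous_phase u).aestronglyMeasurable.mul
    (Lp.aestronglyMeasurable x)) (ae_of_all _ fun p => ?_)
  rw [norm_mul, norm_phase_ofReal, one_mul]

/-- Multiplication by `e^{-2πiup}`. -/
def mulPhase (u : ℝ) (x : ModelSpace) : ModelSpace := (memLp_phase_mul u x).toLp _

theorem ae_mulPhase (u : ℝ) (x : ModelSpace) : ∀ᵐ p, mulPhase u x p = phase u p * x p :=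
  ae_modelMeasure_iff.mp (memLp_phase_mul u x).coeFn_toLp

theorem mulPhase_add (u u' : ℝ) (x : ModelSpace) :
    mulPhase (u + u') x = mulPhase u (mulPhase u' x) := by
  refine ext_ae ?_
  filter_upwards [ae_mulPhase (u + u') x, ae_mulPhase u (mulPhase u' x), ae_mulPhase u' x]
    with p h1 h2 h3
  rw [h1, h2, h3, Complex.ofReal_add, phase_add, mul_assoc]

theorem mulPhase_zero (x : ModelSpace) : mulPhase 0 x = x := by
  refine ext_ae ?_
  filter_upwards [ae_mulPhase 0 x] with p h1
  rw [h1, Complex.ofReal_zero, phase_zero, one_mul]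

/-- The modular group of the spectral model. -/
def modularUnitary (u : ℝ) : ModelSpace ≃ₗᵢ[ℂ] ModelSpace where
  toFun := mulPhase u
  invFun := mulPhase (-u)
  left_inv x := by rw [← mulPhase_add, neg_add_cancel, mulPhase_zero]
  right_inv x := by rw [← mulPhase_add, add_neg_cancel, mulPhase_zero]
  map_add' x y := by
    refine ext_ae ?_
    filter_upwards [ae_mulPhase u (x + y), ae_add x y, ae_mulPhase u x, ae_mulPhase u y,
      ae_add (mulPhase u x) (mulPhase u y)] with p h1 h2 h3 h4 h5
    rw [h1, h2, h5, h3, h4, mul_add]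
  map_smul' c x := by
    refine ext_ae ?_
    filter_upwards [ae_mulPhase u (c • x), ae_smul c x, ae_mulPhase u x, ae_smul c (mulPhase u x)]
      with p h1 h2 h3 h4
    rw [h1, h2, RingHom.id_apply, h4, h3]
    ring
  norm_map' x := by
    refine le_antisymm ?_ ?_ <;> refine Lp.norm_le_norm_of_ae_le ?_ <;>
    · refine ae_modelMeasure_iff.mpr ?_
      filter_upwards [ae_mulPhase u x] with p hp
      simp [hp, norm_phase_ofReal]

theorem ae_modularUnitary (u : ℝ) (x : ModelSpace) :
    ∀ᵐ p, modularUnitary u x p = phase u p * x p := ae_mulPhase u x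

theorem modularUnitary_add (u u' : ℝ) (x : ModelSpace) :
    modularUnitary (u + u') x = modularUnitary u (modularUnitary u' x) := mulPhase_add u u' x

/-! #### Dominated convergence -/

/-- Dominated convergence in `L²`, with vectors given by almost everywhere formulas. It serves the
strong continuity of the modular group, its generator and its analytic continuation. -/
theorem tendsto_of_dominated {ι : Type*} {l : Filter ι} [l.IsCountablyGenerated]
    {F : ι → ModelSpace} {F₀ : ModelSpace} {f : ι → ℝ → ℂ} {f₀ : ℝ → ℂ} {G : ℝ → ℂ}
    (hF : ∀ᶠ i in l, ∀ᵐ p, F i p = f i p) (hF₀ : ∀ᵐ p, F₀ p = f₀ p)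
    (hG : MemLp G 2 modelMeasure) (hb : ∀ᶠ i in l, ∀ᵐ p, ‖f i p - f₀ p‖ ≤ ‖G p‖)
    (hlim : ∀ᵐ p, Tendsto (fun i => f i p) l (𝓝 (f₀ p))) : Tendsto F l (𝓝 F₀) := by
  have hsub : ∀ᶠ i in l, (F i - F₀ : ModelSpace) =ᵐ[modelMeasure] fun p => f i p - f₀ p := by
    filter_upwards [hF] with i hi
    refine ae_modelMeasure_iff.mpr ?_
    filter_upwards [hi, hF₀, ae_sub (F i) F₀] with p h1 h2 h3
    rw [h3, h1, h2]
  have hsq : Tendsto (fun i => ∫⁻ p, ENNReal.ofReal (‖f i p - f₀ p‖ ^ 2) ∂modelMeasure) l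
      (𝓝 (∫⁻ _, 0 ∂modelMeasure)) := by
    refine tendsto_lintegral_filter_of_dominated_convergence'
      (fun p => ENNReal.ofReal (‖G p‖ ^ 2)) ?_ ?_ hG.lintegral_norm_sq_lt_top.ne ?_
    · filter_upwards [hsub] with i hi
      exact (((Lp.aestronglyMeasurable (F i - F₀)).congr hi).norm.aemeasurable.pow_const
        2).ennreal_ofReal
    · filter_upwards [hb] with i h1
      refine ae_modelMeasure_iff.mpr ?_
      filter_upwards [h1] with p k1
      exact ENNReal.ofReal_le_ofReal (by gcongr)
    · refine ae_modelMeasure_iff.mpr ?_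
      filter_upwards [hlim] with p hp
      have h1 : Tendsto (fun i => ‖f i p - f₀ p‖ ^ 2) l (𝓝 (‖f₀ p - f₀ p‖ ^ 2)) :=
        ((hp.sub_const _).norm).pow 2
      simpa using ENNReal.tendsto_ofReal h1
  rw [tendsto_iff_norm_sub_tendsto_zero]
  have h2 := ((ENNReal.tendsto_toReal (by simp)).comp hsq).sqrt
  simp only [lintegral_zero, ENNReal.toReal_zero, Real.sqrt_zero] at h2
  refine h2.congr' ?_
  filter_upwards [hsub] with i hi
  rw [Function.comp_apply, ← norm_sq_eq_toReal_lintegral hi, Real.sqrt_sq (norm_nonneg _)]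

theorem continuous_modularUnitary (x : ModelSpace) : Continuous fun u : ℝ => modularUnitary u x := by
  refine continuous_iff_continuousAt.mpr fun u => ?_
  refine tendsto_of_dominated (f := fun v p => phase v p * x p) (f₀ := fun p => phase u p * x p)
    (G := fun p => 2 * x p) (Eventually.of_forall fun v => ae_modularUnitary v x)
    (ae_modularUnitary u x) ((Lp.memLp x).const_mul 2) (Eventually.of_forall fun v =>
      ae_of_all _ fun p => ?_) (ae_of_all _ fun p => ?_)
  · rw [← sub_mul, norm_mul, norm_mul]
    gcongr
    refine (norm_sub_le _ _).trans ?_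
    rw [norm_phase_ofReal, norm_phase_ofReal]
    norm_num
  · have : Continuous fun v : ℝ => phase v p * x p := by
      unfold phase
      fun_prop
    exact this.tendsto u

theorem hasDerivAt_phase (z : ℂ) (p : ℝ) :
    HasDerivAt (fun w => phase w p) (-(2 * Real.pi * Complex.I * p) * phase z p) z := by
  have h : HasDerivAt (fun w : ℂ => -(2 * Real.pi * Complex.I * w * p))
      (-(2 * Real.pi * Complex.I * p)) z := by
    have := (((hasDerivAt_id z).const_mul (2 * Real.pi * Complex.I : ℂ)).mul_const (p : ℂ)).fun_neg
    simpa using this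
  simpa [phase, mul_comm] using h.cexp

/-- The difference quotients of `e^{-2πiup}` are bounded by `2π|p|`, so those of the orbit of `v`
are dominated by `κ`, which is square integrable by assumption. -/
theorem tendsto_modularUnitary_slope {v κ : ModelSpace}
    (h : ∀ᵐ p : ℝ, κ p = 2 * Real.pi * Complex.I * p * v p) :
    Tendsto (fun u : ℝ => (u : ℂ)⁻¹ • (modularUnitary u v - v)) (𝓝[≠] 0) (𝓝 (-κ)) := by
  have h0 : ∀ᵐ p : ℝ, (-κ : ModelSpace) p = -(2 * Real.pi * Complex.I * p) * v p := by
    filter_upwards [h, ae_modelMeasure_iff.mp (Lp.coeFn_neg κ)] with p h1 h2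
    rw [h2, Pi.neg_apply, h1]
    ring
  have hd : ∀ p u : ℝ, HasDerivAt (fun u : ℝ => phase u p)
      (-(2 * Real.pi * Complex.I * p) * phase u p) u := fun p u =>
    (hasDerivAt_phase u p).comp_ofReal
  refine tendsto_of_dominated (f := fun u p => slope (fun u : ℝ => phase u p) 0 u * v p)
    (G := fun p => 2 * κ p) ?_ h0 ((Lp.memLp κ).const_mul 2) ?_ ?_
  · refine Eventually.of_forall fun u => ?_
    filter_upwards [ae_smul ((u : ℂ)⁻¹) (modularUnitary u v - v),
      ae_sub (modularUnitary u v) v, ae_modularUnitary u v] with p h1 h2 h3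
    rw [slope_def_module, sub_zero, h1, h2, h3, Complex.real_smul, Complex.ofReal_inv,
      Complex.ofReal_zero, phase_zero]
    ring
  · refine Eventually.of_forall fun u => ?_
    filter_upwards [h] with p hp
    have hs : ‖slope (fun u : ℝ => phase u p) 0 u‖ ≤ ‖(2 * Real.pi * Complex.I * p : ℂ)‖ := by
      rw [slope_def_module, sub_zero, norm_smul, norm_inv]
      have := Convex.norm_image_sub_le_of_norm_hasDerivWithin_le (s := univ)
        (C := ‖(2 * Real.pi * Complex.I * p : ℂ)‖)
        (fun u _ => (hd p u).hasDerivWithinAt)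
        (fun u _ => by rw [norm_mul, norm_phase_ofReal, mul_one, norm_neg]) convex_univ
        (mem_univ 0) (mem_univ u)
      rw [sub_zero] at this
      rcases eq_or_ne u 0 with rfl | hu
      · simp
      · rw [inv_mul_le_iff₀ (norm_pos_iff.mpr hu), mul_comm]
        exact this
    rw [← sub_mul, norm_mul, hp, norm_mul, norm_mul, ← mul_assoc]
    refine mul_le_mul_of_nonneg_right ?_ (norm_nonneg _)
    refine (norm_sub_le _ _).trans ?_
    rw [norm_neg]
    have : ‖(2 : ℂ)‖ = 2 := by norm_num
    rw [this]
    linarith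
  · refine ae_of_all _ fun p => ?_
    have := hasDerivAt_iff_tendsto_slope.mp (hd p 0)
    rw [Complex.ofReal_zero, phase_zero, mul_one] at this
    exact this.mul_const _

end ModelSpace

/-! ### Transport of functions between an interval and the line -/

section Push

variable {a b c : ℝ}

/-- The function on the interval `(a, b)`, extended by zero, that corresponds to the function `ψ`
on the line under `intervalParam`. -/
def intervalPush (a b c : ℝ) (ψ : ℝ → ℝ) : ℝ → ℝ :=
  (Ioo a b).indicator fun x => ψ (intervalCoord a b c x)

theorem intervalPush_param (hab : a < b) (hc : 0 < c) (ψ : ℝ → ℝ) (s : ℝ) :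
    intervalPush a b c ψ (intervalParam a b c s) = ψ s := by
  rw [intervalPush, indicator_of_mem (intervalParam_mem hab c s), intervalCoord_param hab hc]

theorem intervalPush_of_notMem (ψ : ℝ → ℝ) {x : ℝ} (hx : x ∉ Ioo a b) :
    intervalPush a b c ψ x = 0 := indicator_of_notMem hx _

theorem eq_zero_of_tsupport_subset {φ : ℝ → ℝ} {s : Set ℝ} (h : tsupport φ ⊆ s) :
    ∀ x ∉ s, φ x = 0 := fun _ hx => image_eq_zero_of_notMem_tsupport fun hx' => hx (h hx')

namespace IsTestFunction

theorem comp_intervalParam (hc : 0 < c) {φ : ℝ → ℝ}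
    (hφ : IsTestFunction φ) (hs : tsupport φ ⊆ Ioo a b) :
    IsTestFunction fun s => φ (intervalParam a b c s) where
  contDiff := hφ.contDiff.comp (contDiff_intervalParam a b c)
  hasCompactSupport := by
    have hab : a < b ∨ ¬ a < b := em _
    rcases hab with hab | hab
    · have hK : IsCompact (intervalCoord a b c '' tsupport φ) :=
        hφ.hasCompactSupport.isCompact.image_of_continuousOn fun x hx =>
          ((contDiffAt_intervalCoord (hs hx)).continuousAt).continuousWithinAt
      refine HasCompactSupport.intro hK fun s hs' => ?_
      refine image_eq_zero_of_notMem_tsupport fun h => hs' ⟨_, h, intervalCoord_param hab hc s⟩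
    · have : φ = 0 := by
        funext x
        exact eq_zero_of_tsupport_subset hs x (by simp [hab])
      subst this
      exact HasCompactSupport.zero

theorem intervalPush_zero_off (hc : 0 < c) {ψ : ℝ → ℝ} {x : ℝ}
    (hx : x ∉ intervalParam a b c '' tsupport ψ) : intervalPush a b c ψ x = 0 := by
  by_cases hxI : x ∈ Ioo a b
  · rw [intervalPush, indicator_of_mem hxI]
    exact image_eq_zero_of_notMem_tsupport fun h => hx ⟨_, h, intervalParam_coord hc hxI⟩
  · exact intervalPush_of_notMem _ hxI

theorem isCompact_image_intervalParam {ψ : ℝ → ℝ} (hψ : IsTestFunction ψ) :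
    IsCompact (intervalParam a b c '' tsupport ψ) :=
  hψ.hasCompactSupport.isCompact.image (contDiff_intervalParam a b c).continuous

theorem tsupport_intervalPush_subset (hc : 0 < c) {ψ : ℝ → ℝ} (hψ : IsTestFunction ψ) :
    tsupport (intervalPush a b c ψ) ⊆ intervalParam a b c '' tsupport ψ := by
  refine closure_minimal (fun x hx => ?_) hψ.isCompact_image_intervalParam.isClosed
  by_contra h
  exact hx (intervalPush_zero_off hc h)

theorem tsupport_intervalPush (hab : a < b) (hc : 0 < c) {ψ : ℝ → ℝ} (hψ : IsTestFunction ψ) :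
    tsupport (intervalPush a b c ψ) ⊆ Ioo a b := by
  refine (hψ.tsupport_intervalPush_subset hc).trans ?_
  rintro _ ⟨s, -, rfl⟩
  exact intervalParam_mem hab c s

theorem intervalPush (hab : a < b) (hc : 0 < c) {ψ : ℝ → ℝ} (hψ : IsTestFunction ψ) :
    IsTestFunction (intervalPush a b c ψ) where
  contDiff := by
    refine contDiff_iff_contDiffAt.mpr fun x => ?_
    by_cases hx : x ∈ Ioo a b
    · have h1 : ContDiffAt ℝ ∞ (fun x => ψ (intervalCoord a b c x)) x :=
        hψ.contDiff.contDiffAt.comp x (contDiffAt_intervalCoord hx)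
      refine h1.congr_of_eventuallyEq ?_
      filter_upwards [isOpen_Ioo.mem_nhds hx] with y hy
      exact indicator_of_mem hy _
    · have hx' : x ∈ (intervalParam a b c '' tsupport ψ)ᶜ := by
        rintro ⟨s, -, rfl⟩
        exact hx (intervalParam_mem hab c s)
      refine (contDiffAt_const (c := (0 : ℝ))).congr_of_eventuallyEq ?_
      filter_upwards [hψ.isCompact_image_intervalParam.isClosed.isOpen_compl.mem_nhds hx'] with y hy
      exact intervalPush_zero_off hc hy
  hasCompactSupport := HasCompactSupport.intro hψ.isCompact_image_intervalParam
    fun _ hx => intervalPush_zero_off hc hx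

/-- The thermal norm of `ψ` is the vacuum norm of its image on `(0, 1)`, which is a test function
and so has a vacuum vector; no estimate of `coth` is needed. -/
theorem lintegral_thermal_lt_top {ψ : ℝ → ℝ} (hψ : IsTestFunction ψ) {β : ℝ} (hβ : 0 < β) :
    ∫⁻ p, ENNReal.ofReal (‖lineFourier ψ p‖ ^ 2) ∂(thermalMeasure β) < ⊤ := by
  have hc : 0 < 2 * Real.pi / β := by positivity
  have hφ := hψ.intervalPush (a := 0) (b := 1) zero_lt_one hc
  have hcomp : (fun s => _root_.intervalPush 0 1 (2 * Real.pi / β) ψ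
      (intervalParam 0 1 (2 * Real.pi / β) s)) = ψ :=
    funext fun s => intervalPush_param zero_lt_one hc ψ s
  have key := lintegral_vacuum_eq_thermal zero_lt_one hβ hφ.continuous.measurable
    (fun x hx => intervalPush_of_notMem _ hx) hφ.integrable hφ.memLp
    (by rw [hcomp]; exact hψ.integrable) (by rw [hcomp]; exact hψ.memLp)
  rw [hcomp] at key
  rw [← key]
  obtain ⟨v, hv⟩ := hφ.exists_vacuumRep
  exact (MemLp.ae_eq hv.2 (Lp.memLp v)).lintegral_norm_sq_lt_top

end IsTestFunction

end Push

/-! ### Functions on the line as vectors of the spectral model -/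

namespace ModelSpace

/-- Folding the line at the origin leaves the even part of the density on the half-line. -/
theorem lintegral_modelMeasure_eq_thermal {F : ℝ → ℝ≥0∞} (hm : Measurable F)
    (hF : ∀ p, F (-p) = F p) :
    ∫⁻ p, F p ∂modelMeasure = ∫⁻ p, F p ∂(thermalMeasure (2 * Real.pi)) := by
  have hθ : Measurable fun p : ℝ => ENNReal.ofReal
      (p * (Real.cosh (2 * Real.pi * p / 2) / Real.sinh (2 * Real.pi * p / 2)) / Real.pi) := by
    fun_prop
  have hρ : Measurable fun p => ENNReal.ofReal (modelDensity p) * F p := by fun_prop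
  rw [lintegral_modelMeasure hm.aemeasurable, thermalMeasure,
    lintegral_withDensity_eq_lintegral_mul _ hθ hm]
  have hsplit := lintegral_add_compl (μ := volume)
    (fun p => ENNReal.ofReal (modelDensity p) * F p) (measurableSet_Ioi (a := (0 : ℝ)))
  rw [← hsplit, compl_Ioi, ← restrict_Iio_eq_restrict_Iic]
  have hneg : ∫⁻ p in Iio (0 : ℝ), ENNReal.ofReal (modelDensity p) * F p =
      ∫⁻ p in Ioi (0 : ℝ), ENNReal.ofReal (modelDensity (-p)) * F p := by
    have := (Measure.measurePreserving_neg (volume : Measure ℝ)).setLIntegral_comp_preimage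
      measurableSet_Iio hρ (s := Iio 0)
    rw [← this]
    simp [hF]
  rw [hneg, ← lintegral_add_left hρ]
  refine setLIntegral_congr_fun measurableSet_Ioi fun p hp => ?_
  have hp' : p ≠ 0 := (mem_Ioi.mp hp).ne'
  simp only [Pi.mul_apply]
  rw [← add_mul, ← ENNReal.ofReal_add (modelDensity_nonneg _) (modelDensity_nonneg _),
    modelDensity_add hp']

/-- The vector `m` of the spectral model is the function `ψ` on the line. -/
def Rep (ψ : ℝ → ℝ) (m : ModelSpace) : Prop := Integrable ψ ∧ ∀ᵐ p, m p = lineFourier ψ p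

theorem Rep.isHermitian {ψ : ℝ → ℝ} {m : ModelSpace} (h : Rep ψ m) : IsHermitian m := by
  have h' := ae_neg_iff.mpr h.2
  filter_upwards [h.2, h'] with p h1 h2
  rw [h2, h1, lineFourier_neg_arg]

theorem Rep.add {ψ χ : ℝ → ℝ} {m n : ModelSpace} (hm : Rep ψ m) (hn : Rep χ n) :
    Rep (fun x => ψ x + χ x) (m + n) := by
  refine ⟨hm.1.add hn.1, ?_⟩
  filter_upwards [hm.2, hn.2, ae_add m n] with p h1 h2 h3
  rw [h3, h1, h2, lineFourier_add hm.1 hn.1]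

theorem Rep.sub {ψ χ : ℝ → ℝ} {m n : ModelSpace} (hm : Rep ψ m) (hn : Rep χ n) :
    Rep (fun x => ψ x - χ x) (m - n) := by
  refine ⟨hm.1.sub hn.1, ?_⟩
  filter_upwards [hm.2, hn.2, ae_sub m n] with p h1 h2 h3
  rw [h3, h1, h2, lineFourier_sub hm.1 hn.1]

theorem measurable_norm_lineFourier_sq {ψ : ℝ → ℝ} (hψ : Integrable ψ) :
    Measurable fun p => ENNReal.ofReal (‖lineFourier ψ p‖ ^ 2) :=
  ((continuous_lineFourier hψ).norm.pow 2).measurable.ennreal_ofReal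

theorem lintegral_lineFourier {ψ : ℝ → ℝ} (hψ : Integrable ψ) :
    ∫⁻ p, ENNReal.ofReal (‖lineFourier ψ p‖ ^ 2) ∂modelMeasure =
      ∫⁻ p, ENNReal.ofReal (‖lineFourier ψ p‖ ^ 2) ∂(thermalMeasure (2 * Real.pi)) :=
  lintegral_modelMeasure_eq_thermal (measurable_norm_lineFourier_sq hψ) fun p => by
    rw [norm_lineFourier_neg_arg]

theorem exists_rep_of_lintegral_lt_top {ψ : ℝ → ℝ} (hψ : Integrable ψ)
    (h : ∫⁻ p, ENNReal.ofReal (‖lineFourier ψ p‖ ^ 2) ∂(thermalMeasure (2 * Real.pi)) < ⊤) :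
    ∃ m, Rep ψ m := by
  rw [← lintegral_lineFourier hψ] at h
  obtain ⟨m, hm⟩ := exists_of_memLp (memLp_two_of_lintegral_lt_top
    (continuous_lineFourier hψ).aestronglyMeasurable h)
  exact ⟨m, hψ, hm⟩

theorem _root_.IsTestFunction.exists_modelRep {ψ : ℝ → ℝ} (hψ : IsTestFunction ψ) :
    ∃ m, Rep ψ m :=
  exists_rep_of_lintegral_lt_top hψ.integrable (hψ.lintegral_thermal_lt_top (by positivity))

theorem Rep.norm_sq_eq {ψ : ℝ → ℝ} {m : ModelSpace} (h : Rep ψ m) :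
    ‖m‖ ^ 2 = (∫⁻ p, ENNReal.ofReal (‖lineFourier ψ p‖ ^ 2)
      ∂(thermalMeasure (2 * Real.pi))).toReal := by
  rw [← lintegral_lineFourier h.1]
  exact norm_sq_eq_toReal_lintegral (ae_modelMeasure_iff.mpr h.2)

/-- For real `ψ` the reflection `p ↦ -p` removes the conjugate from the transform. The pairing then
has the form `∫ ψ̂ h` to which totality of test functions applies. -/
theorem Rep.inner_eq {ψ : ℝ → ℝ} {m : ModelSpace} (h : Rep ψ m) (x : ModelSpace) :
    ⟪m, x⟫_ℂ = ∫ p, lineFourier ψ p * ((modelDensity (-p) : ℂ) * x (-p)) := by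
  rw [ModelSpace.inner_eq, ← integral_neg_eq_self]
  refine integral_congr_ae ?_
  filter_upwards [ae_neg_iff.mpr h.2] with p hp
  rw [hp, lineFourier_neg_arg, Complex.conj_conj]
  ring

theorem Rep.inner_eq_left {ψ : ℝ → ℝ} {m : ModelSpace} (h : Rep ψ m) (x : ModelSpace) :
    ⟪x, m⟫_ℂ = ∫ p, lineFourier ψ p * ((modelDensity p : ℂ) * (starRingEnd ℂ) (x p)) := by
  rw [ModelSpace.inner_eq]
  refine integral_congr_ae ?_
  filter_upwards [h.2] with p hp
  rw [hp]
  ring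

theorem Rep.integrable_left {ψ : ℝ → ℝ} {m : ModelSpace} (h : Rep ψ m) (x : ModelSpace) :
    Integrable fun p => lineFourier ψ p * ((modelDensity p : ℂ) * (starRingEnd ℂ) (x p)) := by
  refine (integrable_inner x m).congr ?_
  filter_upwards [h.2] with p hp
  rw [hp]
  ring

theorem Rep.integrable_right {ψ : ℝ → ℝ} {m : ModelSpace} (h : Rep ψ m) (x : ModelSpace) :
    Integrable fun p => lineFourier ψ p * ((modelDensity (-p) : ℂ) * x (-p)) := by
  refine (integrable_inner m x).comp_neg.congr ?_
  filter_upwards [ae_neg_iff.mpr h.2] with p hp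
  rw [hp, lineFourier_neg_arg, Complex.conj_conj]
  ring

/-- At `-p` the product of transforms is conjugated, so the imaginary part sees only the odd part
`p/π` of the density, as in the vacuum. -/
theorem Rep.im_inner_eq {ψ χ : ℝ → ℝ} {m n : ModelSpace} (hm : Rep ψ m) (hψ : MemLp ψ 2)
    (hn : Rep χ n) (hχ : IsTestFunction χ) : (⟪m, n⟫_ℂ).im = ∫ x, ψ x * deriv χ x := by
  have hint : Integrable fun p => (modelDensity p : ℂ) *
      ((starRingEnd ℂ) (lineFourier ψ p) * lineFourier χ p) := by
    refine (integrable_inner m n).congr ?_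
    filter_upwards [hm.2, hn.2] with p h1 h2
    rw [h1, h2]
  have h1 : ⟪m, n⟫_ℂ = ∫ p, (modelDensity p : ℂ) *
      ((starRingEnd ℂ) (lineFourier ψ p) * lineFourier χ p) := by
    rw [ModelSpace.inner_eq]
    refine integral_congr_ae ?_
    filter_upwards [hm.2, hn.2] with p h1 h2
    rw [h1, h2]
  have hI := (integrable_conj_lineFourier_mul_id hm.1 hψ hχ).integrableOn (s := Ioi 0)
  have him := im_integral_Ioi_conj_lineFourier_mul hm.1 hψ hχ
  rw [h1, integral_Ioi_add_comp_neg hint]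
  have hint2 := (hint.add hint.comp_neg).integrableOn (s := Ioi (0 : ℝ))
  have e1 := integral_im hint2
  have e2 := integral_im hI
  simp only [RCLike.im_to_complex, Pi.add_apply] at e1 e2
  rw [← e1, integral_congr_ae (g := fun p : ℝ => Real.pi⁻¹ *
    ((starRingEnd ℂ) (lineFourier ψ p) * lineFourier χ p * p).im), integral_const_mul, e2, him]
  · have := Real.pi_ne_zero
    field_simp
  · refine ae_of_all _ fun p => ?_
    have hd := modelDensity_sub p
    have hc : (starRingEnd ℂ) (lineFourier ψ (-p)) * lineFourier χ (-p) =
        (starRingEnd ℂ) ((starRingEnd ℂ) (lineFourier ψ p) * lineFourier χ p) := by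
      rw [lineFourier_neg_arg, lineFourier_neg_arg, map_mul]
    simp only []
    rw [hc]
    set z := (starRingEnd ℂ) (lineFourier ψ p) * lineFourier χ p
    rw [Complex.add_im, Complex.im_ofReal_mul, Complex.im_ofReal_mul, Complex.im_mul_ofReal,
      Complex.conj_im, eq_add_of_sub_eq hd]
    ring

/-! ### Analytic continuation of the modular group -/

/-- On the closed strip the modulus is at most its larger value on the two boundary lines, `1` or
`e^{-2πp}`; their sum bounds it uniformly in `z`. -/
theorem norm_phase_le {z : ℂ} (h1 : -1 ≤ z.im) (h0 : z.im ≤ 0) (p : ℝ) :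
    ‖phase z p‖ ≤ 1 + Real.exp (-(2 * Real.pi * p)) := by
  rw [norm_phase]
  have hπ := Real.pi_pos
  rcases le_total 0 p with hp | hp
  · have : Real.exp (2 * Real.pi * z.im * p) ≤ Real.exp 0 := by
      refine Real.exp_le_exp.mpr ?_
      have : 0 ≤ 2 * Real.pi * p * (-z.im) := by
        have := neg_nonneg.mpr h0
        positivity
      linarith
    rw [Real.exp_zero] at this
    linarith [Real.exp_pos (-(2 * Real.pi * p))]
  · have : Real.exp (2 * Real.pi * z.im * p) ≤ Real.exp (-(2 * Real.pi * p)) := by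
      refine Real.exp_le_exp.mpr ?_
      have h1' : 0 ≤ z.im + 1 := by linarith
      have hp' : 0 ≤ -p := by linarith
      have : 0 ≤ 2 * Real.pi * (z.im + 1) * (-p) := by positivity
      linarith
    linarith

/-- The factor `2π|p|` is at most `δ⁻¹ e^{2πδ|p|}`. This exponential moves `z` by `δ` towards one
edge of the strip, up or down with the sign of `p`, where the uniform bound still holds. -/
theorem norm_deriv_phase_le {z : ℂ} {δ : ℝ} (hδ : 0 < δ) (h1 : -1 + δ ≤ z.im) (h0 : z.im ≤ -δ)
    (p : ℝ) : ‖-(2 * Real.pi * Complex.I * p) * phase z p‖ ≤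
      δ⁻¹ * (1 + Real.exp (-(2 * Real.pi * p))) := by
  have hπ := Real.pi_pos
  have hn : ‖-(2 * Real.pi * Complex.I * p : ℂ)‖ = 2 * Real.pi * |p| := by
    simp [abs_of_pos hπ]
  rw [norm_mul, hn]
  have hte : δ * (2 * Real.pi * |p|) ≤ Real.exp (δ * (2 * Real.pi * |p|)) := by
    linarith [Real.add_one_le_exp (δ * (2 * Real.pi * |p|))]
  have hmul : Real.exp (δ * (2 * Real.pi * |p|)) * ‖phase z p‖ ≤
      1 + Real.exp (-(2 * Real.pi * p)) := by
    rcases le_total 0 p with hp | hp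
    · have h2 : Real.exp (δ * (2 * Real.pi * |p|)) * ‖phase z p‖ =
          ‖phase (z + (δ : ℝ) * Complex.I) p‖ := by
        rw [norm_phase, norm_phase, ← Real.exp_add, abs_of_nonneg hp]
        congr 1
        simp
        ring
      rw [h2]
      refine norm_phase_le ?_ ?_ p <;> simp <;> linarith
    · have h2 : Real.exp (δ * (2 * Real.pi * |p|)) * ‖phase z p‖ =
          ‖phase (z - (δ : ℝ) * Complex.I) p‖ := by
        rw [norm_phase, norm_phase, ← Real.exp_add, abs_of_nonpos hp]
        congr 1
        simp
        ring
      rw [h2]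
      refine norm_phase_le ?_ ?_ p <;> simp <;> linarith
  rw [le_inv_mul_iff₀ hδ, ← mul_assoc]
  exact (mul_le_mul_of_nonneg_right hte (norm_nonneg _)).trans hmul

/-- The strip `-1 < Im z < 0`. -/
def strip : Set ℂ := {z : ℂ | -1 < z.im ∧ z.im < 0}

theorem isOpen_strip : IsOpen strip :=
  (isOpen_lt continuous_const Complex.continuous_im).inter
    (isOpen_lt Complex.continuous_im continuous_const)

theorem convex_strip : Convex ℝ strip :=
  (convex_halfSpace_im_gt (-1)).inter (convex_halfSpace_im_lt 0)

theorem closure_strip_subset : closure strip ⊆ {z : ℂ | -1 ≤ z.im ∧ z.im ≤ 0} :=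
  closure_minimal (fun _ hz => ⟨hz.1.le, hz.2.le⟩)
    ((isClosed_le continuous_const Complex.continuous_im).inter
      (isClosed_le Complex.continuous_im continuous_const))

theorem neg_I_mem_closure_strip : -Complex.I ∈ closure strip := by
  have h : Tendsto (fun n : ℕ => -Complex.I + ((1 / ((n : ℝ) + 1) : ℝ) : ℂ) * Complex.I * (1 / 2))
      atTop (𝓝 (-Complex.I + ((0 : ℝ) : ℂ) * Complex.I * (1 / 2))) := by
    refine tendsto_const_nhds.add ((Tendsto.mul_const _ ?_).mul_const _)
    exact (Complex.continuous_ofReal.tendsto _).comp tendsto_one_div_add_atTop_nhds_zero_nat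
  simp only [Complex.ofReal_zero, zero_mul, add_zero] at h
  refine mem_closure_of_tendsto h (Eventually.of_forall fun n => ?_)
  have h1 : (0 : ℝ) < 1 / ((n : ℝ) + 1) := by positivity
  have h2 : 1 / ((n : ℝ) + 1) ≤ 1 := by
    rw [div_le_one (by positivity)]
    linarith [Nat.cast_nonneg (α := ℝ) n]
  have him : (-Complex.I + ((1 / ((n : ℝ) + 1) : ℝ) : ℂ) * Complex.I * (1 / 2)).im =
      -1 + 1 / ((n : ℝ) + 1) / 2 := by
    rw [show (-Complex.I + ((1 / ((n : ℝ) + 1) : ℝ) : ℂ) * Complex.I * (1 / 2)) =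
      ((-1 + 1 / ((n : ℝ) + 1) / 2 : ℝ) : ℂ) * Complex.I by push_cast; ring,
      Complex.im_ofReal_mul, Complex.I_im, mul_one]
  refine ⟨?_, ?_⟩ <;> rw [him] <;> linarith

/-- The extension is multiplication by `e^{-2πizp}`. Since `x` and `e^{-2πp} x` are both square
integrable, `(1 + e^{-2πp}) |x|` dominates it on the closed strip, and a multiple of the same
function dominates its difference quotients locally. -/
theorem exists_strip_extension {x y : ModelSpace}
    (hy : ∀ᵐ p : ℝ, y p = ((Real.exp (-(2 * Real.pi * p)) : ℝ) : ℂ) * x p) :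
    ∃ F : ℂ → ModelSpace, DiffContOnCl ℂ F strip ∧
      (∀ z : ℂ, -1 ≤ z.im → z.im ≤ 0 → ∀ᵐ p, F z p = phase z p * x p) := by
  have hG : MemLp (fun p => ((1 + Real.exp (-(2 * Real.pi * p)) : ℝ) : ℂ) * x p) 2
      modelMeasure := by
    refine memLp_of_ae (x := x + y) ?_
    filter_upwards [hy, ae_add x y] with p h1 h2
    rw [h2, h1]
    push_cast
    ring
  have hnG : ∀ p : ℝ, ‖((1 + Real.exp (-(2 * Real.pi * p)) : ℝ) : ℂ)‖ =
      1 + Real.exp (-(2 * Real.pi * p)) := fun p => by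
    rw [Complex.norm_real, Real.norm_of_nonneg]
    positivity
  have hxm : AEStronglyMeasurable x modelMeasure := Lp.aestronglyMeasurable x
  have hex : ∀ z : ℂ, ∃ X : ModelSpace, -1 ≤ z.im → z.im ≤ 0 → ∀ᵐ p, X p = phase z p * x p := by
    intro z
    by_cases hz : -1 ≤ z.im ∧ z.im ≤ 0
    · obtain ⟨X, hX⟩ := exists_of_memLp (hG.of_le
        ((continuous_phase z).aestronglyMeasurable.mul hxm) (ae_of_all _ fun p => by
          rw [Pi.mul_apply, norm_mul, norm_mul, hnG]
          exact mul_le_mul_of_nonneg_right (norm_phase_le hz.1 hz.2 p) (norm_nonneg _)))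
      exact ⟨X, fun _ _ => hX⟩
    · exact ⟨0, fun h1 h2 => absurd ⟨h1, h2⟩ hz⟩
  choose F hF using hex
  refine ⟨F, ⟨fun z hz => ?_, fun z hz => ?_⟩, hF⟩
  · -- holomorphy
    obtain ⟨δ, hδ, hδ1, hδ2⟩ : ∃ δ : ℝ, 0 < δ ∧ -1 + 2 * δ ≤ z.im ∧ z.im ≤ -(2 * δ) := by
      refine ⟨min (z.im + 1) (-z.im) / 2, ?_, ?_, ?_⟩
      · have := lt_min (show 0 < z.im + 1 by linarith [hz.1]) (show 0 < -z.im by linarith [hz.2])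
        positivity
      · linarith [min_le_left (z.im + 1) (-z.im)]
      · linarith [min_le_right (z.im + 1) (-z.im)]
    have hball : ∀ w ∈ Metric.ball z δ, -1 + δ ≤ w.im ∧ w.im ≤ -δ := fun w hw => by
      have h1 : |w.im - z.im| < δ := by
        rw [← Complex.sub_im]
        exact (Complex.abs_im_le_norm _).trans_lt (mem_ball_iff_norm.mp hw)
      rw [abs_lt] at h1
      constructor <;> linarith [h1.1, h1.2]
    have hG' := hG.const_mul ((δ⁻¹ : ℝ) : ℂ)
    have hnδ : ‖((δ⁻¹ : ℝ) : ℂ)‖ = δ⁻¹ := by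
      rw [Complex.norm_real, Real.norm_of_nonneg (by positivity)]
    obtain ⟨D, hD⟩ := exists_of_memLp (F := fun p => -(2 * Real.pi * Complex.I * p) * phase z p *
      x p) (hG'.of_le (AEStronglyMeasurable.mul (Continuous.aestronglyMeasurable (by fun_prop)) hxm)
        (ae_of_all _ fun p => by
          rw [norm_mul, norm_mul _ (_ * _), norm_mul _ (x p), hnδ, hnG, ← mul_assoc]
          refine mul_le_mul_of_nonneg_right (norm_deriv_phase_le hδ ?_ ?_ p) (norm_nonneg _) <;>
          linarith))
    refine (HasDerivAt.differentiableAt (f' := D) ?_).differentiableWithinAt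
    rw [hasDerivAt_iff_tendsto_slope]
    have hev : ∀ᶠ w in 𝓝[≠] z, w ∈ Metric.ball z δ :=
      mem_nhdsWithin_of_mem_nhds (Metric.ball_mem_nhds z hδ)
    refine tendsto_of_dominated (f := fun w p => slope (fun w => phase w p) z w * x p)
      (G := fun p => 2 * (((δ⁻¹ : ℝ) : ℂ) *
        (((1 + Real.exp (-(2 * Real.pi * p)) : ℝ) : ℂ) * x p))) ?_ hD (hG'.const_mul 2) ?_ ?_
    · filter_upwards [hev] with w hw
      have hw' := hball w hw
      filter_upwards [hF w (by linarith) (by linarith), hF z (by linarith) (by linarith),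
        ae_smul ((w - z)⁻¹) (F w - F z), ae_sub (F w) (F z)] with p h1 h2 h3 h4
      rw [slope_def_module, slope_def_module, h3, h4, h1, h2, smul_eq_mul]
      ring
    · filter_upwards [hev] with w hw
      refine ae_of_all _ fun p => ?_
      have hzb : z ∈ Metric.ball z δ := Metric.mem_ball_self hδ
      have hs : ‖slope (fun w => phase w p) z w‖ ≤ δ⁻¹ * (1 + Real.exp (-(2 * Real.pi * p))) := by
        rw [slope_def_module, norm_smul, norm_inv]
        have := Convex.norm_image_sub_le_of_norm_hasDerivWithin_le (s := Metric.ball z δ)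
          (C := δ⁻¹ * (1 + Real.exp (-(2 * Real.pi * p))))
          (fun u _ => (hasDerivAt_phase u p).hasDerivWithinAt)
          (fun u hu => norm_deriv_phase_le hδ (hball u hu).1 (hball u hu).2 p) (convex_ball z δ)
          hzb hw
        rcases eq_or_ne w z with rfl | hne
        · simp
          positivity
        · rw [inv_mul_le_iff₀ (norm_pos_iff.mpr (sub_ne_zero.mpr hne)), mul_comm]
          exact this
      have hd := norm_deriv_phase_le hδ (hball z hzb).1 (hball z hzb).2 p
      have h2 : ‖(2 : ℂ)‖ = 2 := by norm_num
      rw [← sub_mul, norm_mul, norm_mul, norm_mul, norm_mul, hnδ, hnG, h2, ← mul_assoc, ← mul_assoc]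
      refine mul_le_mul_of_nonneg_right ?_ (norm_nonneg _)
      refine (norm_sub_le _ _).trans ?_
      linarith
    · exact ae_of_all _ fun p =>
        (hasDerivAt_iff_tendsto_slope.mp (hasDerivAt_phase z p)).mul_const _
  · -- continuity up to the boundary
    have hz' := closure_strip_subset hz
    have hev : ∀ᶠ w in 𝓝[closure strip] z, w ∈ closure strip := self_mem_nhdsWithin
    refine tendsto_of_dominated (f := fun w p => phase w p * x p)
      (G := fun p => 2 * (((1 + Real.exp (-(2 * Real.pi * p)) : ℝ) : ℂ) * x p)) ?_
      (hF z hz'.1 hz'.2) (hG.const_mul 2) ?_ ?_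
    · filter_upwards [hev] with w hw
      exact hF w (closure_strip_subset hw).1 (closure_strip_subset hw).2
    · filter_upwards [hev] with w hw
      refine ae_of_all _ fun p => ?_
      have h2 : ‖(2 : ℂ)‖ = 2 := by norm_num
      rw [← sub_mul, norm_mul, norm_mul, norm_mul, hnG, h2, ← mul_assoc]
      refine mul_le_mul_of_nonneg_right ?_ (norm_nonneg _)
      refine (norm_sub_le _ _).trans ?_
      have := norm_phase_le (closure_strip_subset hw).1 (closure_strip_subset hw).2 p
      have := norm_phase_le hz'.1 hz'.2 p
      linarith
    · refine ae_of_all _ fun p => ?_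
      have : Continuous fun w : ℂ => phase w p * x p := by
        unfold phase
        fun_prop
      exact (this.tendsto z).mono_left nhdsWithin_le_nhds

theorem inner_congr_right {d u v : ModelSpace} (h : ∀ᵐ p, d p ≠ 0 → u p = v p) :
    ⟪d, u⟫_ℂ = ⟪d, v⟫_ℂ := by
  rw [inner_eq, inner_eq]
  refine integral_congr_ae ?_
  filter_upwards [h] with p hp
  by_cases hd : d p = 0
  · simp [hd]
  · rw [hp hd]

/-- This gives the exactness of the domain. For momenta bounded by `N` the continuation exists
explicitly, and boundary uniqueness forces any other continuation to agree with it there; then `N`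
grows. -/
theorem strip_extension_neg_I {x : ModelSpace} {F : ℂ → ModelSpace}
    (hF : DiffContOnCl ℂ F strip) (hu : ∀ u : ℝ, F u = modularUnitary u x) :
    ∀ᵐ p : ℝ, F (-Complex.I) p = ((Real.exp (-(2 * Real.pi * p)) : ℝ) : ℂ) * x p := by
  suffices h : ∀ N : ℕ, ∀ᵐ p : ℝ, |p| ≤ N →
      F (-Complex.I) p = ((Real.exp (-(2 * Real.pi * p)) : ℝ) : ℂ) * x p by
    filter_upwards [ae_all_iff.mpr h] with p hp
    obtain ⟨N, hN⟩ := exists_nat_ge |p|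
    exact hp N hN
  intro N
  have hS : MeasurableSet {p : ℝ | |p| ≤ N} := measurableSet_le (by fun_prop) measurable_const
  obtain ⟨xN, hxN⟩ := exists_mul_of_norm_le (m := indicator {p : ℝ | |p| ≤ N} 1)
    (measurable_one.indicator hS).aestronglyMeasurable (fun p => by
      by_cases hp : p ∈ {p : ℝ | |p| ≤ N} <;> simp [hp]) x
  obtain ⟨yN, hyN⟩ := exists_mul_of_norm_le (m := indicator {p : ℝ | |p| ≤ N} 1)
    (measurable_one.indicator hS).aestronglyMeasurable (fun p => by
      by_cases hp : p ∈ {p : ℝ | |p| ≤ N} <;> simp [hp]) (F (-Complex.I))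
  -- The shift by `N` makes the multiplier at most `1`; the constant `C` undoes it.
  obtain ⟨zN, hzN⟩ := exists_mul_of_norm_le (m := indicator {p : ℝ | |p| ≤ N} fun p =>
      ((Real.exp (-(2 * Real.pi * (p + N))) : ℝ) : ℂ))
    (Measurable.indicator (by fun_prop) hS).aestronglyMeasurable (fun p => by
      by_cases hp : p ∈ {p : ℝ | |p| ≤ N}
      · rw [indicator_of_mem hp, Complex.norm_real, Real.norm_of_nonneg (Real.exp_pos _).le,
          Real.exp_le_one_iff]
        have h1 : 0 ≤ p + N := by linarith [neg_abs_le p, (show |p| ≤ N from hp)]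
        have := Real.pi_pos
        have : 0 ≤ 2 * Real.pi * (p + N) := by positivity
        linarith
      · rw [indicator_of_notMem hp]
        simp) x
  set C : ℂ := ((Real.exp (2 * Real.pi * N) : ℝ) : ℂ)
  have hw : ∀ᵐ p : ℝ, (C • zN) p = ((Real.exp (-(2 * Real.pi * p)) : ℝ) : ℂ) * xN p := by
    filter_upwards [hzN, hxN, ae_smul C zN] with p h1 h2 h3
    rw [h3, h1, h2]
    by_cases hp : p ∈ {p : ℝ | |p| ≤ N}
    · rw [indicator_of_mem hp, indicator_of_mem hp, Pi.one_apply, one_mul, ← mul_assoc,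
        ← Complex.ofReal_mul, ← Real.exp_add]
      congr 4
      ring
    · simp [indicator_of_notMem hp]
  obtain ⟨F', hF', hF'z⟩ := exists_strip_extension hw
  -- The discrepancy at `-i` is its own test vector: it lives on `|p| ≤ N`, so pairing with it sees
  -- only bounded momenta, and at `-i` the difference of the two pairings is `‖d‖²`.
  set d : ModelSpace := yN - C • zN
  have hd : ∀ᵐ p : ℝ, d p ≠ 0 → |p| ≤ N := by
    filter_upwards [hyN, hzN, ae_smul C zN, ae_sub yN (C • zN)] with p h1 h2 h3 h4 h5
    by_contra hp
    have hp' : p ∉ {p : ℝ | |p| ≤ N} := hp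
    refine h5 ?_
    rw [h4, h3, h2, h1, indicator_of_notMem hp', indicator_of_notMem hp']
    simp
  have hG : DiffContOnCl ℂ (fun z => ⟪d, F z⟫_ℂ - ⟪d, F' z⟫_ℂ) strip :=
    ((innerSL ℂ d).differentiable.comp_diffContOnCl hF).sub
      ((innerSL ℂ d).differentiable.comp_diffContOnCl hF')
  have hzero := eqOn_zero_of_boundary_eq_zero isOpen_strip convex_strip hG (x₀ := 0)
    (ε := 1) one_pos (fun z _ h1 h2 => ⟨h1, h2⟩) (fun u _ => by
      rw [hu u, sub_eq_zero]
      refine inner_congr_right ?_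
      filter_upwards [hd, ae_modularUnitary u x, hF'z u (by simp) (by simp), hxN]
        with p h1 h2 h3 h4 h5
      rw [h2, h3, h4, indicator_of_mem (show p ∈ {p : ℝ | |p| ≤ N} from h1 h5), Pi.one_apply,
        one_mul])
  have hI := hzero neg_I_mem_closure_strip
  simp only [Pi.zero_apply] at hI
  have hdd : ⟪d, d⟫_ℂ = 0 := by
    rw [← hI, ← inner_sub_right]
    refine inner_congr_right ?_
    filter_upwards [hd, hyN, hw, hF'z (-Complex.I) (by simp) (by simp), ae_sub yN (C • zN),
      ae_sub (F (-Complex.I)) (F' (-Complex.I))] with p h1 h2 h3 h4 h5 h6 h7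
    rw [h6, h5, h3, h4, h2, indicator_of_mem (show p ∈ {p : ℝ | |p| ≤ N} from h1 h7), Pi.one_apply,
      one_mul, phase_neg_I]
  have hd0 : d = 0 := inner_self_eq_zero.mp hdd
  have hyz : yN = C • zN := sub_eq_zero.mp hd0
  filter_upwards [hyN, hw, hxN] with p h1 h2 h3 hp
  have hp' : p ∈ {p : ℝ | |p| ≤ N} := hp
  rw [← hyz, h1, h3, indicator_of_mem hp'] at h2
  simpa using h2

theorem strip_iff (x y : ModelSpace) :
    (∀ᵐ p : ℝ, y p = ((Real.exp (-(2 * Real.pi * p)) : ℝ) : ℂ) * x p) ↔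
      ∃ F : ℂ → ModelSpace, DiffContOnCl ℂ F strip ∧ (∀ u : ℝ, F u = modularUnitary u x) ∧
        F (-Complex.I) = y := by
  constructor
  · intro hy
    obtain ⟨F, hF, hFz⟩ := exists_strip_extension hy
    refine ⟨F, hF, fun u => ext_ae ?_, ext_ae ?_⟩
    · filter_upwards [hFz u (by simp) (by simp), ae_modularUnitary u x] with p h1 h2
      rw [h1, h2]
    · filter_upwards [hFz (-Complex.I) (by simp) (by simp), hy] with p h1 h2
      rw [h1, h2, phase_neg_I]
  · rintro ⟨F, hF, hu, rfl⟩
    exact strip_extension_neg_I hF hu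

/-! ### Tomita theory of the spectral model -/

theorem IsHermitian.add {x y : ModelSpace} (hx : IsHermitian x) (hy : IsHermitian y) :
    IsHermitian (x + y) := by
  filter_upwards [hx, hy, ae_add x y, ae_neg_iff.mpr (ae_add x y)] with p h1 h2 h3 h4
  rw [h4, h3, h1, h2, map_add]

theorem IsHermitian.real_smul {x : ModelSpace} (hx : IsHermitian x) (r : ℝ) :
    IsHermitian ((r : ℂ) • x) := by
  filter_upwards [hx, ae_smul (r : ℂ) x, ae_neg_iff.mpr (ae_smul (r : ℂ) x)] with p h1 h2 h3
  rw [h3, h2, h1, map_mul, Complex.conj_ofReal]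

theorem IsHermitian.sub {x y : ModelSpace} (hx : IsHermitian x) (hy : IsHermitian y) :
    IsHermitian (x - y) := by
  filter_upwards [hx, hy, ae_sub x y, ae_neg_iff.mpr (ae_sub x y)] with p h1 h2 h3 h4
  rw [h4, h3, h1, h2, map_sub]

theorem isHermitian_zero : IsHermitian 0 := by
  filter_upwards [ae_zero, ae_neg_iff.mpr ae_zero] with p h1 h2
  rw [h1, h2, map_zero]

theorem eq_zero_of_isHermitian_I_smul {x : ModelSpace} (hx : IsHermitian x)
    (hI : IsHermitian (Complex.I • x)) : x = 0 := by
  refine ext_ae ?_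
  filter_upwards [hx, hI, ae_smul Complex.I x, ae_neg_iff.mpr (ae_smul Complex.I x), ae_zero]
    with p h1 h2 h3 h4 h5
  rw [h4, h3, h1, map_mul, Complex.conj_I] at h2
  have h6 : Complex.I * (starRingEnd ℂ) (x p) = 0 := by linear_combination h2 / 2
  have h7 : (starRingEnd ℂ) (x p) = 0 := by simpa using h6
  rw [h5, ← Complex.conj_conj (x p), h7, map_zero]

/-- The parts are `f = (x + s)/2` and `g = -i (x - s)/2`. Thus the Tomita operator of the hermitian
vectors is the reflection with its maximal domain. -/
theorem isReflection_iff {x s : ModelSpace} : IsReflection x s ↔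
    ∃ f g, IsHermitian f ∧ IsHermitian g ∧ x = f + Complex.I • g ∧ s = f - Complex.I • g := by
  constructor
  · intro h
    refine ⟨(1 / 2 : ℂ) • (x + s), (-Complex.I / 2) • (x - s), ?_, ?_, ?_, ?_⟩
    · filter_upwards [h, ae_neg_iff.mpr h, ae_smul (1 / 2 : ℂ) (x + s), ae_add x s,
        ae_neg_iff.mpr (ae_smul (1 / 2 : ℂ) (x + s)), ae_neg_iff.mpr (ae_add x s)]
        with p h1 h2 h3 h4 h5 h6
      rw [h5, h6, h2, h3, h4, h1, neg_neg]
      simp [add_comm, map_ofNat]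
    · filter_upwards [h, ae_neg_iff.mpr h, ae_smul (-Complex.I / 2) (x - s), ae_sub x s,
        ae_neg_iff.mpr (ae_smul (-Complex.I / 2) (x - s)), ae_neg_iff.mpr (ae_sub x s)]
        with p h1 h2 h3 h4 h5 h6
      rw [h5, h6, h2, h3, h4, h1, neg_neg]
      simp [map_ofNat]
      ring
    · rw [smul_smul, show Complex.I * (-Complex.I / 2) = 1 / 2 by
        linear_combination (-1 / 2 : ℂ) * Complex.I_sq]
      module
    · rw [smul_smul, show Complex.I * (-Complex.I / 2) = 1 / 2 by
        linear_combination (-1 / 2 : ℂ) * Complex.I_sq]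
      module
  · rintro ⟨f, g, hf, hg, rfl, rfl⟩
    filter_upwards [hf, hg, ae_sub f (Complex.I • g), ae_smul Complex.I g,
      ae_neg_iff.mpr (ae_add f (Complex.I • g)), ae_neg_iff.mpr (ae_smul Complex.I g)]
      with p h1 h2 h3 h4 h5 h6
    rw [h3, h4, h5, h6, h1, h2]
    simp
    ring

theorem IsHermitian.isReflection {x : ModelSpace} (hx : IsHermitian x) : IsReflection x x := by
  filter_upwards [hx] with p h1
  rw [h1, Complex.conj_conj]

/-- The adjoint of the reflection. -/
theorem isReflection_adjoint_iff {y z : ModelSpace} :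
    (∀ x s, IsReflection x s → ⟪z, x⟫_ℂ = ⟪s, y⟫_ℂ) ↔
      ∀ᵐ p, z p = ((Real.exp (-(2 * Real.pi * p)) : ℝ) : ℂ) * (starRingEnd ℂ) (y (-p)) := by
  constructor
  · intro h
    -- It suffices to test on real test functions, which the reflection fixes; both pairings are
    -- then linear in the same transform, and totality equates their coefficients.
    have key : (fun p => (modelDensity p : ℂ) * (starRingEnd ℂ) (z p) -
        (modelDensity (-p) : ℂ) * y (-p)) =ᵐ[volume] 0 := by
      refine ae_eq_zero_of_forall_testFunction (fun ψ hψ => ?_) (fun ψ hψ => ?_) <;>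
      obtain ⟨m, hm⟩ := hψ.exists_modelRep
      · refine ((hm.integrable_left z).sub (hm.integrable_right y)).congr (ae_of_all _ fun p => ?_)
        rw [Pi.sub_apply, ← mul_sub]
      · simp only [mul_sub]
        rw [integral_sub (hm.integrable_left z) (hm.integrable_right y), ← hm.inner_eq_left,
          ← hm.inner_eq, h m m hm.isHermitian.isReflection, sub_self]
    filter_upwards [key, ae_ne_zero] with p hp h0
    rw [Pi.zero_apply, modelDensity_neg, Complex.ofReal_mul] at hp
    have hρ : (modelDensity p : ℂ) ≠ 0 := Complex.ofReal_ne_zero.mpr (modelDensity_pos h0).ne'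
    have h1 : (starRingEnd ℂ) (z p) = ((Real.exp (-(2 * Real.pi * p)) : ℝ) : ℂ) * y (-p) := by
      apply mul_left_cancel₀ hρ
      linear_combination hp
    rw [← Complex.conj_conj (z p), h1, map_mul, Complex.conj_ofReal]
  · intro h x s hs
    rw [inner_eq, inner_eq, ← integral_neg_eq_self]
    refine integral_congr_ae ?_
    filter_upwards [ae_neg_iff.mpr h, hs] with p h1 h2
    rw [h1, h2, map_mul, Complex.conj_conj, Complex.conj_conj, Complex.conj_ofReal, neg_neg]
    have h3 := modelDensity_neg (-p)
    rw [neg_neg] at h3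
    rw [h3]
    push_cast
    ring

theorem eq_zero_of_forall_rep_inner {x : ModelSpace}
    (h : ∀ ψ m, IsTestFunction ψ → Rep ψ m → ⟪m, x⟫_ℂ = 0) : x = 0 := by
  have key : (fun p => (modelDensity (-p) : ℂ) * x (-p)) =ᵐ[volume] 0 := by
    refine ae_eq_zero_of_forall_testFunction (fun ψ hψ => ?_) (fun ψ hψ => ?_) <;>
    obtain ⟨m, hm⟩ := hψ.exists_modelRep
    · exact hm.integrable_right x
    · rw [← hm.inner_eq, h ψ m hψ hm]
  refine ext_ae ?_
  filter_upwards [ae_neg_iff.mpr key, ae_ne_zero, ae_zero] with p h1 h2 h3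
  have hρ : (modelDensity p : ℂ) ≠ 0 := Complex.ofReal_ne_zero.mpr (modelDensity_pos h2).ne'
  rw [h3]
  simpa [hρ] using h1

/-- Real density of the test functions in the hermitian vectors. Twice the real part pairs the
transform with `ρ(p) conj x(p) + ρ(-p) x(-p)`, which for hermitian `x` is `(ρ(p) + ρ(-p)) conj
x(p)`, with a positive factor. -/
theorem eq_zero_of_forall_rep_re_inner {x : ModelSpace} (hx : IsHermitian x)
    (h : ∀ ψ m, IsTestFunction ψ → Rep ψ m → (⟪m, x⟫_ℂ).re = 0) : x = 0 := by
  have key : (fun p => (modelDensity p : ℂ) * (starRingEnd ℂ) (x p) +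
      (modelDensity (-p) : ℂ) * x (-p)) =ᵐ[volume] 0 := by
    refine ae_eq_zero_of_forall_testFunction (fun ψ hψ => ?_) (fun ψ hψ => ?_) <;>
    obtain ⟨m, hm⟩ := hψ.exists_modelRep
    · refine ((hm.integrable_left x).add (hm.integrable_right x)).congr (ae_of_all _ fun p => ?_)
      rw [Pi.add_apply, ← mul_add]
    · simp only [mul_add]
      rw [integral_add (hm.integrable_left x) (hm.integrable_right x), ← hm.inner_eq_left,
        ← hm.inner_eq, ← inner_conj_symm, add_comm, Complex.add_conj, h ψ m hψ hm]
      simp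
  refine ext_ae ?_
  filter_upwards [key, hx, ae_ne_zero, ae_zero] with p h1 h2 h3 h4
  rw [h2, ← add_mul, Pi.zero_apply, ← Complex.ofReal_add] at h1
  have hρ : ((modelDensity p + modelDensity (-p) : ℝ) : ℂ) ≠ 0 := Complex.ofReal_ne_zero.mpr
    (add_pos (modelDensity_pos h3) (modelDensity_pos (neg_ne_zero.mpr h3))).ne'
  have h7 : (starRingEnd ℂ) (x p) = 0 := (mul_eq_zero.mp h1).resolve_left hρ
  rw [h4, ← Complex.conj_conj (x p), h7, map_zero]

end ModelSpace

/-! ### Real subspaces unitarily equivalent to the spectral model -/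

section Transfer

open ModelSpace

variable {E : Type*} [NormedAddCommGroup E] [InnerProductSpace ℂ E]

section RealOrthogonal

open scoped ClosedSubmodule

theorem exists_mem_forall_re_inner_sub_eq_zero [CompleteSpace E] (L : ClosedSubmodule ℝ E)
    (x : E) : ∃ l ∈ L, ∀ y ∈ L, (⟪y, x - l⟫_ℂ).re = 0 := by
  have : CompleteSpace L.toSubmodule := L.isClosed.completeSpace_coe
  refine ⟨L.toSubmodule.starProjection x, Submodule.starProjection_apply_mem _ x, fun y hy => ?_⟩
  exact (Submodule.mem_orthogonal _ _).mp
    (Submodule.sub_starProjection_mem_orthogonal (K := L.toSubmodule) x) y hy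

end RealOrthogonal

theorem mem_localSubspace {R : (ℝ → ℝ) → E → Prop} {I : Set ℝ} {φ : ℝ → ℝ} {v : E}
    (hφ : IsTestFunction φ) (hs : tsupport φ ⊆ I) (hv : R φ v) : v ∈ localSubspace R I :=
  subset_closure (Submodule.subset_span ⟨φ, hφ.1, hφ.2, hs, hv⟩)

theorem localSubspace_subset {R : (ℝ → ℝ) → E → Prop} {I : Set ℝ} {L : ClosedSubmodule ℝ E}
    (h : ∀ φ v, IsTestFunction φ → tsupport φ ⊆ I → R φ v → v ∈ L) : localSubspace R I ≤ L := by
  refine Submodule.closure_le.mpr (Submodule.span_le.mpr ?_)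
  rintro v ⟨φ, h1, h2, h3, h4⟩
  exact h φ v ⟨h1, h2⟩ h3 h4

variable (e : ModelSpace ≃ₗᵢ[ℂ] E)

/-- The closed real subspace of the vectors that correspond to hermitian functions. -/
def hermitianSubspace : ClosedSubmodule ℝ E where
  carrier := {x | IsHermitian (e.symm x)}
  add_mem' := fun hx hy => by
    simpa only [mem_ofPred_eq, map_add] using IsHermitian.add hx hy
  zero_mem' := by simpa only [mem_ofPred_eq, map_zero] using isHermitian_zero
  smul_mem' := fun r x hx => by
    have h : (r • x : E) = (r : ℂ) • x := (Complex.coe_smul r x).symm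
    simpa only [mem_ofPred_eq, h, map_smul] using IsHermitian.real_smul hx r
  isClosed' := isClosed_setOf_isHermitian.preimage e.symm.continuous

theorem mem_hermitianSubspace {x : E} : x ∈ hermitianSubspace e ↔ IsHermitian (e.symm x) := Iff.rfl

/-- A hermitian vector minus its real-orthogonal projection to the local subspace is hermitian and
real-orthogonal to all test functions of the model, so it is zero. -/
theorem localSubspace_eq_hermitianSubspace [CompleteSpace E] {R : (ℝ → ℝ) → E → Prop} {I : Set ℝ}
    (h1 : ∀ φ v, IsTestFunction φ → tsupport φ ⊆ I → R φ v → IsHermitian (e.symm v))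
    (h2 : ∀ ψ m, IsTestFunction ψ → Rep ψ m →
      ∃ φ, IsTestFunction φ ∧ tsupport φ ⊆ I ∧ R φ (e m)) :
    localSubspace R I = hermitianSubspace e := by
  have hle : localSubspace R I ≤ hermitianSubspace e := localSubspace_subset h1
  refine le_antisymm hle fun x hx => ?_
  obtain ⟨l, hl, hperp⟩ := exists_mem_forall_re_inner_sub_eq_zero (localSubspace R I) x
  have h0 : e.symm (x - l) = 0 := by
    refine eq_zero_of_forall_rep_re_inner ?_ fun ψ m hψ hm => ?_
    · rw [map_sub]
      exact IsHermitian.sub hx (hle hl)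
    · obtain ⟨φ, hφ, hs, hR⟩ := h2 ψ m hψ hm
      rw [← hperp _ (mem_localSubspace hφ hs hR), ← e.inner_map_map, e.apply_symm_apply]
  have h3 : x - l = 0 := (map_eq_zero_iff _ e.symm.injective).mp h0
  rw [sub_eq_zero.mp h3]
  exact hl

theorem mem_mulI_iff {L : ClosedSubmodule ℝ E} {x : E} : x ∈ L.mulI ↔ Complex.I • x ∈ L := by
  rw [ClosedSubmodule.mem_mapEquiv_iff]
  have h4 : (scalarSMulCLE E Complex.UnitI).symm x = -(Complex.I • x) := by
    rw [scalarSMulCLE_symm_apply, Units.smul_def]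
    simp
  rw [h4]
  exact L.toSubmodule.neg_mem_iff

theorem hermitianSubspace_inf_mulI :
    hermitianSubspace e ⊓ (hermitianSubspace e).mulI = ⊥ := by
  refine le_bot_iff.mp fun x hx => ?_
  have h1 : IsHermitian (e.symm x) := hx.1
  have h2 : IsHermitian (e.symm (Complex.I • x)) := mem_mulI_iff.mp hx.2
  rw [map_smul] at h2
  exact (map_eq_zero_iff _ e.symm.injective).mp (eq_zero_of_isHermitian_I_smul h1 h2)

/-- Cyclicity by duality: a vector symplectically orthogonal to both `m` and `i m` has zero complex
inner product with `m`, so totality makes the symplectic complement trivial, and the double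
complement is the whole space. -/
theorem hermitianSubspace_sup_mulI [CompleteSpace E] :
    hermitianSubspace e ⊔ (hermitianSubspace e).mulI = ⊤ := by
  have h : (hermitianSubspace e ⊔ (hermitianSubspace e).mulI).symplComp = ⊥ := by
    rw [ClosedSubmodule.symplComp_sup]
    refine le_bot_iff.mp fun x hx => ?_
    refine (map_eq_zero_iff _ e.symm.injective).mp (eq_zero_of_forall_rep_inner fun ψ m _ hm => ?_)
    have hm' : e m ∈ hermitianSubspace e := by
      rw [mem_hermitianSubspace, e.symm_apply_apply]
      exact hm.isHermitian
    have h1 := ClosedSubmodule.mem_symplComp_iff.mp hx.1 _ hm'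
    have h2 := ClosedSubmodule.mem_symplComp_iff.mp hx.2 (-(Complex.I • e m)) (mem_mulI_iff.mpr (by
      rw [smul_neg, smul_smul, Complex.I_mul_I]
      simpa using hm'))
    rw [← e.inner_map_map, e.apply_symm_apply]
    rw [inner_neg_left, inner_smul_left] at h2
    apply Complex.ext
    · simpa using h2
    · exact h1
  rw [← ClosedSubmodule.symplComp_symplComp_eq
    (S := hermitianSubspace e ⊔ (hermitianSubspace e).mulI), h]
  refine top_le_iff.mp fun x _ => ClosedSubmodule.mem_symplComp_iff.mpr fun y hy => ?_
  rw [show y = 0 from hy, inner_zero_left, Complex.zero_im]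

/-- The standard subspace of the vectors that correspond to hermitian functions. -/
def hermitianStandardSubspace [CompleteSpace E] : StandardSubspace E where
  toClosedSubmodule := hermitianSubspace e
  IsSeparating := hermitianSubspace_inf_mulI e
  IsCyclic := hermitianSubspace_sup_mulI e

theorem cuttingProjector_apply {H : StandardSubspace E} (hH : H.IsFactorial) {κ w : E}
    (hw : w ∈ H.toClosedSubmodule) (hκ : κ - w ∈ H.toClosedSubmodule.symplComp) :
    ∃ hk : κ ∈ (H.cuttingProjector hH).domain, H.cuttingProjector hH ⟨κ, hk⟩ = w := by
  have hsum : w + (κ - w) = κ := by abel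
  have hk : κ ∈ (H.cuttingProjector hH).domain := by
    refine Submodule.mem_sup.mpr ⟨w, hw, κ - w, hκ, hsum⟩
  refine ⟨hk, ?_⟩
  have := LinearPMap.sup_apply
    (f := ⟨H.toClosedSubmodule.toSubmodule, H.toClosedSubmodule.toSubmodule.subtype⟩)
    (g := ⟨H.toClosedSubmodule.symplComp.toSubmodule, 0⟩) (by
      rintro ⟨x, hx⟩ ⟨y, hy⟩ hxy
      obtain rfl : x = y := hxy
      have h0 : x ∈ H.toClosedSubmodule ⊓ H.toClosedSubmodule.symplComp := ⟨hx, hy⟩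
      rw [hH] at h0
      have h1 : x = 0 := by simpa using h0
      subst h1
      rfl) ⟨w, hw⟩ ⟨κ - w, hκ⟩ ⟨κ, hk⟩ hsum
  refine this.trans ?_
  change w + 0 = w
  exact add_zero w

variable [CompleteSpace E]

theorem isFactorial_hermitianStandardSubspace : (hermitianStandardSubspace e).IsFactorial := by
  refine le_bot_iff.mp fun x hx => ?_
  refine (map_eq_zero_iff _ e.symm.injective).mp
    (eq_zero_of_forall_isHermitian_im_inner hx.1 fun y hy => ?_)
  have hm' : e y ∈ hermitianSubspace e := by
    rw [mem_hermitianSubspace, e.symm_apply_apply]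
    exact hy
  rw [← e.inner_map_map, e.apply_symm_apply]
  exact ClosedSubmodule.mem_symplComp_iff.mp hx.2 _ hm'

theorem tomitaGraph_iff {x s : E} : (hermitianStandardSubspace e).TomitaGraph x s ↔
    IsReflection (e.symm x) (e.symm s) := by
  rw [isReflection_iff]
  constructor
  · rintro ⟨f, hf, g, hg, rfl, rfl⟩
    exact ⟨e.symm f, e.symm g, hf, hg, by simp, by simp⟩
  · rintro ⟨f, g, hf, hg, h1, h2⟩
    refine ⟨e f, ?_, e g, ?_, ?_, ?_⟩
    · change IsHermitian (e.symm (e f))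
      rwa [e.symm_apply_apply]
    · change IsHermitian (e.symm (e g))
      rwa [e.symm_apply_apply]
    · rw [← map_smul, ← map_add, ← h1, e.apply_symm_apply]
    · rw [← map_smul, ← map_sub, ← h2, e.apply_symm_apply]

theorem tomitaAdjointGraph_iff {y z : E} : (hermitianStandardSubspace e).TomitaAdjointGraph y z ↔
    ∀ᵐ p, e.symm z p =
      ((Real.exp (-(2 * Real.pi * p)) : ℝ) : ℂ) * (starRingEnd ℂ) (e.symm y (-p)) := by
  rw [← isReflection_adjoint_iff]
  constructor
  · intro h x s hs
    have := h (e x) (e s) ((tomitaGraph_iff e).mpr (by simpa using hs))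
    rw [← e.inner_map_map, ← e.inner_map_map, e.apply_symm_apply, e.apply_symm_apply, this]
  · intro h x s hs
    have := h _ _ ((tomitaGraph_iff e).mp hs)
    rwa [e.symm.inner_map_map, e.symm.inner_map_map] at this

theorem modularOperatorGraph_iff {x y : E} :
    (hermitianStandardSubspace e).ModularOperatorGraph x y ↔
      ∀ᵐ p, e.symm y p = ((Real.exp (-(2 * Real.pi * p)) : ℝ) : ℂ) * e.symm x p := by
  constructor
  · rintro ⟨s, h1, h2⟩
    filter_upwards [ae_neg_iff.mpr ((tomitaGraph_iff e).mp h1), (tomitaAdjointGraph_iff e).mp h2]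
      with p h3 h4
    rw [h4, h3, neg_neg, Complex.conj_conj]
  · intro h
    obtain ⟨s, hs⟩ := exists_isReflection h
    refine ⟨e s, (tomitaGraph_iff e).mpr (by simpa using hs), (tomitaAdjointGraph_iff e).mpr ?_⟩
    filter_upwards [h, ae_neg_iff.mpr hs] with p h1 h2
    rw [h1, e.symm_apply_apply, h2, neg_neg, Complex.conj_conj]

theorem isModularGroup_hermitianStandardSubspace : (hermitianStandardSubspace e).IsModularGroup
    fun u => (e.symm.trans (modularUnitary u)).trans e where
  map_add s t x := by simp [modularUnitary_add]
  continuous_apply x := e.continuous.comp (continuous_modularUnitary (e.symm x))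
  modularOperatorGraph_iff x y := by
    rw [modularOperatorGraph_iff, strip_iff]
    constructor
    · rintro ⟨F, hF, hu, hI⟩
      refine ⟨fun z => e (F z), e.toContinuousLinearEquiv.toContinuousLinearMap.differentiable
        |>.comp_diffContOnCl hF, fun u => ?_, ?_⟩
      · simp [hu]
      · simp [hI]
    · rintro ⟨F, hF, hu, hI⟩
      refine ⟨fun z => e.symm (F z),
        e.symm.toContinuousLinearEquiv.toContinuousLinearMap.differentiable
        |>.comp_diffContOnCl hF, fun u => ?_, ?_⟩
      · simp [hu]
      · simp [hI]

theorem modularHamiltonianGraph_hermitianStandardSubspace {v κ : E}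
    (h : ∀ᵐ p : ℝ, e.symm κ p = 2 * Real.pi * Complex.I * p * e.symm v p) :
    (hermitianStandardSubspace e).ModularHamiltonianGraph v (-(Complex.I • κ)) := by
  refine ⟨_, isModularGroup_hermitianStandardSubspace e, ?_⟩
  rw [hasDerivAt_iff_tendsto_slope, smul_neg, smul_smul, Complex.I_mul_I, neg_smul, one_smul,
    neg_neg]
  have h1 := (e.continuous.tendsto _).comp (tendsto_modularUnitary_slope h)
  rw [map_neg, e.apply_symm_apply] at h1
  refine h1.congr fun u => ?_
  have h0 : modularUnitary 0 (e.symm v) = e.symm v := mulPhase_zero _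
  rw [slope_def_module, sub_zero, ← Complex.coe_smul, Complex.ofReal_inv, Function.comp_apply]
  simp [h0]

/-- A local subspace that is unitarily equivalent to the spectral model is standard and factorial,
and its modular Hamiltonian and its cutting projector are those of the model. -/
theorem exists_standardSubspace_of_model {L : ClosedSubmodule ℝ E} (hL : L = hermitianSubspace e)
    {v κ w : E} (hκ : ∀ᵐ p : ℝ, e.symm κ p = 2 * Real.pi * Complex.I * p * e.symm v p)
    (hw : w ∈ L) (hc : κ - w ∈ L.symplComp) :
    ∃ H : StandardSubspace E, H.toClosedSubmodule = L ∧ ∃ hH : H.IsFactorial, ∃ k : E,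
      H.ModularHamiltonianGraph v k ∧ Complex.I • k = κ ∧
      ∃ hk : Complex.I • k ∈ (H.cuttingProjector hH).domain,
        H.cuttingProjector hH ⟨Complex.I • k, hk⟩ = w := by
  subst hL
  have hI : Complex.I • (-(Complex.I • κ)) = κ := by
    rw [smul_neg, smul_smul, Complex.I_mul_I, neg_smul, one_smul, neg_neg]
  refine ⟨hermitianStandardSubspace e, rfl, isFactorial_hermitianStandardSubspace e,
    -(Complex.I • κ), modularHamiltonianGraph_hermitianStandardSubspace e hκ, hI, ?_⟩
  rw [hI]
  exact cuttingProjector_apply _ hw hc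

end Transfer

/-! ### Unitaries from total families with the same Gram matrix -/

section Gram

variable {ι E F : Type*} [NormedAddCommGroup E] [InnerProductSpace ℂ E] [CompleteSpace E]
  [NormedAddCommGroup F] [InnerProductSpace ℂ F] [CompleteSpace F]

theorem denseRange_linearCombination {v : ι → E} (hv : ∀ x, (∀ i, ⟪v i, x⟫_ℂ = 0) → x = 0) :
    DenseRange (Finsupp.linearCombination ℂ v) := by
  have h1 : (Submodule.span ℂ (range v)).topologicalClosure = ⊤ := by
    rw [Submodule.topologicalClosure_eq_top_iff, eq_bot_iff]
    intro x hx
    refine hv x fun i => ?_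
    exact (Submodule.mem_orthogonal _ _).mp hx _ (Submodule.subset_span (mem_range_self i))
  have h2 := (Submodule.dense_iff_topologicalClosure_eq_top).mpr h1
  rw [← Finsupp.range_linearCombination] at h2
  exact h2

/-- The Gram matrix determines the norms of all finite combinations, so matching coefficients
defines an isometry between dense subspaces, which extends by continuity. -/
theorem exists_linearIsometryEquiv {v : ι → E} {w : ι → F}
    (h : ∀ i j, ⟪v i, v j⟫_ℂ = ⟪w i, w j⟫_ℂ) (hv : ∀ x, (∀ i, ⟪v i, x⟫_ℂ = 0) → x = 0)
    (hw : ∀ x, (∀ i, ⟪w i, x⟫_ℂ = 0) → x = 0) : ∃ e : E ≃ₗᵢ[ℂ] F, ∀ i, e (v i) = w i := by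
  have hin : ∀ c d : ι →₀ ℂ, ⟪Finsupp.linearCombination ℂ w c, Finsupp.linearCombination ℂ w d⟫_ℂ =
      ⟪Finsupp.linearCombination ℂ v c, Finsupp.linearCombination ℂ v d⟫_ℂ := by
    intro c d
    induction c using Finsupp.induction_linear with
    | zero => simp
    | add c c' h1 h2 => simp only [map_add, inner_add_left, h1, h2]
    | single i a =>
      induction d using Finsupp.induction_linear with
      | zero => simp
      | add d d' h1 h2 => simp only [map_add, inner_add_right, h1, h2]
      | single j b => simp [h]
  have hn : ∀ c : ι →₀ ℂ, ‖Finsupp.linearCombination ℂ w (LinearEquiv.refl ℂ (ι →₀ ℂ) c)‖ =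
      ‖Finsupp.linearCombination ℂ v c‖ := fun c => by
    rw [norm_eq_sqrt_re_inner (𝕜 := ℂ), norm_eq_sqrt_re_inner (𝕜 := ℂ)]
    exact congrArg (fun z : ℂ => Real.sqrt (RCLike.re z)) (hin c c)
  refine ⟨LinearEquiv.extendOfIsometry (LinearEquiv.refl ℂ (ι →₀ ℂ)) (Finsupp.linearCombination ℂ v)
    (Finsupp.linearCombination ℂ w) (denseRange_linearCombination hv)
    (denseRange_linearCombination hw) hn, fun i => ?_⟩
  have := LinearEquiv.extendOfIsometry_eq (LinearEquiv.refl ℂ (ι →₀ ℂ))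
    (Finsupp.linearCombination ℂ v)
    (Finsupp.linearCombination ℂ w) (denseRange_linearCombination hv)
    (denseRange_linearCombination hw) hn (Finsupp.single i 1)
  simpa using this

end Gram

/-! ### Spaces whose norm is the thermal norm -/

/-- The relation `R` represents functions on the line as vectors of a complex Hilbert space whose
norm is the thermal norm at inverse temperature `β` and whose symplectic form is `∫ f g'`. -/
structure IsThermalRep {E : Type*} [NormedAddCommGroup E] [InnerProductSpace ℂ E] (β : ℝ)
    (R : (ℝ → ℝ) → E → Prop) : Prop where
  add : ∀ {f g v w}, R f v → R g w → R (fun x => f x + g x) (v + w)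
  sub : ∀ {f g v w}, R f v → R g w → R (fun x => f x - g x) (v - w)
  norm_sq_eq : ∀ {f v}, R f v →
    ‖v‖ ^ 2 = (∫⁻ p, ENNReal.ofReal (‖lineFourier f p‖ ^ 2) ∂(thermalMeasure β)).toReal
  im_inner_eq : ∀ {f g v w}, R f v → MemLp f 2 → R g w → IsTestFunction g →
    (⟪v, w⟫_ℂ).im = ∫ x, f x * deriv g x
  exists_of_lt_top : ∀ {f}, Integrable f →
    ∫⁻ p, ENNReal.ofReal (‖lineFourier f p‖ ^ 2) ∂(thermalMeasure β) < ⊤ → ∃ v, R f v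
  total : ∀ x : E, (∀ f v, IsTestFunction f → R f v → ⟪v, x⟫_ℂ = 0) → x = 0

/-- Functions supported in the interval `(a, b)` which are in `L¹ ∩ L²` both on the interval and
in the coordinate `intervalParam`. -/
structure IsIntervalFunction (a b c : ℝ) (f : ℝ → ℝ) : Prop where
  measurable : Measurable f
  zero_off : ∀ x ∉ Ioo a b, f x = 0
  integrable : Integrable f
  memLp : MemLp f 2
  integrable_param : Integrable fun s => f (intervalParam a b c s)
  memLp_param : MemLp (fun s => f (intervalParam a b c s)) 2

namespace IsIntervalFunction

variable {a b c : ℝ} {f g : ℝ → ℝ}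

theorem add (hf : IsIntervalFunction a b c f) (hg : IsIntervalFunction a b c g) :
    IsIntervalFunction a b c fun x => f x + g x where
  measurable := hf.measurable.add hg.measurable
  zero_off x hx := by rw [hf.zero_off x hx, hg.zero_off x hx, add_zero]
  integrable := hf.integrable.add hg.integrable
  memLp := hf.memLp.add hg.memLp
  integrable_param := hf.integrable_param.add hg.integrable_param
  memLp_param := hf.memLp_param.add hg.memLp_param

theorem sub (hf : IsIntervalFunction a b c f) (hg : IsIntervalFunction a b c g) :
    IsIntervalFunction a b c fun x => f x - g x where
  measurable := hf.measurable.sub hg.measurable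
  zero_off x hx := by rw [hf.zero_off x hx, hg.zero_off x hx, sub_zero]
  integrable := hf.integrable.sub hg.integrable
  memLp := hf.memLp.sub hg.memLp
  integrable_param := hf.integrable_param.sub hg.integrable_param
  memLp_param := hf.memLp_param.sub hg.memLp_param

end IsIntervalFunction

theorem IsTestFunction.isIntervalFunction {a b c : ℝ} (hc : 0 < c) {φ : ℝ → ℝ}
    (hφ : IsTestFunction φ) (hs : tsupport φ ⊆ Ioo a b) : IsIntervalFunction a b c φ where
  measurable := hφ.continuous.measurable
  zero_off := eq_zero_of_tsupport_subset hs
  integrable := hφ.integrable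
  memLp := hφ.memLp
  integrable_param := (hφ.comp_intervalParam hc hs).integrable
  memLp_param := (hφ.comp_intervalParam hc hs).memLp

/-- The symplectic form `∫ f dφ` integrates a one-form, so it does not depend on an
orientation-preserving choice of coordinate. -/
theorem integral_mul_deriv_comp_intervalParam {a b c : ℝ} (hab : a < b) (hc : 0 < c)
    {f φ : ℝ → ℝ} (h0 : ∀ x ∉ Ioo a b, f x = 0) (hφ : Differentiable ℝ φ) :
    ∫ s, f (intervalParam a b c s) * deriv (fun s => φ (intervalParam a b c s)) s =
      ∫ x, f x * deriv φ x := by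
  have h1 := integral_image_eq_integral_abs_deriv_smul (s := univ) (f := intervalParam a b c)
    (f' := fun s => c * ((intervalParam a b c s - a) * (b - intervalParam a b c s) / (b - a)))
    MeasurableSet.univ (fun s _ => (hasDerivAt_intervalParam hab c s).hasDerivWithinAt)
    (intervalParam_injective hab hc).injOn (fun x => f x * deriv φ x)
  rw [image_univ, range_intervalParam hab hc, setIntegral_eq_integral_of_forall_compl_eq_zero
    (fun x hx => by rw [h0 x hx, zero_mul]), Measure.restrict_univ] at h1
  rw [h1]
  refine integral_congr_ae (ae_of_all _ fun s => ?_)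
  have h2 : deriv (fun s => φ (intervalParam a b c s)) s = deriv φ (intervalParam a b c s) *
      (c * ((intervalParam a b c s - a) * (b - intervalParam a b c s) / (b - a))) :=
    ((hφ _).hasDerivAt.comp s (hasDerivAt_intervalParam hab c s)).deriv
  simp only [smul_eq_mul]
  rw [h2, abs_of_pos (intervalParam_deriv_pos hab hc s)]
  ring

/-- The Reeh–Schlieder property. The vector and its weight are extended by zero to negative momenta,
where the one-sided support makes totality on an interval applicable. -/
theorem VacuumRep.total {a b : ℝ} (hab : a < b) (x : VacuumSpace)
    (h : ∀ φ v, IsTestFunction φ → tsupport φ ⊆ Ioo a b → VacuumRep φ v → ⟪v, x⟫_ℂ = 0) :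
    x = 0 := by
  set h' : ℝ → ℂ := (Ioi 0).indicator fun p => ((p / Real.pi : ℝ) : ℂ) * (starRingEnd ℂ) (x p)
    with hh'
  have hcongr : ∀ {φ : ℝ → ℝ} {v : VacuumSpace}, VacuumRep φ v →
      ∀ᵐ p ∂(volume.restrict (Ioi (0 : ℝ))), ((p / Real.pi : ℝ) : ℂ) * ⟪x p, v p⟫_ℂ =
        lineFourier φ p * (((p / Real.pi : ℝ) : ℂ) * (starRingEnd ℂ) (x p)) := fun hv => by
    refine (ae_restrict_iff' measurableSet_Ioi).mpr ?_
    filter_upwards [ae_vacuumMeasure_iff.mp hv.2] with p hp h0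
    rw [hp h0, RCLike.inner_apply]
    ring
  have hind : ∀ φ : ℝ → ℝ, (fun p => lineFourier φ p * h' p) = (Ioi 0).indicator fun p =>
      lineFourier φ p * (((p / Real.pi : ℝ) : ℂ) * (starRingEnd ℂ) (x p)) := fun φ => by
    funext p
    by_cases hp : p ∈ Ioi (0 : ℝ) <;> simp [hh', hp]
  have key : h' =ᵐ[volume] 0 := by
    refine ae_eq_zero_of_forall_testFunction_Ioo
      (fun p hp => indicator_of_notMem (notMem_Ioi.mpr hp) _) hab (fun φ hφ hs => ?_)
      (fun φ hφ hs => ?_) <;> obtain ⟨v, hv⟩ := hφ.exists_vacuumRep <;> rw [hind]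
    · rw [integrable_indicator_iff measurableSet_Ioi]
      have h1 := (integrable_withDensity_iff_integrable_smul' (by fun_prop)
        (ae_of_all _ fun p => ENNReal.ofReal_lt_top)).mp (L2.integrable_inner (𝕜 := ℂ) x v)
      refine Integrable.congr h1 ?_
      filter_upwards [hcongr hv, ae_restrict_mem measurableSet_Ioi] with p hp h0
      have : 0 ≤ p / Real.pi := div_nonneg (le_of_lt h0) Real.pi_pos.le
      rw [← hp, ENNReal.toReal_ofReal this, Complex.real_smul]
    · have h1 := h φ v hφ hs hv
      rw [integral_indicator measurableSet_Ioi, ← integral_congr_ae (hcongr hv),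
        ← integral_vacuumMeasure, ← L2.inner_def, ← inner_conj_symm, h1, map_zero]
  refine Lp.ext ?_
  refine ae_vacuumMeasure_iff.mpr ?_
  filter_upwards [key, ae_vacuumMeasure_iff.mp (Lp.coeFn_zero ℂ 2 vacuumMeasure)] with p hp h1 h0
  have hp0 : ((p / Real.pi : ℝ) : ℂ) ≠ 0 :=
    Complex.ofReal_ne_zero.mpr (div_pos h0 Real.pi_pos).ne'
  rw [hh', indicator_of_mem (mem_Ioi.mpr h0), Pi.zero_apply] at hp
  rw [h1 h0, Pi.zero_apply, ← Complex.conj_conj (x p), (mul_eq_zero.mp hp).resolve_left hp0, map_zero]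

/-! ### The unitary between an interval in the vacuum and the thermal line -/

section Unitary

variable {E : Type*} [NormedAddCommGroup E] [InnerProductSpace ℂ E] {β : ℝ}
  {R : (ℝ → ℝ) → E → Prop}

/-- Sums and differences have equal norms by conformal covariance, and the symplectic forms agree by
invariance. Only `φ` has to be smooth, which leaves room for truncated functions in the other slot.
-/
theorem IsThermalRep.inner_eq_vacuum (hR : IsThermalRep β R) (hβ : 0 < β) {a b : ℝ} (hab : a < b)
    {f φ : ℝ → ℝ} {v w : E} {v' w' : VacuumSpace}
    (hf : IsIntervalFunction a b (2 * Real.pi / β) f) (hφ : IsTestFunction φ)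
    (hs : tsupport φ ⊆ Ioo a b) (hv : R (fun s => f (intervalParam a b (2 * Real.pi / β) s)) v)
    (hw : R (fun s => φ (intervalParam a b (2 * Real.pi / β) s)) w) (hv' : VacuumRep f v')
    (hw' : VacuumRep φ w') : ⟪v, w⟫_ℂ = ⟪v', w'⟫_ℂ := by
  have hc : 0 < 2 * Real.pi / β := by positivity
  have hφI := hφ.isIntervalFunction hc hs
  have hnorm : ∀ {g : ℝ → ℝ} {u : E} {u' : VacuumSpace},
      IsIntervalFunction a b (2 * Real.pi / β) g →
      R (fun s => g (intervalParam a b (2 * Real.pi / β) s)) u → VacuumRep g u' →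
      ‖u‖ ^ 2 = ‖u'‖ ^ 2 := fun hg hu hu' => by
    rw [hR.norm_sq_eq hu, hu'.norm_sq_eq, lintegral_vacuum_eq_thermal hab hβ hg.measurable
      hg.zero_off hg.integrable hg.memLp hg.integrable_param hg.memLp_param]
  refine inner_eq_of_norm_eq (hnorm (hf.add hφI) (hR.add hv hw) (hv'.add hw'))
    (hnorm (hf.sub hφI) (hR.sub hv hw) (hv'.sub hw')) ?_
  rw [hR.im_inner_eq hv hf.memLp_param hw (hφ.comp_intervalParam hc hs),
    hv'.im_inner_eq hf.memLp hw' hφ,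
    integral_mul_deriv_comp_intervalParam hab hc hf.zero_off hφ.differentiable]

theorem IsThermalRep.exists_of_test (hR : IsThermalRep β R) (hβ : 0 < β) {ψ : ℝ → ℝ}
    (hψ : IsTestFunction ψ) : ∃ v, R ψ v :=
  hR.exists_of_lt_top hψ.integrable (hψ.lintegral_thermal_lt_top hβ)

/-- The conformal equivalence of the interval `(a, b)` and the thermal line. -/
theorem IsThermalRep.exists_unitary [CompleteSpace E] (hR : IsThermalRep β R) (hβ : 0 < β)
    {a b : ℝ} (hab : a < b) : ∃ e : E ≃ₗᵢ[ℂ] VacuumSpace, ∀ f v v',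
      IsIntervalFunction a b (2 * Real.pi / β) f →
      R (fun s => f (intervalParam a b (2 * Real.pi / β) s)) v → VacuumRep f v' → e v = v' := by
  have hc : 0 < 2 * Real.pi / β := by positivity
  let ι := {φ : ℝ → ℝ // IsTestFunction φ ∧ tsupport φ ⊆ Ioo a b}
  choose w hw using fun i : ι => i.2.1.exists_vacuumRep
  choose v hv using fun i : ι => hR.exists_of_test hβ (i.2.1.comp_intervalParam hc i.2.2)
  have hvR : ∀ {f u}, IsTestFunction f → R f u → ∀ x, (∀ i, ⟪v i, x⟫_ℂ = 0) → ⟪u, x⟫_ℂ = 0 := by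
    intro f u hf hu x hx
    have hφ := hf.intervalPush hab hc
    have h0 := hx ⟨_, hφ, hf.tsupport_intervalPush hab hc⟩
    have h1 := hv ⟨_, hφ, hf.tsupport_intervalPush hab hc⟩
    simp only [intervalPush_param hab hc] at h1
    -- The relation `R` is not assumed single-valued. Two vectors of the same function differ by a
    -- vector of the zero function, whose norm is zero.
    have h2 : v ⟨_, hφ, hf.tsupport_intervalPush hab hc⟩ = u := by
      have h3 := hR.norm_sq_eq (hR.sub h1 hu)
      have h4 : lineFourier (fun x => f x - f x) = 0 := by
        funext p
        simp [lineFourier]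
      rw [h4] at h3
      simpa [sub_eq_zero] using h3
    rw [← h2, h0]
  obtain ⟨e, he⟩ := exists_linearIsometryEquiv (v := v) (w := w)
    (fun i j => hR.inner_eq_vacuum hβ hab (i.2.1.isIntervalFunction hc i.2.2) j.2.1 j.2.2 (hv i)
      (hv j) (hw i) (hw j))
    (fun x hx => hR.total x fun f u hf hu => hvR hf hu x hx)
    (fun x hx => VacuumRep.total hab x fun φ u hφ hs hu => by
      rw [VacuumRep.unique hu (hw ⟨φ, hφ, hs⟩), hx])
  -- The unitary is built from test functions only. For a rougher `f` the images are compared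
  -- weakly, through inner products with test functions in the interval.
  refine ⟨e, fun f u u' hf hu hu' => ?_⟩
  rw [← sub_eq_zero]
  refine VacuumRep.total hab _ fun φ y hφ hs hy => ?_
  rw [inner_sub_right, sub_eq_zero, VacuumRep.unique hy (hw ⟨φ, hφ, hs⟩)]
  nth_rw 1 [← he]
  rw [e.inner_map_map, ← inner_conj_symm, ← inner_conj_symm (w _),
    hR.inner_eq_vacuum hβ hab hf hφ hs hu (hv ⟨φ, hφ, hs⟩) hu' (hw ⟨φ, hφ, hs⟩)]

end Unitary

theorem ModelSpace.isThermalRep : IsThermalRep (2 * Real.pi) ModelSpace.Rep where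
  add := Rep.add
  sub := Rep.sub
  norm_sq_eq := Rep.norm_sq_eq
  im_inner_eq := Rep.im_inner_eq
  exists_of_lt_top := exists_rep_of_lintegral_lt_top
  total _ h := eq_zero_of_forall_rep_inner h

/-! ### Infinitesimal conformal invariance of the vacuum -/

theorem tendsto_lineFourier_atTop {f : ℝ → ℝ} (hf : IsTestFunction f) :
    Tendsto (lineFourier f) atTop (𝓝 0) := by
  obtain ⟨C, hC, h⟩ := exists_norm_lineFourier_le hf
  refine squeeze_zero_norm h ?_
  refine Tendsto.div_atTop tendsto_const_nhds ?_
  refine (tendsto_pow_atTop two_ne_zero).comp ?_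
  exact tendsto_atTop_add_const_left _ _ (tendsto_pow_atTop two_ne_zero)

theorem id_mul_lineFourier {f : ℝ → ℝ} (hf : IsTestFunction f) (p : ℝ) :
    p * lineFourier f p = Complex.I * lineFourier (deriv f) p := by
  rw [lineFourier_deriv hf]
  linear_combination (p * lineFourier f p) * Complex.I_sq

/-- In momentum space the integrand is a total derivative. The boundary term at infinity vanishes by
decay. At zero it vanishes because, for fields of degree at most two, each of its products contains
the transform of `φ'` or of `f'`, and these are zero at `p = 0`. -/
theorem integral_Ioi_quadratic_field {φ f : ℝ → ℝ} (hφ : IsTestFunction φ) (hf : IsTestFunction f)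
    {Xφ Xf : ℝ → ℝ} {α β γ : ℝ} (hXφ : Xφ = fun x => (α + β * x + γ * x ^ 2) * deriv φ x)
    (hXf : Xf = fun x => (α + β * x + γ * x ^ 2) * deriv f x) :
    ∫ p in Ioi (0 : ℝ), ((starRingEnd ℂ) (lineFourier Xφ p) * lineFourier f p * p +
      (starRingEnd ℂ) (lineFourier φ p) * lineFourier Xf p * p) = 0 := by
  have hφ0 := hφ.deriv
  have hφ1 := hφ0.mul_left (contDiff_id (𝕜 := ℝ))
  have hφ2 := hφ1.mul_left (contDiff_id (𝕜 := ℝ))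
  have hf0 := hf.deriv
  have hf1 := hf0.mul_left (contDiff_id (𝕜 := ℝ))
  have hf2 := hf1.mul_left (contDiff_id (𝕜 := ℝ))
  simp only [id_eq] at hφ1 hφ2 hf1 hf2
  have hX : ∀ {g : ℝ → ℝ}, IsTestFunction (deriv g) → IsTestFunction (fun x => x * deriv g x) →
      IsTestFunction (fun x => x * (x * deriv g x)) → ∀ p,
      lineFourier (fun x => (α + β * x + γ * x ^ 2) * deriv g x) p = α * lineFourier (deriv g) p +
        β * lineFourier (fun x => x * deriv g x) p +
        γ * lineFourier (fun x => x * (x * deriv g x)) p := fun {g} h0 h1 h2 p => by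
    rw [← lineFourier_const_mul, ← lineFourier_const_mul, ← lineFourier_const_mul,
      ← lineFourier_add (h0.const_mul α).integrable (h1.const_mul β).integrable,
      ← lineFourier_add ((h0.const_mul α).add (h1.const_mul β)).integrable
        (h2.const_mul γ).integrable]
    congr 1
    funext x
    ring
  set F0 := lineFourier (deriv φ)
  set F1 := lineFourier fun x => x * deriv φ x
  set F2 := lineFourier fun x => x * (x * deriv φ x)
  set G0 := lineFourier (deriv f)
  set G1 := lineFourier fun x => x * deriv f x
  set G2 := lineFourier fun x => x * (x * deriv f x)
  have dF0 : ∀ p, HasDerivAt F0 (Complex.I * F1 p) p := hasDerivAt_lineFourier hφ0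
  have dF1 : ∀ p, HasDerivAt F1 (Complex.I * F2 p) p := hasDerivAt_lineFourier hφ1
  have dG0 : ∀ p, HasDerivAt G0 (Complex.I * G1 p) p := hasDerivAt_lineFourier hf0
  have dG1 : ∀ p, HasDerivAt G1 (Complex.I * G2 p) p := hasDerivAt_lineFourier hf1
  have hF00 : F0 0 = 0 := by simp [F0, lineFourier_deriv hφ]
  have hG00 : G0 0 = 0 := by simp [G0, lineFourier_deriv hf]
  have conj_deriv : ∀ {F : ℝ → ℂ} {F' : ℂ} {p : ℝ}, HasDerivAt F (Complex.I * F') p →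
      HasDerivAt (fun p => (starRingEnd ℂ) (F p)) (-(Complex.I * (starRingEnd ℂ) F')) p := by
    intro F F' p h
    have := h.star
    simpa using this
  -- The primitive: in the derivative of the `γ` part the products of `F1` and `G1` cancel. The
  -- translation part `α` needs no primitive, since it cancels pointwise.
  set P : ℝ → ℂ := fun p => -(β * ((starRingEnd ℂ) (F0 p) * G0 p)) -
    γ * ((starRingEnd ℂ) (F1 p) * G0 p + (starRingEnd ℂ) (F0 p) * G1 p) with hP
  have dP : ∀ p, HasDerivAt P (Complex.I * (β * ((starRingEnd ℂ) (F1 p) * G0 p -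
      (starRingEnd ℂ) (F0 p) * G1 p) + γ * ((starRingEnd ℂ) (F2 p) * G0 p -
      (starRingEnd ℂ) (F0 p) * G2 p))) p := by
    intro p
    have h1 := (conj_deriv (dF0 p)).mul (dG0 p)
    have h2 := (conj_deriv (dF1 p)).mul (dG0 p)
    have h3 := (conj_deriv (dF0 p)).mul (dG1 p)
    refine (((h1.const_mul (β : ℂ)).neg).sub ((h2.add h3).const_mul (γ : ℂ))).congr_deriv ?_
    ring
  have hint : ∀ {u v : ℝ → ℝ}, IsTestFunction u → IsTestFunction v →
      IntegrableOn (fun p => (starRingEnd ℂ) (lineFourier u p) * lineFourier v p) (Ioi 0) :=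
    fun hu hv => (integrable_conj_lineFourier_mul hu.integrable hu.memLp hv.integrable
      hv.memLp).integrableOn
  have htend : ∀ {u v : ℝ → ℝ}, IsTestFunction u → IsTestFunction v →
      Tendsto (fun p => (starRingEnd ℂ) (lineFourier u p) * lineFourier v p) atTop (𝓝 0) :=
    fun hu hv => by
      have h1 := ((Complex.continuous_conj.tendsto _).comp (tendsto_lineFourier_atTop hu)).mul
        (tendsto_lineFourier_atTop hv)
      simpa using h1
  have hPt : Tendsto P atTop (𝓝 (-(β * 0) - γ * (0 + 0))) :=
    (((htend hφ0 hf0).const_mul _).neg).sub (((htend hφ1 hf0).add (htend hφ0 hf1)).const_mul _)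
  have key := integral_Ioi_of_hasDerivAt_of_tendsto' (a := 0) (fun p _ => dP p)
    (((((hint hφ1 hf0).sub (hint hφ0 hf1)).const_mul _).add
      (((hint hφ2 hf0).sub (hint hφ0 hf2)).const_mul _)).const_mul _) hPt
  have hP0 : P 0 = 0 := by simp [hP, hF00, hG00]
  rw [hP0] at key
  simp only [mul_zero, neg_zero, add_zero, sub_zero] at key
  rw [← key]
  refine integral_congr_ae (ae_of_all _ fun p => ?_)
  have e1 : (p : ℂ) * (starRingEnd ℂ) (lineFourier φ p) =
      -(Complex.I * (starRingEnd ℂ) (F0 p)) := by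
    have := congrArg (starRingEnd ℂ) (id_mul_lineFourier hφ p)
    simpa using this
  have e2 := id_mul_lineFourier hf p
  simp only [hXφ, hXf]
  rw [hX hφ0 hφ1 hφ2, hX hf0 hf1 hf2]
  simp only [map_add, map_mul, Complex.conj_ofReal]
  linear_combination (α * (starRingEnd ℂ) (F0 p) + β * (starRingEnd ℂ) (F1 p) +
    γ * (starRingEnd ℂ) (F2 p)) * e2 + (α * G0 p + β * G1 p + γ * G2 p) * e1

theorem vacuumIK_eq_quadratic (a b : ℝ) (f : ℝ → ℝ) : vacuumIK a b f = fun x =>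
    (2 * Real.pi / (b - a) * (a * b) + (-(2 * Real.pi / (b - a) * (a + b))) * x +
      2 * Real.pi / (b - a) * x ^ 2) * deriv f x := by
  funext x
  rw [vacuumIK]
  ring

theorem IsTestFunction.vacuumIK {f : ℝ → ℝ} (hf : IsTestFunction f) (a b : ℝ) :
    IsTestFunction (vacuumIK a b f) := by
  rw [vacuumIK_eq_quadratic]
  exact hf.deriv.mul_left (by fun_prop)

theorem VacuumRep.inner_vacuumIK {a b : ℝ} {φ f : ℝ → ℝ} {u u' v v' : VacuumSpace}
    (hφ : IsTestFunction φ) (hf : IsTestFunction f) (hu : VacuumRep φ u)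
    (hu' : VacuumRep (vacuumIK a b φ) u') (hv : VacuumRep f v)
    (hv' : VacuumRep (vacuumIK a b f) v') : ⟪u', v⟫_ℂ = -⟪u, v'⟫_ℂ := by
  rw [eq_neg_iff_add_eq_zero, hu'.inner_eq hv, hu.inner_eq hv', ← mul_add, ← integral_add,
    integral_Ioi_quadratic_field hφ hf (vacuumIK_eq_quadratic a b φ) (vacuumIK_eq_quadratic a b f),
    mul_zero]
  · have h := hφ.vacuumIK a b
    exact (integrable_conj_lineFourier_mul_id h.integrable h.memLp hf).integrableOn
  · exact (integrable_conj_lineFourier_mul_id hφ.integrable hφ.memLp (hf.vacuumIK a b)).integrableOn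

/-! ### Truncation -/

theorem lineFourier_indicator_deriv {a b : ℝ} (hab : a < b) {h : ℝ → ℝ} (hh : IsTestFunction h)
    (ha : h a = 0) (hb : h b = 0) (p : ℝ) : lineFourier ((Ioo a b).indicator (deriv h)) p =
      -Complex.I * p * lineFourier ((Ioo a b).indicator h) p := by
  have hset : ∀ g : ℝ → ℝ, lineFourier ((Ioo a b).indicator g) p =
      ∫ x in a..b, Complex.exp (Complex.I * (p * x : ℝ)) * (g x : ℂ) := fun g => by
    rw [intervalIntegral.integral_of_le hab.le, integral_Ioc_eq_integral_Ioo,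
      ← integral_indicator measurableSet_Ioo, lineFourier]
    refine integral_congr_ae (ae_of_all _ fun x => ?_)
    by_cases hx : x ∈ Ioo a b <;> simp [hx]
  have hexp : ∀ x : ℝ, HasDerivAt (fun x : ℝ => Complex.exp (Complex.I * (p * x : ℝ)))
      (Complex.I * p * Complex.exp (Complex.I * (p * x : ℝ))) x := fun x => by
    have h1 : HasDerivAt (fun x : ℝ => Complex.I * ((p * x : ℝ) : ℂ)) (Complex.I * p) x := by
      have := ((hasDerivAt_id x).const_mul p).ofReal_comp.const_mul Complex.I
      simpa using this
    simpa [mul_comm] using h1.cexp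
  have hI := intervalIntegral.integral_mul_deriv_eq_deriv_mul (a := a) (b := b)
    (u := fun x : ℝ => Complex.exp (Complex.I * (p * x : ℝ)))
    (v := fun x : ℝ => (h x : ℂ)) (v' := fun x => ((deriv h x : ℝ) : ℂ))
    (fun x _ => hexp x) (fun x _ => (hh.differentiable x).hasDerivAt.ofReal_comp)
    (Continuous.intervalIntegrable (by fun_prop) _ _)
    ((Complex.continuous_ofReal.comp hh.deriv.continuous).intervalIntegrable _ _)
  rw [hset, hset, hI, ha, hb, ← intervalIntegral.integral_const_mul]
  simp only [Complex.ofReal_zero, mul_zero, sub_self, zero_sub]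
  rw [← intervalIntegral.integral_neg]
  exact intervalIntegral.integral_congr fun x _ => by ring

theorem exists_vacuumRep_indicator {a b : ℝ} (hab : a < b) {h : ℝ → ℝ} (hh : IsTestFunction h)
    (ha : h a = 0) (hb : h b = 0) : ∃ w, VacuumRep ((Ioo a b).indicator h) w :=
  exists_vacuumRep_of_weakDeriv (hh.integrable.indicator measurableSet_Ioo)
    (hh.memLp.indicator measurableSet_Ioo) (hh.deriv.integrable.indicator measurableSet_Ioo)
    (hh.deriv.memLp.indicator measurableSet_Ioo) (lineFourier_indicator_deriv hab hh ha hb)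

theorem integrable_comp_intervalParam_mul {a b c : ℝ} (hab : a < b) (hc : 0 < c) {g : ℝ → ℝ}
    (hg : IsTestFunction g) : Integrable fun s => g (intervalParam a b c s) *
      (c * ((intervalParam a b c s - a) * (b - intervalParam a b c s) / (b - a))) := by
  have h1 := (integrableOn_image_iff_integrableOn_abs_deriv_smul MeasurableSet.univ
    (fun s _ => (hasDerivAt_intervalParam hab c s).hasDerivWithinAt)
    (intervalParam_injective hab hc).injOn g).mp hg.integrable.integrableOn
  rw [integrableOn_univ] at h1
  refine h1.congr (ae_of_all _ fun s => ?_)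
  simp only [smul_eq_mul]
  rw [abs_of_pos (intervalParam_deriv_pos hab hc s), mul_comm]

/-- The modular weight is the Jacobian of the logistic map up to a constant, so integrability of the
field in the coordinate is integrability of `f'` on the interval. Boundedness then gives square
integrability. -/
theorem isIntervalFunction_indicator_vacuumIK {a b c : ℝ} (hab : a < b) (hc : 0 < c) {f : ℝ → ℝ}
    (hf : IsTestFunction f) : IsIntervalFunction a b c ((Ioo a b).indicator (vacuumIK a b f)) := by
  have hh := hf.vacuumIK a b
  have heq : (fun s => (Ioo a b).indicator (vacuumIK a b f) (intervalParam a b c s)) =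
      fun s => vacuumIK a b f (intervalParam a b c s) :=
    funext fun s => indicator_of_mem (intervalParam_mem hab c s) _
  have hint : Integrable fun s => vacuumIK a b f (intervalParam a b c s) := by
    refine ((integrable_comp_intervalParam_mul hab hc hf.deriv).const_mul
      (-(2 * Real.pi / c))).congr (ae_of_all _ fun s => ?_)
    simp only [vacuumIK]
    field_simp
  obtain ⟨C, hC⟩ := hh.hasCompactSupport.exists_bound_of_continuous hh.continuous
  refine ⟨hh.continuous.measurable.indicator measurableSet_Ioo,
    fun x hx => indicator_of_notMem hx _, hh.integrable.indicator measurableSet_Ioo,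
    hh.memLp.indicator measurableSet_Ioo, heq ▸ hint, ?_⟩
  rw [heq, memLp_two_iff_integrable_sq hint.aestronglyMeasurable]
  simp only [sq]
  exact hint.bdd_mul hint.aestronglyMeasurable (ae_of_all _ fun s => hC _)

/-! ### The local subspaces -/

section Local

variable {E : Type*} [NormedAddCommGroup E] [InnerProductSpace ℂ E]

theorem IsThermalRep.exists_of_vacuumRep {β : ℝ} {R : (ℝ → ℝ) → E → Prop} (hR : IsThermalRep β R)
    (hβ : 0 < β) {a b : ℝ} (hab : a < b) {f : ℝ → ℝ} {w : VacuumSpace}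
    (hf : IsIntervalFunction a b (2 * Real.pi / β) f) (hw : VacuumRep f w) :
    ∃ v, R (fun s => f (intervalParam a b (2 * Real.pi / β) s)) v := by
  refine hR.exists_of_lt_top hf.integrable_param ?_
  rw [← lintegral_vacuum_eq_thermal hab hβ hf.measurable hf.zero_off hf.integrable hf.memLp
    hf.integrable_param hf.memLp_param]
  exact (MemLp.ae_eq hw.2 (Lp.memLp w)).lintegral_norm_sq_lt_top

/-- The vectors that are symplectically orthogonal to a given one. -/
def symplOrthogonal (x : E) : ClosedSubmodule ℝ E where
  carrier := {y | (⟪x, y⟫_ℂ).im = 0}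
  add_mem' := fun {y z} hy hz => by
    simp only [mem_ofPred_eq, inner_add_right, Complex.add_im] at *
    rw [hy, hz, add_zero]
  zero_mem' := by simp
  smul_mem' := fun r y hy => by
    have h : (r • y : E) = (r : ℂ) • y := (Complex.coe_smul r y).symm
    simp only [mem_ofPred_eq, h, inner_smul_right, Complex.im_ofReal_mul] at *
    rw [hy, mul_zero]
  isClosed' := isClosed_eq (Complex.continuous_im.comp (by fun_prop)) continuous_const

/-- The symplectic form is local: `κ - w` is a function that vanishes on the interval, and the
derivative of a test function supported there vanishes off it. -/
theorem sub_mem_symplComp_localSubspace {R : (ℝ → ℝ) → E → Prop}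
    (hsub : ∀ {f g v w}, R f v → R g w → R (fun x => f x - g x) (v - w))
    (him : ∀ {f g v w}, R f v → MemLp f 2 → R g w → IsTestFunction g →
      (⟪v, w⟫_ℂ).im = ∫ x, f x * deriv g x) {a b : ℝ} {h : ℝ → ℝ} {κ w : E} (hκ : R h κ)
    (hw : R ((Ioo a b).indicator h) w) (hh : MemLp h 2) :
    κ - w ∈ (localSubspace R (Ioo a b)).symplComp := by
  have hle : localSubspace R (Ioo a b) ≤ symplOrthogonal (κ - w) := by
    refine localSubspace_subset fun φ v hφ hs hv => ?_
    change (⟪κ - w, v⟫_ℂ).im = 0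
    rw [him (hsub hκ hw) (hh.sub (hh.indicator measurableSet_Ioo)) hv hφ]
    refine integral_eq_zero_of_ae (ae_of_all _ fun x => ?_)
    by_cases hx : x ∈ Ioo a b
    · simp [hx]
    · have h0 : deriv φ x = 0 :=
        image_eq_zero_of_notMem_tsupport fun h' => hx (hs (tsupport_deriv_subset h'))
      simp [h0]
  refine ClosedSubmodule.mem_symplComp_iff.mpr fun y hy => ?_
  have h1 : (⟪κ - w, y⟫_ℂ).im = 0 := hle hy
  rw [← inner_conj_symm, Complex.conj_im, h1, neg_zero]

end Local

/-- A unitary between the spectral model and the vacuum space that implements the conformal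
equivalence of the interval `(a, b)` and the line. -/
def IsConformalUnitary (a b : ℝ) (e : ModelSpace ≃ₗᵢ[ℂ] VacuumSpace) : Prop :=
  ∀ f v v', IsIntervalFunction a b 1 f → ModelSpace.Rep (fun s => f (intervalParam a b 1 s)) v →
    VacuumRep f v' → e v = v'

theorem two_pi_div_two_pi : 2 * Real.pi / (2 * Real.pi) = 1 := div_self (by positivity)

theorem exists_isConformalUnitary {a b : ℝ} (hab : a < b) : ∃ e, IsConformalUnitary a b e := by
  have := ModelSpace.isThermalRep.exists_unitary Real.two_pi_pos hab
  rwa [two_pi_div_two_pi] at this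

namespace IsConformalUnitary

variable {a b : ℝ} {e : ModelSpace ≃ₗᵢ[ℂ] VacuumSpace}

theorem isHermitian_symm (he : IsConformalUnitary a b e) (hab : a < b) {f : ℝ → ℝ}
    {w : VacuumSpace} (hf : IsIntervalFunction a b 1 f) (hw : VacuumRep f w) :
    ModelSpace.IsHermitian (e.symm w) := by
  obtain ⟨m, hm⟩ := ModelSpace.isThermalRep.exists_of_vacuumRep Real.two_pi_pos hab (w := w)
    (by rwa [two_pi_div_two_pi]) hw
  rw [two_pi_div_two_pi] at hm
  rw [← he f m w hf hm hw, e.symm_apply_apply]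
  exact hm.isHermitian

theorem exists_vacuumRep_apply (he : IsConformalUnitary a b e) (hab : a < b) {ψ : ℝ → ℝ}
    {m : ModelSpace} (hψ : IsTestFunction ψ) (hm : ModelSpace.Rep ψ m) :
    VacuumRep (intervalPush a b 1 ψ) (e m) := by
  have hφ := hψ.intervalPush hab one_pos
  have hs := hψ.tsupport_intervalPush hab one_pos
  obtain ⟨v, hv⟩ := hφ.exists_vacuumRep
  rw [he _ m v (hφ.isIntervalFunction one_pos hs) ?_ hv]
  · exact hv
  · simpa only [intervalPush_param hab one_pos] using hm

theorem localSubspace_eq (he : IsConformalUnitary a b e) (hab : a < b) :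
    localSubspace VacuumRep (Ioo a b) = hermitianSubspace e :=
  localSubspace_eq_hermitianSubspace e
    (fun _ _ hφ hs hv => he.isHermitian_symm hab (hφ.isIntervalFunction one_pos hs) hv)
    fun _ _ hψ hm => ⟨_, hψ.intervalPush hab one_pos, hψ.tsupport_intervalPush hab one_pos,
      he.exists_vacuumRep_apply hab hψ hm⟩

/-- The generator of the modular group. -/
theorem symm_vacuumIK (he : IsConformalUnitary a b e) (hab : a < b) {f : ℝ → ℝ}
    {v κ : VacuumSpace} (hf : IsTestFunction f) (hv : VacuumRep f v)
    (hκ : VacuumRep (vacuumIK a b f) κ) :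
    ∀ᵐ p : ℝ, e.symm κ p = 2 * Real.pi * Complex.I * p * e.symm v p := by
  -- Since `f` may live outside the interval, only the inner products of `e.symm v` and `e.symm κ`
  -- with transported test functions are accessible. Antisymmetry of the field relates them, and it
  -- acts on `ψ` explicitly.
  have hgen : ∀ ψ, IsTestFunction ψ → ∃ m m', ModelSpace.Rep ψ m ∧
      ModelSpace.Rep (fun s => -(2 * Real.pi) * deriv ψ s) m' ∧
      ⟪m', e.symm v⟫_ℂ + ⟪m, e.symm κ⟫_ℂ = 0 := by
    intro ψ hψ
    obtain ⟨m, hm⟩ := hψ.exists_modelRep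
    obtain ⟨m', hm'⟩ := (hψ.deriv.const_mul (-(2 * Real.pi))).exists_modelRep
    have hφ := hψ.intervalPush hab one_pos
    have hs := hψ.tsupport_intervalPush hab one_pos
    have hu := he.exists_vacuumRep_apply hab hψ hm
    have hu' := he.exists_vacuumRep_apply hab (hψ.deriv.const_mul (-(2 * Real.pi))) hm'
    -- At scale `c = 1` the weight `(x - a)(b - x)/(b - a)` is `dx/ds`, so the modular field is `-2π
    -- d/ds` in the logistic coordinate.
    have heq : intervalPush a b 1 (fun s => -(2 * Real.pi) * deriv ψ s) =
        vacuumIK a b (intervalPush a b 1 ψ) := by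
      funext x
      by_cases hx : x ∈ Ioo a b
      · rw [← intervalParam_coord one_pos hx, intervalPush_param hab one_pos]
        set s := intervalCoord a b 1 x
        have h1 := (hφ.differentiable (intervalParam a b 1 s)).hasDerivAt.comp s
          (hasDerivAt_intervalParam hab 1 s)
        have h2 : intervalPush a b 1 ψ ∘ intervalParam a b 1 = ψ :=
          funext fun s => intervalPush_param hab one_pos ψ s
        rw [h2] at h1
        rw [h1.deriv, vacuumIK]
        ring
      · have h0 : deriv (intervalPush a b 1 ψ) x = 0 :=
          image_eq_zero_of_notMem_tsupport fun h' => hx (hs (tsupport_deriv_subset h'))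
        rw [intervalPush_of_notMem _ hx, vacuumIK, h0, mul_zero, neg_zero]
    rw [heq] at hu'
    refine ⟨m, m', hm, hm', ?_⟩
    rw [← e.inner_map_map, ← e.inner_map_map m, e.apply_symm_apply, e.apply_symm_apply,
      VacuumRep.inner_vacuumIK hφ hf hu hu' hv hκ, neg_add_cancel]
  have hFT : ∀ {ψ : ℝ → ℝ}, IsTestFunction ψ → ∀ p, lineFourier
      (fun s => -(2 * Real.pi) * deriv ψ s) p = 2 * Real.pi * Complex.I * p * lineFourier ψ p := by
    intro ψ hψ p
    rw [lineFourier_const_mul, lineFourier_deriv hψ]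
    push_cast
    ring
  have hsum : ∀ {ψ : ℝ → ℝ}, IsTestFunction ψ → ∀ p : ℝ,
      lineFourier (fun s => -(2 * Real.pi) * deriv ψ s) p *
        ((modelDensity (-p) : ℂ) * e.symm v (-p)) +
        lineFourier ψ p * ((modelDensity (-p) : ℂ) * e.symm κ (-p)) =
      lineFourier ψ p * ((modelDensity (-p) : ℂ) *
        (2 * Real.pi * Complex.I * p * e.symm v (-p) + e.symm κ (-p))) := by
    intro ψ hψ p
    rw [hFT hψ]
    ring
  have key : (fun p : ℝ => (modelDensity (-p) : ℂ) *
      (2 * Real.pi * Complex.I * p * e.symm v (-p) + e.symm κ (-p))) =ᵐ[volume] 0 := by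
    refine ae_eq_zero_of_forall_testFunction (fun ψ hψ => ?_) (fun ψ hψ => ?_) <;>
    obtain ⟨m, m', hm, hm', h0⟩ := hgen ψ hψ
    · exact ((hm'.integrable_right (e.symm v)).add (hm.integrable_right (e.symm κ))).congr
        (ae_of_all _ (hsum hψ))
    · rw [hm'.inner_eq, hm.inner_eq, ← integral_add (hm'.integrable_right (e.symm v))
        (hm.integrable_right (e.symm κ))] at h0
      rw [← h0]
      exact integral_congr_ae (ae_of_all _ fun p => (hsum hψ p).symm)
  filter_upwards [ae_neg_iff.mpr key, ae_ne_zero] with p hp h0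
  rw [neg_neg, Pi.zero_apply] at hp
  have hρ : (modelDensity p : ℂ) ≠ 0 := Complex.ofReal_ne_zero.mpr (modelDensity_pos h0).ne'
  have h1 := (mul_eq_zero.mp hp).resolve_left hρ
  push_cast at h1
  linear_combination h1

end IsConformalUnitary

theorem vacuumIK_left (a b : ℝ) (f : ℝ → ℝ) : vacuumIK a b f a = 0 := by simp [vacuumIK]

theorem vacuumIK_right (a b : ℝ) (f : ℝ → ℝ) : vacuumIK a b f b = 0 := by simp [vacuumIK]

/-- The modular Hamiltonian and the cutting projector of an interval in the vacuum. -/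
theorem vacuum_modularHamiltonian_cuttingProjector {a b : ℝ} (hab : a < b) {f : ℝ → ℝ}
    (hf : IsTestFunction f) : ∃ H : StandardSubspace VacuumSpace,
      H.toClosedSubmodule = localSubspace VacuumRep (Ioo a b) ∧
      ∃ hH : H.IsFactorial, ∃ v k w : VacuumSpace,
        VacuumRep f v ∧
        H.ModularHamiltonianGraph v k ∧
        VacuumRep (vacuumIK a b f) (Complex.I • k) ∧
        VacuumRep ((Ioo a b).indicator (vacuumIK a b f)) w ∧
        ∃ hk : Complex.I • k ∈ (H.cuttingProjector hH).domain,
          H.cuttingProjector hH ⟨Complex.I • k, hk⟩ = w := by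
  obtain ⟨e, he⟩ := exists_isConformalUnitary hab
  obtain ⟨v, hv⟩ := hf.exists_vacuumRep
  obtain ⟨κ, hκ⟩ := (hf.vacuumIK a b).exists_vacuumRep
  obtain ⟨w, hw⟩ := exists_vacuumRep_indicator hab (hf.vacuumIK a b) (vacuumIK_left a b f)
    (vacuumIK_right a b f)
  have hL := he.localSubspace_eq hab
  obtain ⟨H, h1, hH, k, h2, h3, hk⟩ := exists_standardSubspace_of_model e hL
    (he.symm_vacuumIK hab hf hv hκ) (w := w)
    (hL ▸ he.isHermitian_symm hab (isIntervalFunction_indicator_vacuumIK hab one_pos hf) hw)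
    (sub_mem_symplComp_localSubspace VacuumRep.sub VacuumRep.im_inner_eq hκ hw
      (hf.vacuumIK a b).memLp)
  exact ⟨H, h1, hH, v, k, w, hv, h2, h3 ▸ hκ, hw, hk⟩

/-! ### The purified thermal space -/

section Thermal

variable {β : ℝ}

theorem measurable_thermalDensity (β : ℝ) : Measurable fun p : ℝ => ENNReal.ofReal
    (p * (Real.cosh (β * p / 2) / Real.sinh (β * p / 2)) / Real.pi) := by fun_prop

theorem thermalDensity_pos (hβ : 0 < β) {p : ℝ} (hp : 0 < p) :
    0 < p * (Real.cosh (β * p / 2) / Real.sinh (β * p / 2)) / Real.pi := by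
  have h1 := sinh_pos_of_thermal hβ hp
  have h2 := Real.cosh_pos (β * p / 2)
  positivity

theorem ae_thermalMeasure_iff (hβ : 0 < β) {P : ℝ → Prop} :
    (∀ᵐ p ∂(thermalMeasure β), P p) ↔ ∀ᵐ p, 0 < p → P p := by
  rw [thermalMeasure, ae_withDensity_iff (measurable_thermalDensity β),
    ae_restrict_iff' measurableSet_Ioi]
  refine ⟨fun h => ?_, fun h => ?_⟩
  · filter_upwards [h] with p hp h0
    refine hp h0 ?_
    simpa using thermalDensity_pos hβ h0
  · filter_upwards [h] with p hp h0 _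
    exact hp h0

theorem integral_thermalMeasure (hβ : 0 < β) {G : Type*} [NormedAddCommGroup G] [NormedSpace ℝ G]
    (F : ℝ → G) : ∫ p, F p ∂(thermalMeasure β) = ∫ p in Ioi (0 : ℝ),
      (p * (Real.cosh (β * p / 2) / Real.sinh (β * p / 2)) / Real.pi) • F p := by
  rw [thermalMeasure, integral_withDensity_eq_integral_toReal_smul (measurable_thermalDensity β)
    (ae_of_all _ fun p => ENNReal.ofReal_lt_top)]
  refine setIntegral_congr_fun measurableSet_Ioi fun p hp => ?_
  simp only [ENNReal.toReal_ofReal (thermalDensity_pos hβ hp).le]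

theorem ThermalRep.add {f g : ℝ → ℝ} {v w : ThermalSpace β} (hv : ThermalRep β f v)
    (hw : ThermalRep β g w) : ThermalRep β (fun x => f x + g x) (v + w) := by
  refine ⟨hv.1.add hw.1, ?_, ?_⟩
  · filter_upwards [hv.2.1, hw.2.1, Lp.coeFn_add v.val.fst w.val.fst] with p h1 h2 h3
    rw [lineFourier_add hv.1 hw.1, ← h1, ← h2]
    exact h3
  · change v.val.snd + w.val.snd = 0
    rw [hv.2.2, hw.2.2, add_zero]

theorem ThermalRep.sub {f g : ℝ → ℝ} {v w : ThermalSpace β} (hv : ThermalRep β f v)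
    (hw : ThermalRep β g w) : ThermalRep β (fun x => f x - g x) (v - w) := by
  refine ⟨hv.1.sub hw.1, ?_, ?_⟩
  · filter_upwards [hv.2.1, hw.2.1, Lp.coeFn_sub v.val.fst w.val.fst] with p h1 h2 h3
    rw [lineFourier_sub hv.1 hw.1, ← h1, ← h2]
    exact h3
  · change v.val.snd - w.val.snd = 0
    rw [hv.2.2, hw.2.2, sub_zero]

theorem ThermalRep.norm_sq_eq {f : ℝ → ℝ} {v : ThermalSpace β} (hv : ThermalRep β f v) :
    ‖v‖ ^ 2 = (∫⁻ p, ENNReal.ofReal (‖lineFourier f p‖ ^ 2) ∂(thermalMeasure β)).toReal := by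
  rw [← norm_sq_eq_toReal_lintegral hv.2.1]
  have h1 : ‖v‖ ^ 2 = ‖v.val.fst‖ ^ 2 + ‖v.val.snd‖ ^ 2 := WithLp.prod_norm_sq_eq_of_L2 v.val
  rw [h1, hv.2.2, norm_zero]
  ring

theorem exists_thermalRep_of_lintegral_lt_top {f : ℝ → ℝ} (hf : Integrable f)
    (h : ∫⁻ p, ENNReal.ofReal (‖lineFourier f p‖ ^ 2) ∂(thermalMeasure β) < ⊤) :
    ∃ v, ThermalRep β f v := by
  have hm := memLp_two_of_lintegral_lt_top (continuous_lineFourier hf).aestronglyMeasurable h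
  exact ⟨Complexified.of _ (WithLp.toLp 2 (hm.toLp _, 0)), hf, hm.coeFn_toLp, rfl⟩

/-- A function occupies only the first summand, so both parts of the complex inner product are real
inner products there; the second summand of `x` enters through the off-diagonal entry of the complex
structure. -/
theorem ThermalRep.inner_eq {f : ℝ → ℝ} {v : ThermalSpace β} (hv : ThermalRep β f v)
    (x : ThermalSpace β) : ⟪v, x⟫_ℂ = ⟨⟪v.val.fst, x.val.fst⟫_ℝ,
      ⟪v.val.fst, opD β x.val.fst - opT β x.val.snd⟫_ℝ⟩ := by
  rw [Complexified.inner_def]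
  have h1 : ∀ y : WithLp 2 (ThermalReal β × ThermalReal β),
      ⟪v.val, y⟫_ℝ = ⟪v.val.fst, y.fst⟫_ℝ := fun y => by
    rw [WithLp.prod_inner_apply]
    change ⟪v.val.fst, y.fst⟫_ℝ + ⟪v.val.snd, y.snd⟫_ℝ = _
    rw [hv.2.2, inner_zero_left, add_zero]
  rw [h1, h1]
  congr 2
  change -(-opD β x.val.fst + opT β x.val.snd) = _
  abel

/-- The factor `tanh` in `D` cancels the `coth` of the measure, leaving the vacuum symplectic form.
-/
theorem ThermalRep.im_inner_eq (hβ : 0 < β) {f g : ℝ → ℝ} {v w : ThermalSpace β}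
    (hv : ThermalRep β f v) (hf2 : MemLp f 2) (hw : ThermalRep β g w) (hg : IsTestFunction g) :
    (⟪v, w⟫_ℂ).im = ∫ x, f x * deriv g x := by
  rw [hv.inner_eq]
  change ⟪v.val.fst, opD β w.val.fst - opT β w.val.snd⟫_ℝ = _
  rw [hw.2.2, map_zero, sub_zero, L2.inner_def, integral_thermalMeasure hβ]
  have hI := (integrable_conj_lineFourier_mul_id hv.1 hf2 hg).integrableOn (s := Ioi 0)
  have e2 := integral_im hI
  simp only [RCLike.im_to_complex] at e2
  have him := im_integral_Ioi_conj_lineFourier_mul hv.1 hf2 hg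
  rw [integral_congr_ae (g := fun p : ℝ => Real.pi⁻¹ *
    ((starRingEnd ℂ) (lineFourier f p) * lineFourier g p * p).im), integral_const_mul, e2, him]
  · have := Real.pi_ne_zero
    field_simp
  · refine (ae_restrict_iff' measurableSet_Ioi).mpr ?_
    filter_upwards [(ae_thermalMeasure_iff hβ).mp hv.2.1, (ae_thermalMeasure_iff hβ).mp hw.2.1,
      (ae_thermalMeasure_iff hβ).mp (momentumMul_coeFn _ (memLp_D β) w.val.fst)] with p h1 h2 h3 hp
    have h3' : opD β w.val.fst p = polarC p * (absD β p : ℂ) * w.val.fst p := h3 hp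
    rw [h3', h1 hp, h2 hp]
    have hs := (sinh_pos_of_thermal hβ hp).ne'
    have hc := (Real.cosh_pos (β * p / 2)).ne'
    have ht : Real.cosh (β * p / 2) / Real.sinh (β * p / 2) * absD β p = 1 := by
      rw [absD, Real.tanh_eq_sinh_div_cosh]
      field_simp
    have hin : ⟪lineFourier f p, polarC p * (absD β p : ℂ) * lineFourier g p⟫_ℝ =
        absD β p * ((starRingEnd ℂ) (lineFourier f p) * lineFourier g p).im := by
      simp [Complex.inner, polarC]
      ring
    rw [hin, Complex.im_mul_ofReal, smul_eq_mul]
    linear_combination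
      (p / Real.pi * ((starRingEnd ℂ) (lineFourier f p) * lineFourier g p).im) * ht

/-- Only real parts on the half-line are known to vanish. Extending the weighted conjugate of `y` to
negative momenta by conjugate reflection turns twice the real part into an integral over the line,
where totality of real test functions applies. -/
theorem eq_zero_of_forall_thermal_inner (hβ : 0 < β) {y : ThermalReal β}
    (h : ∀ f (v : ThermalReal β), IsTestFunction f → v =ᵐ[thermalMeasure β] lineFourier f →
      ⟪v, y⟫_ℝ = 0) : y = 0 := by
  set θ : ℝ → ℝ := fun p => p * (Real.cosh (β * p / 2) / Real.sinh (β * p / 2)) / Real.pi with hθ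
  set k : ℝ → ℂ := (Ioi 0).indicator fun p => (θ p : ℂ) * (starRingEnd ℂ) (y p) with hk
  have hex : ∀ f, IsTestFunction f → ∃ v : ThermalReal β, v =ᵐ[thermalMeasure β] lineFourier f :=
    fun f hf => by
      have hm := memLp_two_of_lintegral_lt_top
        (continuous_lineFourier hf.integrable).aestronglyMeasurable (hf.lintegral_thermal_lt_top hβ)
      exact ⟨hm.toLp _, hm.coeFn_toLp⟩
  have hcongr : ∀ {f : ℝ → ℝ} {v : ThermalReal β}, v =ᵐ[thermalMeasure β] lineFourier f →
      ∀ᵐ p ∂(volume.restrict (Ioi (0 : ℝ))), (θ p : ℂ) * ⟪y p, v p⟫_ℂ =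
        lineFourier f p * ((θ p : ℂ) * (starRingEnd ℂ) (y p)) := fun hv => by
    refine (ae_restrict_iff' measurableSet_Ioi).mpr ?_
    filter_upwards [(ae_thermalMeasure_iff hβ).mp hv] with p hp h0
    rw [hp h0, RCLike.inner_apply]
    ring
  have hind : ∀ f : ℝ → ℝ, (fun p => lineFourier f p * k p) = (Ioi 0).indicator fun p =>
      lineFourier f p * ((θ p : ℂ) * (starRingEnd ℂ) (y p)) := fun f => by
    funext p
    by_cases hp : p ∈ Ioi (0 : ℝ) <;> simp [hk, hp]
  have hint : ∀ f, IsTestFunction f → Integrable fun p => lineFourier f p * k p := by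
    intro f hf
    obtain ⟨v, hv⟩ := hex f hf
    rw [hind, integrable_indicator_iff measurableSet_Ioi]
    have h1 := (integrable_withDensity_iff_integrable_smul' (measurable_thermalDensity β)
      (ae_of_all _ fun p => ENNReal.ofReal_lt_top)).mp (L2.integrable_inner (𝕜 := ℂ) y v)
    refine Integrable.congr h1 ?_
    filter_upwards [hcongr hv, ae_restrict_mem measurableSet_Ioi] with p hp h0
    rw [← hp, ENNReal.toReal_ofReal (thermalDensity_pos hβ h0).le, Complex.real_smul]
  have hre : ∀ f, IsTestFunction f → (∫ p, lineFourier f p * k p).re = 0 := by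
    intro f hf
    obtain ⟨v, hv⟩ := hex f hf
    have h1 := h f v hf hv
    rw [real_inner_comm, L2.inner_def] at h1
    have h2 : ∫ p, lineFourier f p * k p = ∫ p, ⟪y p, v p⟫_ℂ ∂(thermalMeasure β) := by
      rw [hind, integral_indicator measurableSet_Ioi, ← integral_congr_ae (hcongr hv),
        integral_thermalMeasure hβ]
      simp only [Complex.real_smul, hθ]
    rw [h2, ← h1]
    exact (integral_re (L2.integrable_inner (𝕜 := ℂ) y v)).symm
  have hneg : ∀ f p, lineFourier f p * (k p + (starRingEnd ℂ) (k (-p))) = lineFourier f p * k p +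
      (starRingEnd ℂ) (lineFourier f (-p) * k (-p)) := by
    intro f p
    rw [map_mul, lineFourier_neg_arg, Complex.conj_conj, mul_add]
  have hintn : ∀ f, IsTestFunction f →
      Integrable fun p => (starRingEnd ℂ) (lineFourier f (-p) * k (-p)) := fun f hf =>
    (RCLike.conjLIE (K := ℂ)).toContinuousLinearEquiv.toContinuousLinearMap.integrable_comp
      (hint f hf).comp_neg
  have key : (fun p => k p + (starRingEnd ℂ) (k (-p))) =ᵐ[volume] 0 := by
    refine ae_eq_zero_of_forall_testFunction (fun f hf => ?_) (fun f hf => ?_)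
    · simp only [hneg]
      exact (hint f hf).add (hintn f hf)
    · simp only [hneg]
      rw [integral_add (hint f hf) (hintn f hf), integral_conj,
        integral_neg_eq_self (fun p => lineFourier f p * k p), Complex.add_conj, hre f hf]
      simp
  refine Lp.ext ((ae_thermalMeasure_iff hβ).mpr ?_)
  filter_upwards [key, (ae_thermalMeasure_iff hβ).mp (Lp.coeFn_zero ℂ 2 (thermalMeasure β))]
    with p hp h1 h0
  have hp0 : (θ p : ℂ) ≠ 0 := Complex.ofReal_ne_zero.mpr (thermalDensity_pos hβ h0).ne'
  have hn : -p ∉ Ioi (0 : ℝ) := by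
    rw [mem_Ioi]
    linarith
  rw [hk, indicator_of_mem (mem_Ioi.mpr h0), indicator_of_notMem hn, map_zero, add_zero,
    Pi.zero_apply] at hp
  rw [h1 h0, Pi.zero_apply, ← Complex.conj_conj (y p), (mul_eq_zero.mp hp).resolve_left hp0,
    map_zero]

/-- Since `|tanh| < 1`, the multiplier has no zeros. This is what lets the first summand alone
generate the purified space over the complex numbers. -/
theorem eq_zero_of_opT_eq_zero {y : ThermalReal β} (h : opT β y = 0) : y = 0 := by
  refine Lp.ext ?_
  have h1 : opT β y =ᵐ[thermalMeasure β] fun p =>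
      polarC p * (Real.sqrt (1 - absD β p ^ 2) : ℂ) * y p := momentumMul_coeFn _ (memLp_T β) y
  rw [h] at h1
  filter_upwards [h1, Lp.coeFn_zero ℂ 2 (thermalMeasure β)] with p h2 h3
  rw [h3, Pi.zero_apply] at h2
  rw [h3, Pi.zero_apply]
  have hs : Real.sqrt (1 - absD β p ^ 2) ≠ 0 := by
    refine (Real.sqrt_pos.mpr ?_).ne'
    have := (sq_lt_one_iff_abs_lt_one _).mpr (Real.abs_tanh_lt_one (β * p / 2))
    rw [absD]
    linarith
  have hc : polarC p * (Real.sqrt (1 - absD β p ^ 2) : ℂ) ≠ 0 :=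
    mul_ne_zero (by simp [polarC]) (Complex.ofReal_ne_zero.mpr hs)
  exact (mul_eq_zero.mp h2.symm).resolve_left hc

/-- The real parts of the pairings kill the first component of `x`; the imaginary parts then kill
the image of the second under `C √(1 + D²)`, which is injective. -/
theorem ThermalRep.total (hβ : 0 < β) (x : ThermalSpace β)
    (h : ∀ f v, IsTestFunction f → ThermalRep β f v → ⟪v, x⟫_ℂ = 0) : x = 0 := by
  have h' : ∀ f (v : ThermalReal β), IsTestFunction f → v =ᵐ[thermalMeasure β] lineFourier f →
      ⟪v, x.val.fst⟫_ℝ = 0 ∧ ⟪v, opD β x.val.fst - opT β x.val.snd⟫_ℝ = 0 := by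
    intro f v hf hv
    have hR : ThermalRep β f (Complexified.of (thermalJ β) (WithLp.toLp 2 (v, 0))) :=
      ⟨hf.integrable, hv, rfl⟩
    have h1 := h f _ hf hR
    rw [hR.inner_eq] at h1
    exact ⟨congrArg Complex.re h1, congrArg Complex.im h1⟩
  have hx1 : x.val.fst = 0 := eq_zero_of_forall_thermal_inner hβ fun f v hf hv => (h' f v hf hv).1
  have hx2 : opD β x.val.fst - opT β x.val.snd = 0 :=
    eq_zero_of_forall_thermal_inner hβ fun f v hf hv => (h' f v hf hv).2
  rw [hx1, map_zero, zero_sub, neg_eq_zero] at hx2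
  apply Complexified.val_inj
  apply WithLp.ofLp_injective
  exact Prod.ext hx1 (eq_zero_of_opT_eq_zero hx2)

theorem isThermalRep_thermalRep (hβ : 0 < β) : IsThermalRep β (ThermalRep β) where
  add := ThermalRep.add
  sub := ThermalRep.sub
  norm_sq_eq := ThermalRep.norm_sq_eq
  im_inner_eq := ThermalRep.im_inner_eq hβ
  exists_of_lt_top := exists_thermalRep_of_lintegral_lt_top
  total := ThermalRep.total hβ

end Thermal

/-! ### The thermal vector fields in the conformal coordinate -/

section ThermalField

variable {β : ℝ}

theorem intervalParam_strictMono {a b c : ℝ} (hab : a < b) (hc : 0 < c) :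
    StrictMono (intervalParam a b c) :=
  strictMono_of_deriv_pos fun s => by
    rw [(hasDerivAt_intervalParam hab c s).deriv]
    exact intervalParam_deriv_pos hab hc s

theorem intervalParam_unit_eq (β s : ℝ) : intervalParam 0 1 (2 * Real.pi / β) s =
    Real.exp (Real.pi / β * s) ^ 2 / (Real.exp (Real.pi / β * s) ^ 2 + 1) := by
  have h := intervalParam_sub_left 0 1 (2 * Real.pi / β) s
  rw [sub_zero, sub_zero] at h
  have h1 : Real.exp (-(2 * Real.pi / β * s)) = (Real.exp (Real.pi / β * s) ^ 2)⁻¹ := by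
    rw [← Real.exp_nat_mul, ← Real.exp_neg]
    congr 1
    push_cast
    ring
  rw [h, h1]
  have := Real.exp_pos (Real.pi / β * s)
  field_simp

/-- The field of the image interval is the thermal field multiplied by the derivative of the
logistic map. With `u = e^{πs/β}` and likewise for the endpoints, the logistic map is `u²/(u² + 1)`
and the claim is rational. -/
theorem intervalParam_unit_field (hβ : 0 < β) {a b : ℝ} (hab : a < b) (s : ℝ) :
    Real.pi * ((intervalParam 0 1 (2 * Real.pi / β) s - intervalParam 0 1 (2 * Real.pi / β) a) *
      (intervalParam 0 1 (2 * Real.pi / β) b - intervalParam 0 1 (2 * Real.pi / β) s) /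
      (intervalParam 0 1 (2 * Real.pi / β) b - intervalParam 0 1 (2 * Real.pi / β) a)) =
    β * (Real.sinh (Real.pi / β * (s - a)) * Real.sinh (Real.pi / β * (b - s)) /
      Real.sinh (Real.pi / β * (b - a))) * (2 * Real.pi / β *
      ((intervalParam 0 1 (2 * Real.pi / β) s - 0) *
        (1 - intervalParam 0 1 (2 * Real.pi / β) s) / (1 - 0))) := by
  have hlt : Real.exp (Real.pi / β * a) < Real.exp (Real.pi / β * b) := by
    have := Real.pi_pos
    gcongr
  have hsinh : ∀ x y : ℝ, Real.sinh (Real.pi / β * (x - y)) =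
      (Real.exp (Real.pi / β * x) ^ 2 - Real.exp (Real.pi / β * y) ^ 2) /
        (2 * Real.exp (Real.pi / β * x) * Real.exp (Real.pi / β * y)) := fun x y => by
    rw [Real.sinh_eq, mul_sub, neg_sub, Real.exp_sub, Real.exp_sub]
    have h1 := Real.exp_pos (Real.pi / β * x)
    have h2 := Real.exp_pos (Real.pi / β * y)
    field_simp
  simp only [intervalParam_unit_eq β, hsinh]
  have hu := Real.exp_pos (Real.pi / β * s)
  have hv := Real.exp_pos (Real.pi / β * a)
  have hw := Real.exp_pos (Real.pi / β * b)
  generalize Real.exp (Real.pi / β * s) = u at *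
  generalize Real.exp (Real.pi / β * a) = v at *
  generalize Real.exp (Real.pi / β * b) = w at *
  have hwv : w ^ 2 - v ^ 2 ≠ 0 := by nlinarith
  have hdiff : ∀ x y : ℝ, x ^ 2 / (x ^ 2 + 1) - y ^ 2 / (y ^ 2 + 1) =
      (x ^ 2 - y ^ 2) / ((x ^ 2 + 1) * (y ^ 2 + 1)) := fun x y => by
    field_simp
    ring
  have h1u : 1 - u ^ 2 / (u ^ 2 + 1) = 1 / (u ^ 2 + 1) := by
    field_simp
    ring
  rw [hdiff, hdiff, hdiff, h1u, sub_zero, sub_zero]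
  field_simp

theorem isTestFunction_thermalIK {f : ℝ → ℝ} (hf : IsTestFunction f) (β a b : ℝ) :
    IsTestFunction (thermalIK β a b f) := by
  have heq : thermalIK β a b f = fun x => (-(2 * β * (Real.sinh (Real.pi / β * (x - a)) *
      Real.sinh (Real.pi / β * (b - x)) / Real.sinh (Real.pi / β * (b - a))))) * deriv f x := by
    funext x
    rw [thermalIK]
    ring
  rw [heq]
  refine hf.deriv.mul_left (((contDiff_const.mul (ContDiff.div_const (ContDiff.mul ?_ ?_) _))).neg)
  · exact Real.contDiff_sinh.comp (by fun_prop)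
  · exact Real.contDiff_sinh.comp (by fun_prop)

/-- The thermal field is the vacuum field in the conformal coordinate. -/
theorem vacuumIK_intervalPush (hβ : 0 < β) {a b : ℝ} (hab : a < b) {f : ℝ → ℝ}
    (hf : IsTestFunction f) :
    vacuumIK (intervalParam 0 1 (2 * Real.pi / β) a) (intervalParam 0 1 (2 * Real.pi / β) b)
      (intervalPush 0 1 (2 * Real.pi / β) f) =
    intervalPush 0 1 (2 * Real.pi / β) (thermalIK β a b f) := by
  have hc : 0 < 2 * Real.pi / β := by positivity
  have hφ := hf.intervalPush zero_lt_one hc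
  have hs := hf.tsupport_intervalPush zero_lt_one hc
  funext x
  by_cases hx : x ∈ Ioo (0 : ℝ) 1
  · rw [← intervalParam_coord hc hx, intervalPush_param zero_lt_one hc]
    set s := intervalCoord 0 1 (2 * Real.pi / β) x
    have h1 := (hφ.differentiable (intervalParam 0 1 (2 * Real.pi / β) s)).hasDerivAt.comp s
      (hasDerivAt_intervalParam zero_lt_one (2 * Real.pi / β) s)
    have h2 : intervalPush 0 1 (2 * Real.pi / β) f ∘ intervalParam 0 1 (2 * Real.pi / β) = f :=
      funext fun s => intervalPush_param zero_lt_one hc f s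
    rw [h2] at h1
    rw [vacuumIK, thermalIK, h1.deriv]
    linear_combination (-2 * deriv (intervalPush 0 1 (2 * Real.pi / β) f)
      (intervalParam 0 1 (2 * Real.pi / β) s)) * intervalParam_unit_field hβ hab s
  · have h0 : deriv (intervalPush 0 1 (2 * Real.pi / β) f) x = 0 :=
      image_eq_zero_of_notMem_tsupport fun h' => hx (hs (tsupport_deriv_subset h'))
    rw [intervalPush_of_notMem _ hx, vacuumIK, h0, mul_zero, neg_zero]

theorem Ioo_intervalParam_subset (β a b : ℝ) :
    Ioo (intervalParam 0 1 (2 * Real.pi / β) a) (intervalParam 0 1 (2 * Real.pi / β) b) ⊆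
      Ioo 0 1 := fun _ hx =>
  ⟨(intervalParam_mem zero_lt_one _ a).1.trans hx.1,
    hx.2.trans (intervalParam_mem zero_lt_one _ b).2⟩

theorem tsupport_comp_intervalParam_subset (hβ : 0 < β) {a b : ℝ} {φ : ℝ → ℝ}
    (hs : tsupport φ ⊆ Ioo (intervalParam 0 1 (2 * Real.pi / β) a)
      (intervalParam 0 1 (2 * Real.pi / β) b)) :
    tsupport (fun s => φ (intervalParam 0 1 (2 * Real.pi / β) s)) ⊆ Ioo a b := by
  have hc : 0 < 2 * Real.pi / β := by positivity
  have hmono := intervalParam_strictMono zero_lt_one hc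
  refine (tsupport_comp_subset_preimage φ (contDiff_intervalParam 0 1 _).continuous).trans ?_
  intro s h
  have h1 := hs h
  exact ⟨hmono.lt_iff_lt.mp h1.1, hmono.lt_iff_lt.mp h1.2⟩

theorem tsupport_intervalPush_subset (hβ : 0 < β) {a b : ℝ} {φ : ℝ → ℝ} (hφ : IsTestFunction φ)
    (hs : tsupport φ ⊆ Ioo a b) : tsupport (intervalPush 0 1 (2 * Real.pi / β) φ) ⊆
      Ioo (intervalParam 0 1 (2 * Real.pi / β) a) (intervalParam 0 1 (2 * Real.pi / β) b) := by
  have hc : 0 < 2 * Real.pi / β := by positivity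
  have hmono := intervalParam_strictMono zero_lt_one hc
  refine (hφ.tsupport_intervalPush_subset hc).trans ?_
  rintro _ ⟨s, h, rfl⟩
  exact ⟨hmono (hs h).1, hmono (hs h).2⟩

theorem indicator_vacuumIK_comp_intervalParam (hβ : 0 < β) {a b : ℝ} (hab : a < b) {f : ℝ → ℝ}
    (hf : IsTestFunction f) : (fun s => (Ioo (intervalParam 0 1 (2 * Real.pi / β) a)
      (intervalParam 0 1 (2 * Real.pi / β) b)).indicator
      (vacuumIK (intervalParam 0 1 (2 * Real.pi / β) a) (intervalParam 0 1 (2 * Real.pi / β) b)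
        (intervalPush 0 1 (2 * Real.pi / β) f)) (intervalParam 0 1 (2 * Real.pi / β) s)) =
      (Ioo a b).indicator (thermalIK β a b f) := by
  have hc : 0 < 2 * Real.pi / β := by positivity
  have hmono := intervalParam_strictMono zero_lt_one hc
  have hmem : ∀ s, intervalParam 0 1 (2 * Real.pi / β) s ∈
      Ioo (intervalParam 0 1 (2 * Real.pi / β) a) (intervalParam 0 1 (2 * Real.pi / β) b) ↔
      s ∈ Ioo a b := fun s => and_congr hmono.lt_iff_lt hmono.lt_iff_lt
  funext s
  rw [vacuumIK_intervalPush hβ hab hf]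
  by_cases hs : s ∈ Ioo a b
  · rw [indicator_of_mem hs, indicator_of_mem ((hmem s).mpr hs), intervalPush_param zero_lt_one hc]
  · rw [indicator_of_notMem hs, indicator_of_notMem (mt (hmem s).mp hs)]

/-- The modular Hamiltonian and the cutting projector of an interval at positive temperature. -/
theorem thermal_modularHamiltonian_cuttingProjector (hβ : 0 < β) {a b : ℝ} (hab : a < b)
    {f : ℝ → ℝ} (hf : IsTestFunction f) : ∃ H : StandardSubspace (ThermalSpace β),
      H.toClosedSubmodule = localSubspace (ThermalRep β) (Ioo a b) ∧
      ∃ hH : H.IsFactorial, ∃ v k w : ThermalSpace β,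
        ThermalRep β f v ∧
        H.ModularHamiltonianGraph v k ∧
        ThermalRep β (thermalIK β a b f) (Complex.I • k) ∧
        ThermalRep β ((Ioo a b).indicator (thermalIK β a b f)) w ∧
        ∃ hk : Complex.I • k ∈ (H.cuttingProjector hH).domain,
          H.cuttingProjector hH ⟨Complex.I • k, hk⟩ = w := by
  have hc : 0 < 2 * Real.pi / β := by positivity
  have hR := isThermalRep_thermalRep hβ
  -- The reference interval `(0, 1)` carries the whole thermal line. The interval `(a, b)` becomes
  -- `(a', b')` inside it, which has its own conformal unitary `e` to the model.
  obtain ⟨W, hW⟩ := hR.exists_unitary hβ (zero_lt_one (α := ℝ))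
  have hWtest : ∀ {g : ℝ → ℝ} {v : ThermalSpace β} {v' : VacuumSpace}, IsTestFunction g →
      ThermalRep β g v → VacuumRep (intervalPush 0 1 (2 * Real.pi / β) g) v' → W v = v' :=
    fun {g v v'} hg hv hv' => hW _ v v' ((hg.intervalPush zero_lt_one hc).isIntervalFunction hc
      (hg.tsupport_intervalPush zero_lt_one hc))
      (by simpa only [intervalPush_param zero_lt_one hc] using hv) hv'
  have hcomp := indicator_vacuumIK_comp_intervalParam hβ hab hf
  have hIK := vacuumIK_intervalPush hβ hab hf
  have hlt : intervalParam 0 1 (2 * Real.pi / β) a < intervalParam 0 1 (2 * Real.pi / β) b :=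
    intervalParam_strictMono zero_lt_one hc hab
  have hsub := Ioo_intervalParam_subset β a b
  have hts : ∀ {φ : ℝ → ℝ}, IsTestFunction φ → tsupport φ ⊆ Ioo a b →
      tsupport (intervalPush 0 1 (2 * Real.pi / β) φ) ⊆ Ioo (intervalParam 0 1 (2 * Real.pi / β) a)
        (intervalParam 0 1 (2 * Real.pi / β) b) := tsupport_intervalPush_subset hβ
  have htc : ∀ {φ : ℝ → ℝ}, tsupport φ ⊆ Ioo (intervalParam 0 1 (2 * Real.pi / β) a)
      (intervalParam 0 1 (2 * Real.pi / β) b) →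
      tsupport (fun s => φ (intervalParam 0 1 (2 * Real.pi / β) s)) ⊆ Ioo a b :=
    tsupport_comp_intervalParam_subset hβ
  set a' := intervalParam 0 1 (2 * Real.pi / β) a
  set b' := intervalParam 0 1 (2 * Real.pi / β) b
  set f' := intervalPush 0 1 (2 * Real.pi / β) f
  have hf' : IsTestFunction f' := hf.intervalPush zero_lt_one hc
  have hg := isTestFunction_thermalIK hf β a b
  obtain ⟨e, he⟩ := exists_isConformalUnitary hlt
  obtain ⟨v', hv'⟩ := hf'.exists_vacuumRep
  obtain ⟨κ', hκ'⟩ := (hf'.vacuumIK a' b').exists_vacuumRep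
  obtain ⟨w', hw'⟩ := exists_vacuumRep_indicator hlt (hf'.vacuumIK a' b') (vacuumIK_left a' b' f')
    (vacuumIK_right a' b' f')
  obtain ⟨v, hv⟩ := hR.exists_of_test hβ hf
  obtain ⟨κ, hκ⟩ := hR.exists_of_test hβ hg
  -- Here the truncation at `a'` and `b'` is regarded as a function on the larger interval `(0, 1)`.
  -- Its pullback is the truncation at `a` and `b` of a test function, so both integrability
  -- conditions are immediate.
  have hwI : IsIntervalFunction 0 1 (2 * Real.pi / β) ((Ioo a' b').indicator (vacuumIK a' b' f')) :=
    { measurable := (hf'.vacuumIK a' b').continuous.measurable.indicator measurableSet_Ioo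
      zero_off := fun x hx => indicator_of_notMem (fun h => hx (hsub h)) _
      integrable := (hf'.vacuumIK a' b').integrable.indicator measurableSet_Ioo
      memLp := (hf'.vacuumIK a' b').memLp.indicator measurableSet_Ioo
      integrable_param := hcomp ▸ hg.integrable.indicator measurableSet_Ioo
      memLp_param := hcomp ▸ hg.memLp.indicator measurableSet_Ioo }
  obtain ⟨w, hw⟩ := hR.exists_of_vacuumRep hβ zero_lt_one hwI hw'
  have hWv : W v = v' := hWtest hf hv hv'
  have hWκ : W κ = κ' := hWtest hg hκ (hIK ▸ hκ')
  have hWw : W w = w' := hW _ w w' hwI hw hw'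
  rw [hcomp] at hw
  have hsymm : ∀ u, (e.trans W.symm).symm u = e.symm (W u) := fun u => rfl
  -- Two logistic coordinates meet: `W` uses that of `(0, 1)` at scale `2π/β`, while `e` uses that
  -- of `(a', b')` at scale `1`. Test functions of the model go to `(a', b')` and are then pulled
  -- back to `(a, b)`.
  have hL : localSubspace (ThermalRep β) (Ioo a b) = hermitianSubspace (e.trans W.symm) := by
    refine localSubspace_eq_hermitianSubspace _ (fun φ u hφ hs hu => ?_) fun ψ m hψ hm => ?_
    · obtain ⟨u', hu'⟩ := (hφ.intervalPush zero_lt_one hc).exists_vacuumRep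
      rw [hsymm, hWtest hφ hu hu']
      exact he.isHermitian_symm hlt ((hφ.intervalPush zero_lt_one hc).isIntervalFunction one_pos
        (hts hφ hs)) hu'
    · have hφ := hψ.intervalPush hlt one_pos
      have hs := hψ.tsupport_intervalPush hlt one_pos
      have hem := he.exists_vacuumRep_apply hlt hψ hm
      have hχ := hφ.comp_intervalParam hc (hs.trans hsub)
      refine ⟨_, hχ, htc hs, ?_⟩
      obtain ⟨u, hu⟩ := hR.exists_of_test hβ hχ
      have hWu := hW _ u _ (hφ.isIntervalFunction hc (hs.trans hsub)) hu hem
      rwa [LinearIsometryEquiv.trans_apply, ← hWu, W.symm_apply_apply]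
  obtain ⟨H, h1, hH, k, h2, h3, hk⟩ := exists_standardSubspace_of_model _ hL (v := v) (κ := κ)
    (w := w) (by
      rw [hsymm, hsymm, hWκ, hWv]
      exact he.symm_vacuumIK hlt hf' hv' hκ')
    (by
      rw [hL, mem_hermitianSubspace, hsymm, hWw]
      exact he.isHermitian_symm hlt (isIntervalFunction_indicator_vacuumIK hlt one_pos hf') hw')
    (sub_mem_symplComp_localSubspace ThermalRep.sub (ThermalRep.im_inner_eq hβ) hκ hw hg.memLp)
  exact ⟨H, h1, hH, v, k, w, hv, h2, h3 ▸ hκ, hw, hk⟩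

end ThermalField

end

/-! ### The theorem, in the vacuum and at every positive temperature -/

theorem mainTheorem5 (a b : ℝ) (hab : a < b) (f : ℝ → ℝ) (hf : ContDiff ℝ ∞ f)
    (hfc : HasCompactSupport f) :
    -- vacuum
    (∃ H : StandardSubspace VacuumSpace,
      H.toClosedSubmodule = localSubspace VacuumRep (Ioo a b) ∧
      ∃ hH : H.IsFactorial, ∃ v k w : VacuumSpace,
        VacuumRep f v ∧
        H.ModularHamiltonianGraph v k ∧
        VacuumRep (vacuumIK a b f) (Complex.I • k) ∧
        VacuumRep ((Ioo a b).indicator (vacuumIK a b f)) w ∧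
        ∃ hk : Complex.I • k ∈ (H.cuttingProjector hH).domain,
          H.cuttingProjector hH ⟨Complex.I • k, hk⟩ = w) ∧
    -- every positive temperature
    (∀ β : ℝ, 0 < β →
      ∃ H : StandardSubspace (ThermalSpace β),
        H.toClosedSubmodule = localSubspace (ThermalRep β) (Ioo a b) ∧
        ∃ hH : H.IsFactorial, ∃ v k w : ThermalSpace β,
          ThermalRep β f v ∧
          H.ModularHamiltonianGraph v k ∧
          ThermalRep β (thermalIK β a b f) (Complex.I • k) ∧
          ThermalRep β ((Ioo a b).indicator (thermalIK β a b f)) w ∧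
          ∃ hk : Complex.I • k ∈ (H.cuttingProjector hH).domain,
            H.cuttingProjector hH ⟨Complex.I • k, hk⟩ = w) :=
  ⟨vacuum_modularHamiltonian_cuttingProjector hab ⟨hf, hfc⟩,
    fun _ hβ => thermal_modularHamiltonian_cuttingProjector hβ hab ⟨hf, hfc⟩⟩
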